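/- Let $(M,g_0)$ be a closed (compact, without boundary) smooth Riemannian manifold of dimension $n\ge 1$, with Riemannian distance $d_0$, Riemannian volume $\mu_0$ and $g_0$-geodesic balls $\mathbb B(x,r)$. For a function $f\colon M\to\mathbb R$ put $d\mu_f=e^{nf}\,d\mu_0$. If $f$ is continuous, let $d_f$ be the Riemannian distance of $g_f=e^{2f}g_0$, i.e. the infimum of $\int e^{f(\gamma)}|\dot\gamma|_{g_0}\,dt$ over $C^1$ curves $\gamma$ joining two given points. For general $f$, let $$d_f(x,y)=\lim_{\varepsilon\to0}\ \inf\Big\{\sum_{i=0}^{N-1}\delta_f(x_i,x_{i+1})\ :\ x_0=x,\ x_N=y,\ d_0(x_i,x_{i+1})\le\varepsilon\Big\},\qquad \delta_f(x,y)=2\Big(\frac{\mu_f(\mathbb B_{xy})}{\omega_n}\Big)^{1/n},$$ where $\mathbb B_{xy}$ is the $g_0$-ball of radius $\tfrac12 d_0(x,y)$ centred at the midpoint of $x$ and $y$ (unique for nearby points), and $\omega_n$ is the volume of the unit ball of $\mathbb R^n$. The weight $e^{nf}$ is called a strong $A_\infty$ weight with respect to $g_0$, with constants $\theta,\eta>0$,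 if $\mu_f(M)<\infty$ and 1. $\mu_f(\mathbb B(x,2r))\le\theta\,\mu_f(\mathbb B(x,r))$ for all $x\in M$ and $0<r\le\eta$; 2. $\theta^{-n}d_f(x,y)^n\le\mu_f\big(\mathbb B(x,d_0(x,y))\big)\le\theta^n d_f(x,y)^n$ for all $x,y\in M$ with $d_0(x,y)\le\eta$. Theorem. There is $\eta>0$, depending only on $(M,g_0)$, and for every real $\mathbf I$ there is $\theta>0$, depending only on $(M,g_0)$ and $\mathbf I$, such that for every locally integrable $f\colon M\to\mathbb R$ with a weak differential $df$ satisfying $\|df\|_{L^n(M,g_0)}\le\mathbf I$, the weight $e^{nf}$ is a strong $A_\infty$ weight with respect to $g_0$ with constants $(\theta,\eta)$. When $f$ is continuous, this holds for both of the above descriptions of $d_f$. -/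

import Mathlib

open MeasureTheory Manifold Bundle
open scoped ENNReal ContDiff Topology

noncomputable section

namespace ConformalWeight

section Volume

variable {n : ℕ} {M : Type*} [TopologicalSpace M] [ChartedSpace (EuclideanSpace ℝ (Fin n)) M]

/-- The differential at `y` of the inverse of the preferred chart at `x₀`, as a map from `ℝⁿ` to
the tangent space at the point with coordinates `y`. -/
def chartFrame (x₀ : M) (y : EuclideanSpace ℝ (Fin n)) :
    EuclideanSpace ℝ (Fin n) →L[ℝ] TangentSpace (𝓡 n) ((extChartAt (𝓡 n) x₀).symm y) :=
  mfderiv 𝓘(ℝ, EuclideanSpace ℝ (Fin n)) (𝓡 n) (extChartAt (𝓡 n) x₀).symm y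

variable [RiemannianBundle (fun x : M ↦ TangentSpace (𝓡 n) x)]

/-- The matrix `g_ij` of the Riemannian metric in the preferred chart at `x₀`, at coordinates `y`:
the inner products of the coordinate vector fields. -/
def metricMatrix (x₀ : M) (y : EuclideanSpace ℝ (Fin n)) : Matrix (Fin n) (Fin n) ℝ :=
  Matrix.of fun i j ↦
    inner ℝ (chartFrame x₀ y (EuclideanSpace.single i 1))
      (chartFrame x₀ y (EuclideanSpace.single j 1))

variable [MeasurableSpace M]

/-- The Riemannian volume on the domain of the preferred chart at `x₀` (and zero outside this
domain): the measure `√(det g_ij) dy` on the chart target, transported to `M`. -/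
def chartVolume (x₀ : M) : Measure M :=
  ((volume.restrict (extChartAt (𝓡 n) x₀).target).withDensity
    fun y ↦ ENNReal.ofReal √(metricMatrix x₀ y).det).map (extChartAt (𝓡 n) x₀).symm

variable (n M) in
/-- The Riemannian volume measure `μ₀`. The local volumes agree on overlaps of chart domains, so
their supremum, as measures, is the measure on `M` that restricts to each of them. -/
def riemannianVolume : Measure M :=
  ⨆ x₀ : M, chartVolume (n := n) x₀

variable (n) in
/-- The measure `dμ_f = e^{nf} dμ₀`, the Riemannian volume of `g_f = e^{2f} g₀`. -/
def conformalVolume (f : M → ℝ) : Measure M :=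
  (riemannianVolume n M).withDensity fun x ↦ ENNReal.ofReal (Real.exp (n * f x))

end Volume

section WeakDifferential

variable {n : ℕ} {M : Type*} [TopologicalSpace M] [ChartedSpace (EuclideanSpace ℝ (Fin n)) M]

/-- The covector field `α` is the weak (distributional) differential of `f`: in the preferred
charts, `f` and the components of `α` are locally integrable and satisfy the integration by parts
formula against every smooth function with compact support in the chart target. -/
structure HasWeakDifferential (f : M → ℝ) (α : (x : M) → TangentSpace (𝓡 n) x →L[ℝ] ℝ) :
    Prop where
  locallyIntegrable (x₀ : M) :
    LocallyIntegrableOn (fun y ↦ f ((extChartAt (𝓡 n) x₀).symm y))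
      (extChartAt (𝓡 n) x₀).target
  locallyIntegrable_differential (x₀ : M) (v : EuclideanSpace ℝ (Fin n)) :
    LocallyIntegrableOn (fun y ↦ α ((extChartAt (𝓡 n) x₀).symm y) (chartFrame x₀ y v))
      (extChartAt (𝓡 n) x₀).target
  integral_eq (x₀ : M) (v : EuclideanSpace ℝ (Fin n)) (ψ : EuclideanSpace ℝ (Fin n) → ℝ)
    (hψ : ContDiff ℝ ∞ ψ) (hc : HasCompactSupport ψ)
    (hs : tsupport ψ ⊆ (extChartAt (𝓡 n) x₀).target) :
    ∫ y, f ((extChartAt (𝓡 n) x₀).symm y) * fderiv ℝ ψ y v =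
      -∫ y, α ((extChartAt (𝓡 n) x₀).symm y) (chartFrame x₀ y v) * ψ y

variable [RiemannianBundle (fun x : M ↦ TangentSpace (𝓡 n) x)] [MeasurableSpace M]

/-- The norm `‖α‖_{L^n}` of a covector field, for the pointwise norm dual to `g₀` and for `μ₀`. -/
def covectorLpNorm (α : (x : M) → TangentSpace (𝓡 n) x →L[ℝ] ℝ) : ℝ≥0∞ :=
  eLpNorm (fun x ↦ ‖α x‖) n (riemannianVolume n M)

end WeakDifferential

section Distances

variable {n : ℕ} {M : Type*} [EMetricSpace M] [ChartedSpace (EuclideanSpace ℝ (Fin n)) M]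
  [RiemannianBundle (fun x : M ↦ TangentSpace (𝓡 n) x)]

variable (n) in
/-- The Riemannian distance of the conformal metric `g_f = e^{2f} g₀`, that is, the infimum of the
lengths of `C¹` paths for the norm `e^f |·|_{g₀}` on tangent vectors. -/
def conformalEDist (f : M → ℝ) (x y : M) : ℝ≥0∞ :=
  letI : ∀ z : M, ENorm (TangentSpace (𝓡 n) z) :=
    fun z ↦ ⟨fun v ↦ ENNReal.ofReal (Real.exp (f z)) * ‖v‖ₑ⟩
  riemannianEDist (𝓡 n) x y

variable [MeasurableSpace M]

variable (n) in
/-- The quantity `δ_f(x, y) = 2 (μ_f(B_{xy}) / ω_n)^{1/n}`, where `B_{xy}` is the `g₀`-ball of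
radius `d₀(x, y) / 2` around the midpoint of `x` and `y`, and `ω_n` is the volume of the unit ball
of `ℝⁿ`. For `x` and `y` close to each other the midpoint is unique, and only such pairs matter
below; in general the infimum over the midpoints is taken. -/
def ballGauge (f : M → ℝ) (x y : M) : ℝ≥0∞ :=
  ⨅ (m : M) (_ : edist m x = edist x y / 2 ∧ edist m y = edist x y / 2),
    2 * (conformalVolume n f (Metric.eball m (edist x y / 2)) /
      volume (Metric.ball (0 : EuclideanSpace ℝ (Fin n)) 1)) ^ (1 / (n : ℝ))

variable (n) in
/-- The distance associated with the weight `e^{nf}` when `f` need not be continuous: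
the limit as `ε → 0` (a supremum, by monotonicity) of the infimum of `∑ δ_f(x_i, x_{i+1})` over
chains from `x` to `y` whose steps have `g₀`-length at most `ε`. -/
def weightEDist (f : M → ℝ) (x y : M) : ℝ≥0∞ :=
  ⨆ (ε : ℝ≥0∞) (_ : 0 < ε),
    ⨅ (N : ℕ) (p : ℕ → M)
      (_ : p 0 = x ∧ p N = y ∧ ∀ i < N, edist (p i) (p (i + 1)) ≤ ε),
      ∑ i ∈ Finset.range N, ballGauge n f (p i) (p (i + 1))

variable (n) in
/-- `e^{nf}` is a strong `A_∞` weight with respect to `g₀`, with constants `(θ, η)`, where `d` is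
the distance attached to `f`. Balls are balls for the fixed distance `d₀ = edist`. -/
structure IsStrongAInftyWeight (f : M → ℝ) (d : M → M → ℝ≥0∞) (θ η : ℝ) : Prop where
  volume_lt_top : conformalVolume n f Set.univ < ⊤
  doubling (x : M) (r : ℝ) (hr : 0 < r) (hη : r ≤ η) :
    conformalVolume n f (Metric.eball x (ENNReal.ofReal (2 * r))) ≤
      ENNReal.ofReal θ * conformalVolume n f (Metric.eball x (ENNReal.ofReal r))
  distance_le (x y : M) (hη : edist x y ≤ ENNReal.ofReal η) :
    d x y ^ n / ENNReal.ofReal θ ^ n ≤ conformalVolume n f (Metric.eball x (edist x y))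
  le_distance (x y : M) (hη : edist x y ≤ ENNReal.ofReal η) :
    conformalVolume n f (Metric.eball x (edist x y)) ≤ ENNReal.ofReal θ ^ n * d x y ^ n

end Distances

end ConformalWeight

end

/-! In a chart, let `a x r` be the average of `f` at the point `x` and the scale `r`, taken with a
kernel that lives in the annulus of radii `r/2` and `r`. Changing the scale by a factor of at most
two, or the point by at most `r`, changes `a` by a quantity whose `n`-th power is at most a constant
times the energy `∫ |df|^n` nearby. No power of `r` appears, because the exponent equals the
dimension. The kernel avoids its centre, so a change of scale only sees the energy of an annulus.
The annuli at successive halvings have bounded overlap, so the `n`-th powers of the increments along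
all scales at one point have a sum bounded by the total energy. This is `ScaleControl`, and the core
of the proof uses nothing else.

Two facts follow. At every point the averages drift by at most a small slope times the number of
halvings, plus a constant (`abs_sub_le_linear`). If the energy of the balls around a point decays
linearly in the radius, then the averages stay bounded there, by a geometric series
(`abs_sub_le_of_mass_le`). The remaining "heavy" points are covered, by Vitali, by balls whose radii
have a small sum: the heavy set is small in the sense of one-dimensional content.

Upper bounds: for any measure whose balls grow at most linearly, the slope can be chosen so small
that `exp (q a)` on successive heavy sets loses against the decay of their measure
(`lintegral_exp_le`). Applied to normalized Lebesgue measure, with Fatou, this bounds `μ_f (B(x,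
r))` by a multiple of `(r exp (a x r))^n`; Jensen gives the reverse bound. Doubling is then
immediate, since `a` hardly changes from `r` to `2r`. Applied to equally spaced points of a segment,
the same estimate bounds the sum of `δ_f` along arbitrarily fine chains by a multiple of `r exp (a x
r)`, hence `d_f^n` by the measure of the ball.

Lower bound: along a chain that leaves a ball of radius `s`, the distances to the centre sweep out
an interval of length comparable with `s`. The steps near heavy points cover at most half of it. At
the others the average at the scale of the step is at least `a x s - C`, so the sum of `δ_f` is at
least a multiple of `s exp (a x s)` (`le_sum_exp_of_chain`).

On the manifold, small charts are bilipschitz and distort volume by a bounded factor, and finitely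
many suffice by compactness. The scale `η` comes from the charts alone; the energy bound only enters
the constants. For continuous `f` the oscillation at small scales is at most one, so each small step
has nearly the same length for both descriptions of `d_f`. The two distances are therefore
comparable with constants that do not depend on the modulus of continuity. -/

noncomputable section

namespace ConformalWeight

open Metric Set Filter

/-! ### Averages over scales, controlled by a measure. -/

section Scales

/-- Two-sided control of averages `a x r` (at the point `x` and the scale `r ≤ R`) by a measure `ν`
of mass at most `J`: vertical increments are controlled by the mass of an annulus, horizontal
increments by the total mass. -/
structure ScaleControl {X : Type*} [PseudoMetricSpace X] [MeasurableSpace X] (n : ℕ)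
    (ν : Measure X) (a : X → ℝ → ℝ) (S : Set X) (R J : ℝ) : Prop where
  one_le_dim : 1 ≤ n
  one_le : 1 ≤ J
  mass_le : ν univ ≤ ENNReal.ofReal J
  vertical : ∀ x ∈ S, ∀ r r' : ℝ, 0 < r → r ≤ R → r / 2 ≤ r' → r' ≤ r →
    |a x r - a x r'| ^ n ≤ ν.real (closedBall x r \ ball x (r / 4))
  horizontal : ∀ x ∈ S, ∀ z ∈ S, ∀ r : ℝ, 0 < r → r ≤ R → dist x z ≤ r → |a x r - a z r| ≤ J

/-- A number above one is at most its `n`-th power. This is what the normalization `1 ≤ J` is for: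
bounds on `n`-th powers of increments become bounds on the increments, with the same constant. -/
lemma le_of_pow_le_of_one_le {u J : ℝ} {n : ℕ} (hn : 1 ≤ n) (hJ : 1 ≤ J) (h : u ^ n ≤ J) :
    u ≤ J := by
  by_contra! hu
  have h1 : 1 ≤ u := hJ.trans hu.le
  have : u ^ 1 ≤ u ^ n := pow_le_pow_right₀ h1 hn
  linarith [pow_one u]

/-- Either `u ≤ δ`, or `(u / δ)^(n-1) ≥ 1`. It trades a sum of `n`-th powers for a sum of first
powers, at the price of `δ` per term. -/
lemma le_add_pow_div {u δ : ℝ} (n : ℕ) (hn : 1 ≤ n) (hu : 0 ≤ u) (hδ : 0 < δ) :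
    u ≤ δ + u ^ n / δ ^ (n - 1) := by
  rcases le_total u δ with h | h
  · have : 0 ≤ u ^ n / δ ^ (n - 1) := by positivity
    linarith
  · have : u ≤ u ^ n / δ ^ (n - 1) := by
      rw [le_div_iff₀ (by positivity)]
      calc u * δ ^ (n - 1) ≤ u * u ^ (n - 1) := by gcongr
        _ = u ^ n := by rw [← pow_succ', Nat.sub_add_cancel hn]
    linarith

lemma sum_range_sub_add_three (N : ℕ → ℝ) (m : ℕ) :
    ∑ k ∈ Finset.range m, (N k - N (k + 3)) =
      N 0 + N 1 + N 2 - N m - N (m + 1) - N (m + 2) := by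
  induction m with
  | zero => rw [Finset.sum_range_zero]; ring
  | succ m ih => rw [Finset.sum_range_succ, ih]; ring_nf

lemma abs_sub_le_sum {X : Type*} (a : X → ℝ → ℝ) (x : X) (r : ℝ) (m : ℕ) :
    |a x r - a x (r / 2 ^ m)| ≤
      ∑ k ∈ Finset.range m, |a x (r / 2 ^ k) - a x (r / 2 ^ (k + 1))| := by
  have := Finset.sum_range_sub' (fun k ↦ a x (r / 2 ^ k)) m
  rw [pow_zero, div_one] at this
  rw [← this]
  exact Finset.abs_sum_le_sum_abs _ _

variable {X : Type*} [PseudoMetricSpace X] [MeasurableSpace X]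

namespace ScaleControl

variable {n : ℕ} {ν : Measure X} {a : X → ℝ → ℝ} {S : Set X} {R J : ℝ}

lemma isFiniteMeasure (h : ScaleControl n ν a S R J) : IsFiniteMeasure ν :=
  ⟨h.mass_le.trans_lt ENNReal.ofReal_lt_top⟩

lemma real_le (h : ScaleControl n ν a S R J) (s : Set X) : ν.real s ≤ J := by
  have := h.isFiniteMeasure
  refine (measureReal_mono (subset_univ s)).trans ?_
  exact ENNReal.toReal_le_of_le_ofReal (by linarith [h.one_le]) h.mass_le

lemma vertical_le (h : ScaleControl n ν a S R J) {x : X} (hx : x ∈ S) {r r' : ℝ} (hr : 0 < r)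
    (hR : r ≤ R) (h1 : r / 2 ≤ r') (h2 : r' ≤ r) : |a x r - a x r'| ≤ J :=
  le_of_pow_le_of_one_le h.one_le_dim h.one_le
    ((h.vertical x hx r r' hr hR h1 h2).trans (h.real_le _))

lemma vertical_halving (h : ScaleControl n ν a S R J) {x : X} (hx : x ∈ S) {r : ℝ} (hr : 0 < r)
    (hR : r ≤ R) (k : ℕ) : |a x (r / 2 ^ k) - a x (r / 2 ^ (k + 1))| ^ n ≤
      ν.real (closedBall x (r / 2 ^ k) \ ball x (r / 2 ^ k / 4)) := by
  have h1 : r / 2 ^ k ≤ r := div_le_self hr.le (one_le_pow₀ (by norm_num))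
  have h2 : r / 2 ^ (k + 1) = r / 2 ^ k / 2 := by rw [pow_succ, div_div]
  refine h.vertical x hx _ _ (by positivity) (h1.trans hR) h2.ge ?_
  rw [h2]; exact half_le_self (by positivity)

/-- The ball of radius `r / 2^(k+3)` lies inside the removed ball of the `k`-th annulus, so the sum
telescopes with gap three, and at most three masses survive. -/
lemma sum_annuli_le [OpensMeasurableSpace X] (h : ScaleControl n ν a S R J) (x : X) {r : ℝ}
    (hr : 0 < r) (m : ℕ) :
    ∑ k ∈ Finset.range m, ν.real (closedBall x (r / 2 ^ k) \ ball x (r / 2 ^ k / 4)) ≤ 3 * J := by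
  have := h.isFiniteMeasure
  set N : ℕ → ℝ := fun k ↦ ν.real (closedBall x (r / 2 ^ k)) with hN
  have key : ∀ k, ν.real (closedBall x (r / 2 ^ k) \ ball x (r / 2 ^ k / 4)) ≤ N k - N (k + 3) := by
    intro k
    have hpos : 0 < r / 2 ^ k := by positivity
    rw [measureReal_sdiff (ball_subset_closedBall.trans (closedBall_subset_closedBall (by linarith)))
      measurableSet_ball]
    have : N (k + 3) ≤ ν.real (ball x (r / 2 ^ k / 4)) := by
      refine measureReal_mono (closedBall_subset_ball ?_)
      rw [pow_add, ← div_div]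
      norm_num
      linarith
    simp only [hN] at this ⊢
    linarith
  refine (Finset.sum_le_sum fun k _ ↦ key k).trans ?_
  rw [sum_range_sub_add_three]
  have h0 : ∀ k, 0 ≤ N k := fun k ↦ measureReal_nonneg
  have h1 : ∀ k, N k ≤ J := fun k ↦ h.real_le _
  linarith [h0 m, h0 (m + 1), h0 (m + 2), h1 0, h1 1, h1 2]

/-- Averages grow at most linearly, with an arbitrarily small slope, in the number of halvings. -/
lemma abs_sub_le_linear [OpensMeasurableSpace X] (h : ScaleControl n ν a S R J) {x : X}
    (hx : x ∈ S) {r : ℝ} (hr : 0 < r) (hR : r ≤ R) {δ : ℝ} (hδ : 0 < δ) (m : ℕ) :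
    |a x r - a x (r / 2 ^ m)| ≤ δ * m + 3 * J / δ ^ (n - 1) := by
  refine (abs_sub_le_sum a x r m).trans ?_
  calc ∑ k ∈ Finset.range m, |a x (r / 2 ^ k) - a x (r / 2 ^ (k + 1))|
      ≤ ∑ k ∈ Finset.range m,
        (δ + ν.real (closedBall x (r / 2 ^ k) \ ball x (r / 2 ^ k / 4)) / δ ^ (n - 1)) := by
        refine Finset.sum_le_sum fun k _ ↦ ?_
        refine (le_add_pow_div n h.one_le_dim (abs_nonneg _) hδ).trans ?_
        gcongr
        exact h.vertical_halving hx hr hR k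
    _ = δ * m + (∑ k ∈ Finset.range m,
        ν.real (closedBall x (r / 2 ^ k) \ ball x (r / 2 ^ k / 4))) / δ ^ (n - 1) := by
        rw [Finset.sum_add_distrib, Finset.sum_div]
        simp [mul_comm]
    _ ≤ _ := by
        gcongr
        exact h.sum_annuli_le x hr m

lemma abs_sub_le_mul (h : ScaleControl n ν a S R J) {x : X}
    (hx : x ∈ S) {r : ℝ} (hr : 0 < r) (hR : r ≤ R) (m : ℕ) :
    |a x r - a x (r / 2 ^ m)| ≤ m * J := by
  refine (abs_sub_le_sum a x r m).trans ?_
  refine (Finset.sum_le_card_nsmul _ _ J fun k _ ↦ ?_).trans (by simp)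
  have := h.isFiniteMeasure
  exact le_of_pow_le_of_one_le h.one_le_dim h.one_le
    ((h.vertical_halving hx hr hR k).trans (h.real_le _))

/-- The ratio of the geometric series controlling the averages at points of small mass. -/
def ratio (n : ℕ) : ℝ := (1 / 2 : ℝ) ^ (1 / (n : ℝ))

lemma ratio_pos (n : ℕ) : 0 < ratio n := by unfold ratio; positivity

lemma ratio_lt_one {n : ℕ} (hn : 1 ≤ n) : ratio n < 1 := by
  unfold ratio
  apply Real.rpow_lt_one (by norm_num) (by norm_num)
  have : (0 : ℝ) < n := by exact_mod_cast hn
  positivity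

lemma ratio_pow {n : ℕ} (hn : 1 ≤ n) : ratio n ^ n = 1 / 2 := by
  unfold ratio
  rw [← Real.rpow_natCast, ← Real.rpow_mul (by norm_num), one_div_mul_cancel, Real.rpow_one]
  exact_mod_cast (by omega : n ≠ 0)

/-- The sum of the geometric series of ratio `ratio n`. -/
def geomBound (n : ℕ) : ℝ := (1 - ratio n)⁻¹

lemma sum_ratio_le {n : ℕ} (hn : 1 ≤ n) (m : ℕ) :
    ∑ k ∈ Finset.range m, ratio n ^ k ≤ geomBound n := by
  rw [geomBound, ← tsum_geometric_of_lt_one (ratio_pos n).le (ratio_lt_one hn)]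
  exact (summable_geometric_of_lt_one (ratio_pos n).le (ratio_lt_one hn)).sum_le_tsum _
    fun k _ ↦ pow_nonneg (ratio_pos n).le k

/-- If the mass of the balls around `x` decays linearly in the radius, the averages are bounded. -/
lemma abs_sub_le_of_mass_le [OpensMeasurableSpace X] (h : ScaleControl n ν a S R J) {x : X}
    (hx : x ∈ S) {r : ℝ} (hr : 0 < r) (hR : r ≤ R) {H : ℝ} (hH : 1 ≤ H) (m : ℕ)
    (hm : ∀ k < m, ν.real (closedBall x (r / 2 ^ k)) ≤ H / 2 ^ k) :
    |a x r - a x (r / 2 ^ m)| ≤ H * geomBound n := by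
  have := h.isFiniteMeasure
  refine (abs_sub_le_sum a x r m).trans ?_
  calc _ ≤ ∑ k ∈ Finset.range m, H * ratio n ^ k := by
        refine Finset.sum_le_sum fun k hk ↦ ?_
        have h1 := (h.vertical_halving hx hr hR k).trans
          ((measureReal_mono sdiff_subset).trans (hm k (Finset.mem_range.1 hk)))
        -- Taking the `n`-th root: since `ratio n ^ n = 1/2` and `H ≤ H^n`, the bound `H / 2^k` is
        -- at most the `n`-th power of `H * ratio n ^ k`.
        refine le_of_pow_le_pow_left₀ (by have := h.one_le_dim; omega)
          (mul_nonneg (by linarith) (pow_nonneg (ratio_pos n).le k)) (h1.trans ?_)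
        rw [mul_pow, ← pow_mul, mul_comm k n, pow_mul, ratio_pow h.one_le_dim, one_div, inv_pow,
          div_eq_mul_inv]
        gcongr
        exact le_self_pow₀ hH (by have := h.one_le_dim; omega)
    _ = H * ∑ k ∈ Finset.range m, ratio n ^ k := by rw [Finset.mul_sum]
    _ ≤ _ := by
        gcongr
        exact sum_ratio_le h.one_le_dim m

end ScaleControl

end Scales

/-! ### Heavy points: Vitali coverings, exponential integrability, chains. -/

section Covering

/-- A Vitali covering argument: among balls whose radius is controlled by their mass, there is a
disjoint subfamily that covers everything after enlargement and whose radii have a bounded sum. -/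
lemma exists_subfamily_sum_radius_le {X ι : Type*} [PseudoMetricSpace X]
    [TopologicalSpace.SeparableSpace X] [MeasurableSpace X] [OpensMeasurableSpace X]
    (ν : Measure X) [IsFiniteMeasure ν] (t : Set ι) (x : ι → X) (ρ : ι → ℝ) {r c : ℝ}
    (hc : 0 ≤ c) (hpos : ∀ i ∈ t, 0 < ρ i) (hr : ∀ i ∈ t, ρ i ≤ r)
    (hν : ∀ i ∈ t, ρ i ≤ c * ν.real (closedBall (x i) (ρ i))) :
    ∃ u ⊆ t, u.Countable ∧
      (∀ i ∈ t, ∃ j ∈ u, dist (x i) (x j) ≤ 3 * ρ j ∧ ρ i ≤ 2 * ρ j) ∧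
      ∑' i : u, ENNReal.ofReal (ρ i) ≤ ENNReal.ofReal c * ν univ := by
  obtain ⟨u, hut, hdisj, hcov⟩ := Vitali.exists_disjoint_subfamily_covering_enlargement
    (fun i ↦ closedBall (x i) (ρ i)) t ρ 2 one_lt_two (fun i hi ↦ (hpos i hi).le) r hr
    (fun i hi ↦ nonempty_closedBall.2 (hpos i hi).le)
  refine ⟨u, hut, ?_, ?_, ?_⟩
  · refine hdisj.countable_of_nonempty_interior fun i hi ↦ ⟨x i, ?_⟩
    exact ball_subset_interior_closedBall (mem_ball_self (hpos i (hut hi)))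
  · intro i hi
    -- The two balls share the point `z`, so their centres are at distance at most `ρ i + ρ j ≤ 3 ρ
    -- j`.
    obtain ⟨j, hj, ⟨z, hzi, hzj⟩, hij⟩ := hcov i hi
    refine ⟨j, hj, ?_, hij⟩
    have := dist_triangle_left (x i) (x j) z
    rw [mem_closedBall] at hzi hzj
    linarith
  · calc ∑' i : u, ENNReal.ofReal (ρ i)
        ≤ ∑' i : u, ENNReal.ofReal c * ν (closedBall (x i) (ρ i)) := by
          refine ENNReal.tsum_le_tsum fun i ↦ ?_
          refine (ENNReal.ofReal_le_ofReal (hν i (hut i.2))).trans ?_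
          rw [ENNReal.ofReal_mul hc, measureReal_def, ENNReal.ofReal_toReal (measure_ne_top _ _)]
      _ = ENNReal.ofReal c * ∑' i : u, ν (closedBall (x i) (ρ i)) := ENNReal.tsum_mul_left
      _ ≤ ENNReal.ofReal c * ν univ := by
          gcongr
          refine tsum_measure_le_measure_univ
            (fun i ↦ measurableSet_closedBall.nullMeasurableSet) ?_
          intro i j hij
          exact (hdisj i.2 j.2 (fun h ↦ hij (Subtype.ext h))).aedisjoint

variable {X : Type*} [PseudoMetricSpace X] [MeasurableSpace X] [OpensMeasurableSpace X]

/-- The points around which some ball, of radius between `r / 2 ^ m` and `r / 2 ^ k₀`, has a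
mass that is large with respect to its radius. -/
def heavyPoints (ν : Measure X) (r : ℝ) (k₀ m : ℕ) : Set X :=
  {z | ∃ k, k₀ ≤ k ∧ k < m ∧
    r / 2 ^ k ≤ r / 2 ^ k₀ * ν.real (closedBall z (r / 2 ^ k))}

/-- The Vitali balls of the heavy points have radii of total size at most `(r / 2^k₀) ν(univ)`, and
the linear growth of `κ` turns a sum of radii into a measure. Growth is only needed at scales above
`r / 2^m`, which admits discrete measures `κ`. -/
lemma measure_heavyPoints_le [TopologicalSpace.SeparableSpace X] (ν : Measure X)
    [IsFiniteMeasure ν] (κ : Measure X) (T : Set X) {r D : ℝ} (hr : 0 < r) (hD : 0 ≤ D) (k₀ m : ℕ)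
    (hκ : ∀ z ∈ T, ∀ t, r / 2 ^ m ≤ t → t ≤ r → κ (closedBall z (3 * t)) ≤ ENNReal.ofReal (D * t)) :
    κ (heavyPoints ν r k₀ m ∩ T) ≤ ENNReal.ofReal (D * (r / 2 ^ k₀)) * ν univ := by
  classical
  have hex : ∀ z : X, ∃ k : ℕ, z ∈ heavyPoints ν r k₀ m → k₀ ≤ k ∧ k < m ∧
      r / 2 ^ k ≤ r / 2 ^ k₀ * ν.real (closedBall z (r / 2 ^ k)) := by
    intro z
    by_cases hz : z ∈ heavyPoints ν r k₀ m
    · obtain ⟨k, hk⟩ := hz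
      exact ⟨k, fun _ ↦ hk⟩
    · exact ⟨0, fun h ↦ absurd h hz⟩
  choose k hk using hex
  have hle : ∀ j : ℕ, r / 2 ^ j ≤ r := fun j ↦ div_le_self hr.le (one_le_pow₀ (by norm_num))
  obtain ⟨u, hut, hcount, hcov, hsum⟩ := exists_subfamily_sum_radius_le ν
    (heavyPoints ν r k₀ m ∩ T) id (fun z ↦ r / 2 ^ k z) (r := r) (c := r / 2 ^ k₀) (by positivity)
    (fun z _ ↦ by positivity) (fun z _ ↦ hle _) (fun z hz ↦ (hk z hz.1).2.2)
  have hsub : heavyPoints ν r k₀ m ∩ T ⊆ ⋃ z ∈ u, closedBall z (3 * (r / 2 ^ k z)) := by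
    intro z hz
    obtain ⟨w, hw, hd, -⟩ := hcov z hz
    exact mem_biUnion hw hd
  calc κ (heavyPoints ν r k₀ m ∩ T) ≤ κ (⋃ z ∈ u, closedBall z (3 * (r / 2 ^ k z))) :=
        measure_mono hsub
    _ ≤ ∑' z : u, κ (closedBall (z : X) (3 * (r / 2 ^ k z))) := measure_biUnion_le _ hcount _
    _ ≤ ∑' z : u, ENNReal.ofReal D * ENNReal.ofReal (r / 2 ^ k z) := by
        refine ENNReal.tsum_le_tsum fun z ↦ ?_
        rw [← ENNReal.ofReal_mul hD]
        refine hκ z (hut z.2).2 _ ?_ (hle _)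
        have := (hk z (hut z.2).1).2.1
        gcongr
        norm_num
    _ = ENNReal.ofReal D * ∑' z : u, ENNReal.ofReal (r / 2 ^ k z) := ENNReal.tsum_mul_left
    _ ≤ ENNReal.ofReal D * (ENNReal.ofReal (r / 2 ^ k₀) * ν univ) := by gcongr
    _ = _ := by rw [ENNReal.ofReal_mul hD, mul_assoc]

namespace ScaleControl

variable {n : ℕ} {ν : Measure X} {a : X → ℝ → ℝ} {S : Set X} {R J : ℝ}

/-- Three moves: from `x` to `z` at scale `r`; down `k₀` halvings with slope `δ`; then from `k₀` to
`m` with bounded cost, because the mass around `z` decays linearly below scale `r / 2^k₀`. -/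
lemma le_of_notMem_heavyPoints (h : ScaleControl n ν a S R J) {x z : X} {r : ℝ} (hr : 0 < r)
    (hR : r ≤ R) (hx : x ∈ S) (hz : z ∈ S) (hzx : dist x z ≤ r) {δ : ℝ} (hδ : 0 < δ) {k₀ m : ℕ}
    (hkm : k₀ ≤ m) (hn : z ∉ heavyPoints ν r k₀ m) :
    a z (r / 2 ^ m) ≤ a x r + (J + 3 * J / δ ^ (n - 1) + geomBound n) + δ * k₀ := by
  have h1 := h.horizontal x hx z hz r hr hR hzx
  have h2 := h.abs_sub_le_linear hz hr hR hδ k₀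
  have hrk : r / 2 ^ k₀ ≤ r := div_le_self hr.le (one_le_pow₀ (by norm_num))
  have h3 := h.abs_sub_le_of_mass_le hz (r := r / 2 ^ k₀) (by positivity) (hrk.trans hR) le_rfl
    (m - k₀) ?_
  · have : r / 2 ^ k₀ / 2 ^ (m - k₀) = r / 2 ^ m := by
      rw [div_div, ← pow_add, Nat.add_sub_cancel' hkm]
    rw [this, one_mul] at h3
    linarith [abs_le.1 h1, abs_le.1 h2, abs_le.1 h3, neg_abs_le (a x r - a z r),
      neg_abs_le (a z r - a z (r / 2 ^ k₀)), neg_abs_le (a z (r / 2 ^ k₀) - a z (r / 2 ^ m))]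
  · intro j hj
    by_contra! hlt
    refine hn ⟨k₀ + j, by omega, by omega, ?_⟩
    have e : r / 2 ^ (k₀ + j) = r / 2 ^ k₀ / 2 ^ j := by rw [pow_add, div_div]
    rw [e]
    calc r / 2 ^ k₀ / 2 ^ j = r / 2 ^ k₀ * (1 / 2 ^ j) := by ring
      _ ≤ _ := by gcongr

variable [TopologicalSpace.SeparableSpace X]

/-- Exponential integrability of the averages at small scales, for every measure whose balls have
at most linear growth. -/
lemma lintegral_exp_le (h : ScaleControl n ν a S R J) {q D : ℝ} (hq : 0 < q) (hD : 0 ≤ D)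
    {x : X} {r : ℝ} (hr : 0 < r) (hR : r ≤ R) (hS : closedBall x r ⊆ S) (m : ℕ) (κ : Measure X)
    (hκ₀ : κ (closedBall x r) ≤ ENNReal.ofReal (D * r))
    (hκ : ∀ z ∈ closedBall x r, ∀ t, r / 2 ^ m ≤ t → t ≤ r →
      κ (closedBall z (3 * t)) ≤ ENNReal.ofReal (D * t)) :
    ∫⁻ z in closedBall x r, ENNReal.ofReal (Real.exp (q * a z (r / 2 ^ m))) ∂κ ≤
      ENNReal.ofReal (Real.exp (q * (J + 3 * J / (Real.log (3 / 2) / q) ^ (n - 1) + geomBound n)) *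
        (7 * J * D) * r * Real.exp (q * a x r)) := by
  have := h.isFiniteMeasure
  have hJ := h.one_le
  -- With this slope each halving multiplies `exp (q a)` by at most `3/2`, while the measure of the
  -- heavy set halves; the product `3/4` is summable.
  set δ : ℝ := Real.log (3 / 2) / q with hδdef
  have hδ : 0 < δ := div_pos (Real.log_pos (by norm_num)) hq
  have hexpδ : Real.exp (q * δ) = 3 / 2 := by
    rw [hδdef, mul_div_cancel₀ _ hq.ne', Real.exp_log (by norm_num)]
  set C : ℝ := J + 3 * J / δ ^ (n - 1) + geomBound n with hC
  set A : ℝ := Real.exp (q * (a x r + C)) with hA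
  have hApos : 0 < A := Real.exp_pos _
  -- The heavy sets need not be measurable; their measurable hulls have the same measure and can be
  -- used in indicator functions.
  set Z : ℕ → Set X := fun k ↦
    toMeasurable κ (heavyPoints ν r k m ∩ closedBall x r) with hZ
  have hZm : ∀ k, MeasurableSet (Z k) := fun k ↦ measurableSet_toMeasurable _ _
  have hx : x ∈ S := hS (mem_closedBall_self hr.le)
  -- pointwise bound
  have hpt : ∀ z ∈ closedBall x r, ENNReal.ofReal (Real.exp (q * a z (r / 2 ^ m))) ≤
      ENNReal.ofReal A + ∑ k ∈ Finset.range m,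
        (Z k).indicator (fun _ ↦ ENNReal.ofReal (A * (3 / 2) ^ (k + 1))) z := by
    intro z hz
    have hex : ∃ k, k ≤ m ∧ z ∉ heavyPoints ν r k m := by
      refine ⟨m, le_rfl, ?_⟩
      rintro ⟨k, h1, h2, -⟩
      omega
    classical
    -- The first level at which `z` is not heavy; level `m` always qualifies, as no scale remains
    -- there. If `k₀ > 0`, then `z` is heavy at level `k₀ - 1`, hence the exponent `k + 1` in the
    -- pointwise bound.
    set k₀ := Nat.find hex
    obtain ⟨hk₀m, hk₀⟩ := Nat.find_spec hex
    have hb := h.le_of_notMem_heavyPoints hr hR hx (hS hz) (by rwa [dist_comm]) hδ hk₀m hk₀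
    have hb' : Real.exp (q * a z (r / 2 ^ m)) ≤ A * (3 / 2) ^ k₀ := by
      calc Real.exp (q * a z (r / 2 ^ m)) ≤ Real.exp (q * (a x r + C) + k₀ * (q * δ)) := by
            apply Real.exp_le_exp.2
            have := mul_le_mul_of_nonneg_left hb hq.le
            refine this.trans (le_of_eq ?_)
            rw [hC]; ring
        _ = _ := by rw [Real.exp_add, Real.exp_nat_mul, hexpδ]
    rcases Nat.eq_zero_or_pos k₀ with h0 | hpos
    · rw [h0, pow_zero, mul_one] at hb'
      exact (ENNReal.ofReal_le_ofReal hb').trans le_self_add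
    · have hlt : k₀ - 1 < k₀ := by omega
      have hmem : z ∈ heavyPoints ν r (k₀ - 1) m := by
        by_contra hcon
        exact Nat.find_min hex hlt ⟨by omega, hcon⟩
      have hzZ : z ∈ Z (k₀ - 1) := subset_toMeasurable _ _ ⟨hmem, hz⟩
      refine le_trans ?_ le_add_self
      refine le_trans ?_ (Finset.single_le_sum (f := fun k ↦
        (Z k).indicator (fun _ ↦ ENNReal.ofReal (A * (3 / 2) ^ (k + 1))) z)
        (fun _ _ ↦ zero_le) (Finset.mem_range.2 (by omega : k₀ - 1 < m)))
      simp only [indicator_of_mem hzZ]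
      rw [Nat.sub_add_cancel hpos]
      exact ENNReal.ofReal_le_ofReal hb'
  have hZle : ∀ k, κ (Z k) ≤ ENNReal.ofReal (D * (r / 2 ^ k) * J) := by
    intro k
    rw [hZ, measure_toMeasurable, ENNReal.ofReal_mul (by positivity)]
    exact (measure_heavyPoints_le ν κ _ hr hD k m hκ).trans (by gcongr; exact h.mass_le)
  calc ∫⁻ z in closedBall x r, ENNReal.ofReal (Real.exp (q * a z (r / 2 ^ m))) ∂κ
      ≤ ∫⁻ z in closedBall x r, (ENNReal.ofReal A + ∑ k ∈ Finset.range m,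
        (Z k).indicator (fun _ ↦ ENNReal.ofReal (A * (3 / 2) ^ (k + 1))) z) ∂κ :=
        setLIntegral_mono' measurableSet_closedBall hpt
    _ = ENNReal.ofReal A * κ (closedBall x r) + ∑ k ∈ Finset.range m,
        ∫⁻ z in closedBall x r,
          (Z k).indicator (fun _ ↦ ENNReal.ofReal (A * (3 / 2) ^ (k + 1))) z ∂κ := by
        rw [lintegral_add_left measurable_const, setLIntegral_const,
          lintegral_finsetSum _ fun k _ ↦ measurable_const.indicator (hZm k)]
    _ ≤ ENNReal.ofReal (A * (D * r)) + ∑ k ∈ Finset.range m,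
        ENNReal.ofReal (A * D * r * J * (3 / 2) * (3 / 4) ^ k) := by
        rw [ENNReal.ofReal_mul hApos.le]
        gcongr with k hk
        rw [lintegral_indicator_const (hZm k)]
        refine (mul_le_mul_right ((Measure.restrict_apply_le _ _).trans (hZle k)) _).trans ?_
        rw [← ENNReal.ofReal_mul (by positivity)]
        refine ENNReal.ofReal_le_ofReal (le_of_eq ?_)
        rw [show (3 / 4 : ℝ) = 3 / 2 / 2 by norm_num, div_pow (3 / 2 : ℝ) 2 k]
        field_simp
        ring
    _ = ENNReal.ofReal (A * (D * r) + ∑ k ∈ Finset.range m,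
        A * D * r * J * (3 / 2) * (3 / 4) ^ k) := by
        rw [ENNReal.ofReal_add (by positivity) (Finset.sum_nonneg fun k _ ↦ by positivity),
          ENNReal.ofReal_sum_of_nonneg fun k _ ↦ by positivity]
    _ ≤ _ := by
        -- The geometric series sums to at most `4`, and `1 + (3/2) * 4 = 7` is the factor in the
        -- statement.
        apply ENNReal.ofReal_le_ofReal
        rw [← Finset.mul_sum]
        have hg : ∑ k ∈ Finset.range m, (3 / 4 : ℝ) ^ k ≤ 4 := by
          have := (summable_geometric_of_lt_one (r := (3 / 4 : ℝ)) (by norm_num)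
            (by norm_num)).sum_le_tsum (Finset.range m) fun k _ ↦ by positivity
          rw [tsum_geometric_of_lt_one (by norm_num) (by norm_num)] at this
          norm_num at this
          exact this
        have hAe : A = Real.exp (q * C) * Real.exp (q * a x r) := by
          rw [hA, ← Real.exp_add]; ring_nf
        calc _ ≤ A * (D * r) * J + A * D * r * J * (3 / 2) * 4 := by
              refine add_le_add (le_mul_of_one_le_right (by positivity) hJ) ?_
              gcongr
          _ = _ := by rw [hAe]; ring

/-- Along a chain that leaves a ball, the averages at the scale of the steps can not be small on
average: the mass of `ν` only affects a set of steps of small total length. -/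
lemma le_sum_exp_of_chain (h : ScaleControl n ν a S R J) {L Γ s : ℝ} (hL : 0 < L) (hΓ : 1 ≤ Γ)
    {y : X} (hs : 0 < s) (hR : s ≤ R) (hy : y ∈ S) {N : ℕ} {p m : ℕ → X} {t : ℕ → ℝ}
    (hp0 : p 0 = y) (hpN : s / Γ ≤ dist (p N) y) (ht : ∀ i < N, 0 ≤ t i) (hts : ∀ i < N, t i ≤ s)
    (hmS : ∀ i < N, m i ∈ S) (hmy : ∀ i < N, dist y (m i) ≤ s)
    (hm₁ : ∀ i < N, dist (p i) (m i) ≤ L * t i)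
    (hm₂ : ∀ i < N, dist (p (i + 1)) (m i) ≤ L * t i) :
    Real.exp (-(2 * J + 4 * (3 + 2 * L) * J * Γ * geomBound n)) / (4 * L * Γ) *
      (s * Real.exp (a y s)) ≤ ∑ i ∈ Finset.range N, t i * Real.exp (a (m i) (t i)) := by
  classical
  have := h.isFiniteMeasure
  have hJ := h.one_le
  -- This threshold makes the bad intervals below have total length at most `2 (3 + 2L) (s / H) J =
  -- s / (2Γ)`, half of the interval to be covered.
  set H : ℝ := 4 * (3 + 2 * L) * J * Γ with hH
  have hH1 : 1 ≤ H := by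
    have h1 : 1 ≤ 4 * (3 + 2 * L) := by linarith
    have h2 : 1 ≤ J * Γ := one_le_mul_of_one_le_of_one_le hJ hΓ
    calc (1 : ℝ) ≤ 4 * (3 + 2 * L) * (J * Γ) := one_le_mul_of_one_le_of_one_le h1 h2
      _ = H := by rw [hH]; ring
  have hsle : ∀ j : ℕ, s / 2 ^ j ≤ s := fun j ↦ div_le_self hs.le (one_le_pow₀ (by norm_num))
  -- A step is bad if, at some scale between its own size and `s`, the ball around `m i` has mass at
  -- least `H / 2^j`.
  let bad : Set ℕ := {i | i < N ∧ ∃ j : ℕ, t i ≤ s / 2 ^ j ∧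
    s / 2 ^ j ≤ s / H * ν.real (closedBall (m i) (s / 2 ^ j))}
  have hgood : ∀ i < N, i ∉ bad →
      t i * Real.exp (a y s - (2 * J + H * geomBound n)) ≤ t i * Real.exp (a (m i) (t i)) := by
    intro i hi hib
    rcases (ht i hi).eq_or_lt with h0 | hpos
    · rw [← h0, zero_mul, zero_mul]
    refine mul_le_mul_of_nonneg_left (Real.exp_le_exp.2 ?_) hpos.le
    obtain ⟨k, hk1, hk2⟩ := exists_nat_pow_near (x := s / t i) (y := 2)
      ((one_le_div hpos).2 (hts i hi)) one_lt_two
    have hk1' : t i ≤ s / 2 ^ k := by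
      rw [le_div_iff₀ (by positivity)] at hk1 ⊢
      linarith
    have hk2' : s / 2 ^ k / 2 ≤ t i := by
      rw [div_lt_iff₀ hpos, pow_succ] at hk2
      rw [div_div, div_le_iff₀ (by positivity)]
      linarith
    have h1 := h.horizontal y hy (m i) (hmS i hi) s hs hR (hmy i hi)
    have h2 := h.vertical_le (hmS i hi) (r := s / 2 ^ k) (by positivity) ((hsle k).trans hR)
      hk2' hk1'
    have h3 := h.abs_sub_le_of_mass_le (hmS i hi) hs hR hH1 k ?_
    · linarith [abs_le.1 h1, abs_le.1 h2, abs_le.1 h3, le_abs_self (a y s - a (m i) s),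
        le_abs_self (a (m i) s - a (m i) (s / 2 ^ k)),
        le_abs_self (a (m i) (s / 2 ^ k) - a (m i) (t i))]
    · intro j hj
      by_contra! hlt
      refine hib ⟨hi, j, hk1'.trans ?_, ?_⟩
      · gcongr
        norm_num
      · calc s / 2 ^ j = s / H * (H / 2 ^ j) := by field_simp
          _ ≤ _ := by gcongr
  have hex : ∀ i, ∃ j : ℕ, i ∈ bad → t i ≤ s / 2 ^ j ∧
      s / 2 ^ j ≤ s / H * ν.real (closedBall (m i) (s / 2 ^ j)) := by
    intro i
    by_cases hi : i ∈ bad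
    · obtain ⟨-, j, hj⟩ := hi
      exact ⟨j, fun _ ↦ hj⟩
    · exact ⟨0, fun h ↦ absurd h hi⟩
  choose j hj using hex
  set ρ : ℕ → ℝ := fun i ↦ s / 2 ^ j i with hρ
  obtain ⟨u, hut, hcount, hcov, hsum⟩ := exists_subfamily_sum_radius_le ν bad m ρ (r := s)
    (c := s / H) (by positivity) (fun i _ ↦ by positivity) (fun i _ ↦ hsle _)
    (fun i hi ↦ (hj i hi).2)
  -- the distances to `y` along the chain cover an interval
  have hcover : Ioc 0 (s / Γ) ⊆ (⋃ i ∈ (Finset.range N).filter (· ∉ bad),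
      closedBall (dist (m i) y) (L * t i)) ∪
        ⋃ i ∈ u, closedBall (dist (m i) y) ((3 + 2 * L) * ρ i) := by
    intro v hv
    -- A discrete intermediate value argument: the first index at distance at least `v` yields a
    -- step whose end points have distances to `y` on both sides of `v`.
    have hexj : ∃ k, v ≤ dist (p k) y := ⟨N, hv.2.trans hpN⟩
    set k := Nat.find hexj
    have hk : v ≤ dist (p k) y := Nat.find_spec hexj
    have hkN : k ≤ N := Nat.find_min' hexj (hv.2.trans hpN)
    have hk0 : k ≠ 0 := by
      intro h0
      rw [h0, hp0, dist_self] at hk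
      exact absurd hv.1 (not_lt.2 hk)
    obtain ⟨i, hi⟩ := Nat.exists_eq_succ_of_ne_zero hk0
    have hlt : dist (p i) y < v := by
      have := Nat.find_min hexj (m := i) (by omega)
      exact not_le.1 this
    rw [hi] at hk
    have hiN : i < N := by omega
    have hclose : |v - dist (m i) y| ≤ L * t i := by
      have h1 := dist_triangle (p (i + 1)) (m i) y
      have h2 := dist_triangle_left (m i) y (p i)
      have h3 := hm₁ i hiN
      have h4 := hm₂ i hiN
      rw [abs_le]
      constructor
      · linarith
      · linarith
    by_cases hib : i ∈ bad
    · right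
      obtain ⟨w, hw, hd, hr⟩ := hcov i hib
      refine mem_biUnion hw ?_
      rw [mem_closedBall, Real.dist_eq]
      have h1 : |dist (m i) y - dist (m w) y| ≤ dist (m i) (m w) := abs_dist_sub_le _ _ _
      -- A bad step is smaller than its heavy radius, hence than `2 ρ w` for the selected ball `w`;
      -- together with `3 ρ w` between the centres this explains the factor `3 + 2L`.
      have h2 : L * t i ≤ L * (2 * ρ w) := by
        gcongr
        exact (hj i hib).1.trans hr
      calc |v - dist (m w) y| ≤ |v - dist (m i) y| + |dist (m i) y - dist (m w) y| :=
            abs_sub_le _ _ _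
        _ ≤ L * (2 * ρ w) + 3 * ρ w := by linarith
        _ = _ := by ring
    · left
      refine mem_biUnion (Finset.mem_filter.2 ⟨Finset.mem_range.2 hiN, hib⟩) ?_
      rw [mem_closedBall, Real.dist_eq]
      exact hclose
  have hvol : ENNReal.ofReal (s / Γ) ≤
      ENNReal.ofReal (∑ i ∈ (Finset.range N).filter (· ∉ bad), 2 * (L * t i)) +
        ENNReal.ofReal (s / Γ / 2) := by
    calc ENNReal.ofReal (s / Γ) = volume (Ioc 0 (s / Γ)) := by rw [Real.volume_Ioc, sub_zero]
      _ ≤ _ := (measure_mono hcover).trans (measure_union_le _ _)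
      _ ≤ ∑ i ∈ (Finset.range N).filter (· ∉ bad), volume (closedBall (dist (m i) y) (L * t i)) +
          ∑' i : u, volume (closedBall (dist (m i) y) ((3 + 2 * L) * ρ i)) :=
          add_le_add (measure_biUnion_finset_le _ _) (measure_biUnion_le _ hcount _)
      _ ≤ _ := by
          simp only [Real.volume_closedBall]
          gcongr
          · rw [ENNReal.ofReal_sum_of_nonneg]
            intro i hi
            have := ht i (Finset.mem_range.1 (Finset.mem_filter.1 hi).1)
            positivity
          · calc ∑' i : u, ENNReal.ofReal (2 * ((3 + 2 * L) * ρ i))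
                = ∑' i : u, ENNReal.ofReal (2 * (3 + 2 * L)) * ENNReal.ofReal (ρ i) := by
                  congr 1; ext i
                  rw [← ENNReal.ofReal_mul (by positivity)]; ring_nf
              _ = ENNReal.ofReal (2 * (3 + 2 * L)) * ∑' i : u, ENNReal.ofReal (ρ i) :=
                  ENNReal.tsum_mul_left
              _ ≤ ENNReal.ofReal (2 * (3 + 2 * L)) * (ENNReal.ofReal (s / H) *
                  ENNReal.ofReal J) := by
                  gcongr
                  exact hsum.trans (by gcongr; exact h.mass_le)
              _ = ENNReal.ofReal (s / Γ / 2) := by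
                  rw [← ENNReal.ofReal_mul (by positivity), ← ENNReal.ofReal_mul (by positivity)]
                  congr 1
                  rw [hH]
                  field_simp
                  ring
  have hnn : 0 ≤ ∑ i ∈ (Finset.range N).filter (· ∉ bad), 2 * (L * t i) := by
    refine Finset.sum_nonneg fun i hi ↦ ?_
    have := ht i (Finset.mem_range.1 (Finset.mem_filter.1 hi).1)
    positivity
  rw [← ENNReal.ofReal_add hnn (by positivity), ENNReal.ofReal_le_ofReal_iff (by positivity)]
    at hvol
  -- The good intervals, of lengths `2 L t i`, cover at least the other half `s / (2Γ)`.
  have hlen : s / (4 * L * Γ) ≤ ∑ i ∈ (Finset.range N).filter (· ∉ bad), t i := by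
    have e : ∑ i ∈ (Finset.range N).filter (· ∉ bad), 2 * (L * t i) =
        2 * L * ∑ i ∈ (Finset.range N).filter (· ∉ bad), t i := by
      rw [Finset.mul_sum]; exact Finset.sum_congr rfl fun i _ ↦ by ring
    rw [e] at hvol
    have e2 : s / (4 * L * Γ) = s / Γ / 2 / (2 * L) := by field_simp; ring
    rw [e2, div_le_iff₀ (by positivity)]
    linarith
  calc _ = s / (4 * L * Γ) * Real.exp (a y s - (2 * J + H * geomBound n)) := by
        rw [sub_eq_add_neg, Real.exp_add]; ring
    _ ≤ (∑ i ∈ (Finset.range N).filter (· ∉ bad), t i) *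
        Real.exp (a y s - (2 * J + H * geomBound n)) := by gcongr
    _ ≤ ∑ i ∈ (Finset.range N).filter (· ∉ bad), t i * Real.exp (a (m i) (t i)) := by
        rw [Finset.sum_mul]
        refine Finset.sum_le_sum fun i hi ↦ ?_
        rw [Finset.mem_filter, Finset.mem_range] at hi
        exact hgood i hi.1 hi.2
    _ ≤ _ := by
        refine Finset.sum_le_sum_of_subset_of_nonneg (Finset.filter_subset _ _) fun i hi _ ↦ ?_
        exact mul_nonneg (ht i (Finset.mem_range.1 hi)) (Real.exp_pos _).le

end ScaleControl

end Covering

/-! ### The averaging kernel. -/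

section Kernel

variable {n : ℕ}

/-- A smooth probability density on `ℝⁿ` that is bounded by `B` and vanishes outside of the annulus
`1 / 2 ≤ ‖z‖ ≤ 1`. -/
structure IsAnnularKernel (φ : EuclideanSpace ℝ (Fin n) → ℝ) (B : ℝ) : Prop where
  contDiff : ContDiff ℝ ∞ φ
  nonneg : ∀ z, 0 ≤ φ z
  le : ∀ z, φ z ≤ B
  annulus : ∀ z, φ z ≠ 0 → 1 / 2 ≤ ‖z‖ ∧ ‖z‖ ≤ 1
  integral_eq : ∫ z, φ z = 1

/-- A normalized bump of outer radius `1/4` around a vector of length `3/4` stays in the annulus. A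
nonzero vector exists because `1 ≤ n`. -/
lemma exists_isAnnularKernel (hn : 1 ≤ n) :
    ∃ (φ : EuclideanSpace ℝ (Fin n) → ℝ) (B : ℝ), 1 ≤ B ∧ IsAnnularKernel φ B := by
  set e : EuclideanSpace ℝ (Fin n) := EuclideanSpace.single ⟨0, hn⟩ (3 / 4) with he
  have hnorm : ‖e‖ = 3 / 4 := by rw [he, PiLp.norm_single]; norm_num
  let b : ContDiffBump e := ⟨1 / 8, 1 / 4, by norm_num, by norm_num⟩
  have hcont : Continuous (b.normed volume) := b.continuous_normed
  have hsupp : HasCompactSupport (b.normed volume) := b.hasCompactSupport_normed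
  obtain ⟨B, hB⟩ := hcont.bounded_above_of_compact_support hsupp
  refine ⟨b.normed volume, max B 1, le_max_right _ _,
    b.contDiff_normed, fun z ↦ b.nonneg_normed z, fun z ↦ ?_, ?_, b.integral_normed⟩
  · exact (le_abs_self _).trans ((hB z).trans (le_max_left _ _))
  · intro z hz
    have h1 : z ∈ ball e (1 / 4) := by
      have : z ∈ Function.support (b.normed volume) := hz
      rwa [b.support_normed_eq] at this
    rw [mem_ball_iff_norm] at h1
    have h2 := norm_sub_norm_le e z
    have h3 := norm_sub_norm_le z e
    rw [norm_sub_rev] at h2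
    constructor <;> linarith

/-- The kernel `φ`, recentred at `x` and rescaled by the factor `l`. -/
def scaledKernel (φ : EuclideanSpace ℝ (Fin n) → ℝ) (x : EuclideanSpace ℝ (Fin n)) (l : ℝ)
    (y : EuclideanSpace ℝ (Fin n)) : ℝ :=
  l ^ n * φ (l • (y - x))

/-- The average of `F` at the point `x` and the scale `s`. -/
def scaleAverage (φ F : EuclideanSpace ℝ (Fin n) → ℝ) (x : EuclideanSpace ℝ (Fin n)) (s : ℝ) : ℝ :=
  ∫ y, F y * scaledKernel φ x s⁻¹ y

variable {φ : EuclideanSpace ℝ (Fin n) → ℝ} {B : ℝ}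

lemma IsAnnularKernel.contDiff_scaledKernel (hφ : IsAnnularKernel φ B)
    (x : EuclideanSpace ℝ (Fin n)) (l : ℝ) : ContDiff ℝ ∞ (scaledKernel φ x l) := by
  unfold scaledKernel
  exact contDiff_const.mul (hφ.contDiff.comp (by fun_prop))

lemma IsAnnularKernel.mem_annulus (hφ : IsAnnularKernel φ B) {x y : EuclideanSpace ℝ (Fin n)}
    {l : ℝ} (hl : 0 < l) (h : φ (l • (y - x)) ≠ 0) :
    1 / (2 * l) ≤ ‖y - x‖ ∧ ‖y - x‖ ≤ 1 / l := by
  have := hφ.annulus _ h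
  rw [norm_smul, Real.norm_of_nonneg hl.le] at this
  constructor
  · rw [div_le_iff₀ (by positivity)]; linarith
  · rw [le_div_iff₀ hl]; linarith

lemma IsAnnularKernel.scaledKernel_nonneg (hφ : IsAnnularKernel φ B)
    (x : EuclideanSpace ℝ (Fin n)) {l : ℝ} (hl : 0 ≤ l) (y : EuclideanSpace ℝ (Fin n)) :
    0 ≤ scaledKernel φ x l y := mul_nonneg (by positivity) (hφ.nonneg _)

lemma IsAnnularKernel.scaledKernel_le (hφ : IsAnnularKernel φ B)
    (x : EuclideanSpace ℝ (Fin n)) {l : ℝ} (hl : 0 ≤ l) (y : EuclideanSpace ℝ (Fin n)) :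
    scaledKernel φ x l y ≤ l ^ n * B := mul_le_mul_of_nonneg_left (hφ.le _) (by positivity)

lemma IsAnnularKernel.scaledKernel_eq_zero (hφ : IsAnnularKernel φ B)
    {x y : EuclideanSpace ℝ (Fin n)} {s : ℝ} (hs : 0 < s) (hy : y ∉ closedBall x s) :
    scaledKernel φ x s⁻¹ y = 0 := by
  by_contra h
  have h' : φ (s⁻¹ • (y - x)) ≠ 0 := fun h0 ↦ h (by rw [scaledKernel, h0, mul_zero])
  have := (hφ.mem_annulus (inv_pos.2 hs) h').2
  rw [one_div, inv_inv] at this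
  exact hy (mem_closedBall_iff_norm.2 this)

lemma IsAnnularKernel.integral_scaledKernel (hφ : IsAnnularKernel φ B)
    (x : EuclideanSpace ℝ (Fin n)) {s : ℝ} (hs : 0 < s) :
    ∫ y, scaledKernel φ x s⁻¹ y = 1 := by
  simp only [scaledKernel]
  rw [integral_const_mul, integral_sub_right_eq_self (fun y ↦ φ (s⁻¹ • y)) x,
    Measure.integral_comp_smul, hφ.integral_eq, finrank_euclideanSpace_fin, inv_pow, inv_inv,
    abs_of_pos (by positivity)]
  simp only [smul_eq_mul, mul_one]
  field_simp

end Kernel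

/-! ### Weak derivatives tested against families of functions. -/

section WeakDerivative

variable {n : ℕ}

/-- The functions `G i` are the weak partial derivatives of `F` in the open set `Ω`. -/
structure HasWeakPartials (F : EuclideanSpace ℝ (Fin n) → ℝ)
    (G : Fin n → EuclideanSpace ℝ (Fin n) → ℝ) (Ω : Set (EuclideanSpace ℝ (Fin n))) : Prop where
  locallyIntegrable : LocallyIntegrableOn F Ω
  locallyIntegrable_partial : ∀ i, LocallyIntegrableOn (G i) Ω
  integral_eq : ∀ (i : Fin n) (ψ : EuclideanSpace ℝ (Fin n) → ℝ), ContDiff ℝ ∞ ψ →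
    HasCompactSupport ψ → tsupport ψ ⊆ Ω →
      ∫ y, F y * fderiv ℝ ψ y (EuclideanSpace.single i 1) = -∫ y, G i y * ψ y

lemma sum_lintegral_le_lintegral_sum {α ι : Type*} [MeasurableSpace α] {μ : Measure α}
    (s : Finset ι) (f : ι → α → ℝ≥0∞) :
    ∑ i ∈ s, ∫⁻ y, f i y ∂μ ≤ ∫⁻ y, ∑ i ∈ s, f i y ∂μ := by
  classical
  induction s using Finset.induction_on with
  | empty => simp
  | insert i s hi ih =>
    simp_rw [Finset.sum_insert hi]
    exact (add_le_add le_rfl ih).trans (le_lintegral_add _ _)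

lemma integrable_mul_of_eq_zero {E : Type*} [TopologicalSpace E] [T2Space E] [MeasurableSpace E]
    [BorelSpace E] {μ : Measure E} {F ψ : E → ℝ}
    {K : Set E} (hK : IsCompact K) (hF : IntegrableOn F K μ) (hψ : Continuous ψ)
    (h0 : ∀ y ∉ K, ψ y = 0) : Integrable (fun y ↦ F y * ψ y) μ := by
  rw [← integrableOn_iff_integrable_of_support_subset (s := K)]
  · exact hF.mul_continuousOn hψ.continuousOn hK
  · intro y hy
    by_contra h
    exact hy (by simp [h0 y h])

/-- Differentiation under the integral sign against a family of functions with support in a fixed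
compact set. -/
lemma hasDerivAt_integral_mul {E : Type*} [TopologicalSpace E] [T2Space E] [MeasurableSpace E]
    [BorelSpace E] {μ : Measure E} {F : E → ℝ} {K : Set E} (hK : IsCompact K)
    (hF : IntegrableOn F K μ) {ψ ψ' : ℝ → E → ℝ} {T : Set ℝ} (hT : IsOpen T)
    (hψ : ∀ τ ∈ T, ∀ y, HasDerivAt (fun τ ↦ ψ τ y) (ψ' τ y) τ) (hψc : ∀ τ, Continuous (ψ τ))
    (hψ'c : Continuous (Function.uncurry ψ')) (h0 : ∀ τ ∈ T, ∀ y ∉ K, ψ τ y = 0) {τ : ℝ}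
    (hτ : τ ∈ T) :
    HasDerivAt (fun τ ↦ ∫ y, F y * ψ τ y ∂μ) (∫ y, F y * ψ' τ y ∂μ) τ := by
  obtain ⟨ε, hε, hεT⟩ := Metric.isOpen_iff.1 hT τ hτ
  have h0' : ∀ τ ∈ T, ∀ y ∉ K, ψ' τ y = 0 := by
    intro σ hσ y hy
    refine (hψ σ hσ y).unique ?_
    refine (hasDerivAt_const σ (0 : ℝ)).congr_of_eventuallyEq ?_
    filter_upwards [hT.mem_nhds hσ] with σ' hσ' using h0 σ' hσ' y hy
  have hcomp : IsCompact (closedBall τ (ε / 2) ×ˢ K) := (isCompact_closedBall _ _).prod hK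
  obtain ⟨C, hC⟩ := (hcomp.image hψ'c).isBounded.exists_norm_le
  have hnhds : closedBall τ (ε / 2) ∈ 𝓝 τ := closedBall_mem_nhds _ (by positivity)
  have hsubT : closedBall τ (ε / 2) ⊆ T :=
    (closedBall_subset_ball (by linarith)).trans hεT
  have hcψ' : ∀ σ, Continuous (ψ' σ) := fun σ ↦ hψ'c.comp (Continuous.prodMk_right σ)
  have key := hasDerivAt_integral_of_dominated_loc_of_deriv_le (μ := μ.restrict K)
    (F := fun σ y ↦ F y * ψ σ y) (F' := fun σ y ↦ F y * ψ' σ y) (x₀ := τ)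
    (bound := fun y ↦ ‖F y‖ * C) hnhds ?_ ?_ ?_ ?_ ?_ ?_
  · have key := key.2
    have e1 : ∀ σ ∈ T, ∫ y in K, F y * ψ σ y ∂μ = ∫ y, F y * ψ σ y ∂μ := fun σ hσ ↦
      setIntegral_eq_integral_of_forall_compl_eq_zero fun y hy ↦ by rw [h0 σ hσ y hy, mul_zero]
    have e2 : ∫ y in K, F y * ψ' τ y ∂μ = ∫ y, F y * ψ' τ y ∂μ :=
      setIntegral_eq_integral_of_forall_compl_eq_zero fun y hy ↦ by rw [h0' τ hτ y hy, mul_zero]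
    rw [e2] at key
    refine key.congr_of_eventuallyEq ?_
    filter_upwards [hT.mem_nhds hτ] with σ hσ using (e1 σ hσ).symm
  · exact Filter.Eventually.of_forall fun σ ↦
      (hF.mul_continuousOn (hψc σ).continuousOn hK).aestronglyMeasurable
  · exact hF.mul_continuousOn (hψc τ).continuousOn hK
  · exact (hF.mul_continuousOn (hcψ' τ).continuousOn hK).aestronglyMeasurable
  · filter_upwards [ae_restrict_mem hK.measurableSet] with y hy σ hσ
    rw [norm_mul]
    gcongr
    exact hC _ ⟨(σ, y), ⟨hσ, hy⟩, rfl⟩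
  · exact hF.norm.mul_const C
  · refine Filter.Eventually.of_forall fun y σ hσ ↦ ?_
    exact (hψ σ (hsubT hσ) y).const_mul (F y)

/-- If the derivative of a family of test functions is a divergence, the increments of the
corresponding integrals are controlled by the weak partial derivatives. -/
lemma HasWeakPartials.abs_integral_sub_le {F : EuclideanSpace ℝ (Fin n) → ℝ}
    {G : Fin n → EuclideanSpace ℝ (Fin n) → ℝ} {Ω : Set (EuclideanSpace ℝ (Fin n))}
    (hw : HasWeakPartials F G Ω) {K : Set (EuclideanSpace ℝ (Fin n))} (hK : IsCompact K)
    (hKΩ : K ⊆ Ω) {ψ ψ' : ℝ → EuclideanSpace ℝ (Fin n) → ℝ}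
    {V : ℝ → Fin n → EuclideanSpace ℝ (Fin n) → ℝ} {T : Set ℝ} (hT : IsOpen T)
    (hψ : ∀ τ ∈ T, ∀ y, HasDerivAt (fun τ ↦ ψ τ y) (ψ' τ y) τ) (hψc : ∀ τ, Continuous (ψ τ))
    (hψ'c : Continuous (Function.uncurry ψ')) (h0 : ∀ τ ∈ T, ∀ y ∉ K, ψ τ y = 0)
    (hV : ∀ τ i, ContDiff ℝ ∞ (V τ i)) (hV0 : ∀ τ ∈ T, ∀ i, ∀ y ∉ K, V τ i y = 0)
    (hdiv : ∀ τ y, ψ' τ y = ∑ i, fderiv ℝ (V τ i) y (EuclideanSpace.single i 1))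
    {A : Set (EuclideanSpace ℝ (Fin n))} {M τ₀ τ₁ : ℝ}
    (hM : 0 ≤ M) (hτ : τ₀ ≤ τ₁) (hIcc : Icc τ₀ τ₁ ⊆ T)
    (hVM : ∀ τ ∈ Icc τ₀ τ₁, ∀ i y, |V τ i y| ≤ M) (hVA : ∀ τ ∈ Icc τ₀ τ₁, ∀ i, ∀ y ∉ A, V τ i y = 0)
    (hfin : ∫⁻ y in A, ∑ i, ‖G i y‖ₑ ≠ ⊤) :
    |(∫ y, F y * ψ τ₁ y) - ∫ y, F y * ψ τ₀ y| ≤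
      M * (∫⁻ y in A, ∑ i, ‖G i y‖ₑ).toReal * (τ₁ - τ₀) := by
  have hFK : IntegrableOn F K := hw.locallyIntegrable.integrableOn_compact_subset hKΩ hK
  have hts : ∀ τ ∈ T, ∀ i, tsupport (V τ i) ⊆ K := fun τ hτ i ↦
    closure_minimal (fun y hy ↦ by_contra fun h ↦ hy (hV0 τ hτ i y h)) hK.isClosed
  have hderiv : ∀ τ ∈ T, HasDerivAt (fun τ ↦ ∫ y, F y * ψ τ y)
      (-∑ i, ∫ y, G i y * V τ i y) τ := by
    intro τ hτ
    -- The parameter derivative falls on the test function, where it is a divergence; integrating by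
    -- parts componentwise moves it to the weak partial derivatives.
    convert! hasDerivAt_integral_mul hK hFK hT hψ hψc hψ'c h0 hτ using 1
    have e : ∀ y, F y * ψ' τ y = ∑ i, F y * fderiv ℝ (V τ i) y (EuclideanSpace.single i 1) := by
      intro y; rw [hdiv, Finset.mul_sum]
    simp_rw [e]
    rw [integral_finsetSum, ← Finset.sum_neg_distrib]
    · refine Finset.sum_congr rfl fun i _ ↦ ?_
      rw [hw.integral_eq i (V τ i) (hV τ i)
        (HasCompactSupport.intro hK fun y hy ↦ hV0 τ hτ i y hy) ((hts τ hτ i).trans hKΩ)]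
    · intro i _
      refine integrable_mul_of_eq_zero hK hFK ?_ ?_
      · exact ((hV τ i).continuous_fderiv (by simp)).clm_apply continuous_const
      · intro y hy
        have : fderiv ℝ (V τ i) y = 0 := by
          by_contra hne
          exact hy ((hts τ hτ i) (support_fderiv_subset ℝ hne))
        rw [this]; rfl
  have hbound : ∀ τ ∈ Icc τ₀ τ₁, ‖-∑ i, ∫ y, G i y * V τ i y‖ ≤
      M * (∫⁻ y in A, ∑ i, ‖G i y‖ₑ).toReal := by
    intro τ hτ
    have h1 : ∀ i, ‖∫ y, G i y * V τ i y‖ₑ ≤ ENNReal.ofReal M * ∫⁻ y in A, ‖G i y‖ₑ := by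
      intro i
      have e : ∫ y, G i y * V τ i y = ∫ y in A, G i y * V τ i y :=
        (setIntegral_eq_integral_of_forall_compl_eq_zero fun y hy ↦ by
          rw [hVA τ hτ i y hy, mul_zero]).symm
      rw [e]
      refine (enorm_integral_le_lintegral_enorm _).trans ?_
      rw [← lintegral_const_mul' _ _ ENNReal.ofReal_ne_top]
      refine lintegral_mono fun y ↦ ?_
      rw [enorm_mul, mul_comm]
      gcongr
      rw [Real.enorm_eq_ofReal_abs]
      exact ENNReal.ofReal_le_ofReal (hVM τ hτ i y)
    have h2 : ‖-∑ i, ∫ y, G i y * V τ i y‖ₑ ≤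
        ENNReal.ofReal M * ∫⁻ y in A, ∑ i, ‖G i y‖ₑ := by
      rw [enorm_neg]
      refine (enorm_sum_le _ _).trans ?_
      refine (Finset.sum_le_sum fun i _ ↦ h1 i).trans ?_
      rw [← Finset.mul_sum]
      gcongr
      exact sum_lintegral_le_lintegral_sum _ _
    have h3 := ENNReal.toReal_mono (ENNReal.mul_ne_top ENNReal.ofReal_ne_top hfin) h2
    rwa [toReal_enorm, ENNReal.toReal_mul, ENNReal.toReal_ofReal hM] at h3
  have := (convex_Icc τ₀ τ₁).norm_image_sub_le_of_norm_hasDerivWithin_le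
    (fun τ hτ ↦ (hderiv τ (hIcc hτ)).hasDerivWithinAt) hbound
    (left_mem_Icc.2 hτ) (right_mem_Icc.2 hτ)
  rwa [Real.norm_eq_abs, Real.norm_of_nonneg (by linarith)] at this

end WeakDerivative

/-! ### Increments of averages under dilation and translation. -/

section Averages

variable {n : ℕ} {φ : EuclideanSpace ℝ (Fin n) → ℝ} {B : ℝ}
  {F : EuclideanSpace ℝ (Fin n) → ℝ} {G : Fin n → EuclideanSpace ℝ (Fin n) → ℝ}
  {Ω : Set (EuclideanSpace ℝ (Fin n))}

lemma sum_smul_single (v : EuclideanSpace ℝ (Fin n)) :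
    ∑ i, v i • (EuclideanSpace.single i (1 : ℝ)) = v := by
  ext j
  simp [Finset.sum_apply, Pi.single_apply]

lemma sum_mul_apply_single (A : EuclideanSpace ℝ (Fin n) →L[ℝ] ℝ) (v : EuclideanSpace ℝ (Fin n)) :
    ∑ i, v i * A (EuclideanSpace.single i 1) = A v := by
  conv_rhs => rw [← sum_smul_single v, map_sum]
  simp

lemma abs_apply_le_norm (v : EuclideanSpace ℝ (Fin n)) (i : Fin n) : |v i| ≤ ‖v‖ := by
  simpa using PiLp.norm_apply_le v i

/-- The increment of the averages between two comparable scales. -/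
lemma HasWeakPartials.abs_scaleAverage_vertical_le (hw : HasWeakPartials F G Ω) (hn : 1 ≤ n)
    (hB : 0 ≤ B) (hφ : IsAnnularKernel φ B) {x : EuclideanSpace ℝ (Fin n)} {r r' : ℝ} (hr : 0 < r)
    (hΩ : closedBall x (2 * r) ⊆ Ω) (h1 : r / 2 ≤ r') (h2 : r' ≤ r)
    (hfin : ∫⁻ y in closedBall x r \ ball x (r / 4), ∑ i, ‖G i y‖ₑ ≠ ⊤) :
    |scaleAverage φ F x r - scaleAverage φ F x r'| ≤ B * (2 / r) ^ (n - 1) *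
      (∫⁻ y in closedBall x r \ ball x (r / 4), ∑ i, ‖G i y‖ₑ).toReal := by
  have hr' : 0 < r' := by linarith
  have hdφ : Continuous (fderiv ℝ φ) := hφ.contDiff.continuous_fderiv (by simp)
  have hcφ : Continuous φ := hφ.contDiff.continuous
  have hdiff : Differentiable ℝ φ := hφ.contDiff.differentiable (by simp)
  -- The parameter is the inverse scale. This open set contains the parameters between `1 / r` and
  -- `1 / r'`, and keeps the supports in the ball of radius `2 r`.
  let T : Set ℝ := Ioi (1 / (2 * r))
  have hTpos : ∀ l ∈ T, 0 < l := fun l hl ↦ lt_trans (by positivity) hl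
  -- The derivative of `l^n φ(l(y - x))` in `l` is the divergence in `y` of this field. The field
  -- vanishes wherever the kernel does, in particular near `x`, so only an annulus of the gradient
  -- is seen.
  let V : ℝ → Fin n → EuclideanSpace ℝ (Fin n) → ℝ := fun l i y ↦
    l ^ (n - 1) * ((y - x) i * φ (l • (y - x)))
  let ψ' : ℝ → EuclideanSpace ℝ (Fin n) → ℝ := fun l y ↦
    n * l ^ (n - 1) * φ (l • (y - x)) + l ^ n * fderiv ℝ φ (l • (y - x)) (y - x)
  have key := hw.abs_integral_sub_le (K := closedBall x (2 * r)) (isCompact_closedBall _ _) hΩ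
    (ψ := fun l y ↦ scaledKernel φ x l y) (ψ' := ψ') (V := V) (T := T) isOpen_Ioi ?_ ?_ ?_ ?_ ?_ ?_
    ?_ (A := closedBall x r \ ball x (r / 4))
    (M := r * (2 / r) ^ (n - 1) * B) (τ₀ := r⁻¹) (τ₁ := r'⁻¹) (by positivity) ?_ ?_ ?_ ?_ hfin
  · rw [abs_sub_comm, scaleAverage, scaleAverage]
    refine key.trans ?_
    have h3 : r'⁻¹ - r⁻¹ ≤ r⁻¹ := by
      have : r'⁻¹ ≤ (r / 2)⁻¹ := inv_anti₀ (by positivity) h1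
      rw [inv_div, div_eq_mul_inv] at this
      linarith
    calc _ ≤ r * (2 / r) ^ (n - 1) * B *
          (∫⁻ y in closedBall x r \ ball x (r / 4), ∑ i, ‖G i y‖ₑ).toReal * r⁻¹ := by gcongr
      _ = _ := by field_simp
  · intro l _ y
    have e1 : HasDerivAt (fun l : ℝ ↦ l • (y - x)) (y - x) l := by
      simpa using (hasDerivAt_id l).smul_const (y - x)
    have e2 := (hdiff (l • (y - x))).hasFDerivAt.comp_hasDerivAt l e1
    exact (hasDerivAt_pow n l).mul e2
  · exact fun l ↦ (hφ.contDiff_scaledKernel x l).continuous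
  · simp only [Function.uncurry_def, ψ']
    refine Continuous.add (by fun_prop) (Continuous.mul (by fun_prop) ?_)
    exact (hdφ.comp (by fun_prop)).clm_apply (by fun_prop)
  · intro l hl y hy
    by_contra h
    have h' : φ (l • (y - x)) ≠ 0 := fun h0 ↦ h (by rw [scaledKernel, h0, mul_zero])
    have := (hφ.mem_annulus (hTpos l hl) h').2
    refine hy (mem_closedBall_iff_norm.2 (this.trans ?_))
    rw [div_le_iff₀ (hTpos l hl)]
    have hl' : 1 / (2 * r) < l := hl
    rw [div_lt_iff₀ (by positivity)] at hl'
    linarith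
  · intro l i
    refine contDiff_const.mul (ContDiff.mul ?_ (hφ.contDiff.comp (by fun_prop)))
    fun_prop
  · intro l hl i y hy
    by_contra h
    have h' : φ (l • (y - x)) ≠ 0 := fun h0 ↦ h (by simp only [V, h0, mul_zero])
    have := (hφ.mem_annulus (hTpos l hl) h').2
    refine hy (mem_closedBall_iff_norm.2 (this.trans ?_))
    rw [div_le_iff₀ (hTpos l hl)]
    have hl' : 1 / (2 * r) < l := hl
    rw [div_lt_iff₀ (by positivity)] at hl'
    linarith
  · intro l y
    have hd : ∀ i, fderiv ℝ (V l i) y (EuclideanSpace.single i 1) =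
        l ^ (n - 1) * φ (l • (y - x)) + l ^ n * ((y - x) i *
          fderiv ℝ φ (l • (y - x)) (EuclideanSpace.single i 1)) := by
      intro i
      have e1 : HasFDerivAt (fun y : EuclideanSpace ℝ (Fin n) ↦ l • (y - x))
          (l • ContinuousLinearMap.id ℝ (EuclideanSpace ℝ (Fin n))) y :=
        ((hasFDerivAt_id y).sub_const x).const_smul l
      have e2 := (hdiff (l • (y - x))).hasFDerivAt.comp y e1
      have e3 : HasFDerivAt (fun y : EuclideanSpace ℝ (Fin n) ↦ (y - x) i)
          (EuclideanSpace.proj i : EuclideanSpace ℝ (Fin n) →L[ℝ] ℝ) y :=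
        (EuclideanSpace.proj i : EuclideanSpace ℝ (Fin n) →L[ℝ] ℝ).hasFDerivAt.comp y
          ((hasFDerivAt_id y).sub_const x)
      have e4 := (e3.mul e2).const_mul (l ^ (n - 1))
      have e5 : fderiv ℝ (V l i) y = _ := e4.fderiv
      rw [e5]
      have hln : l ^ n = l ^ (n - 1) * l := by rw [← pow_succ, Nat.sub_add_cancel hn]
      simp [hln]
      ring
    simp_rw [hd]
    rw [Finset.sum_add_distrib, ← Finset.mul_sum Finset.univ _ (l ^ n), sum_mul_apply_single]
    simp only [ψ', Finset.sum_const, Finset.card_univ, Fintype.card_fin, nsmul_eq_mul]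
    ring
  · exact inv_anti₀ hr' h2
  · intro l hl
    refine lt_of_lt_of_le ?_ hl.1
    rw [one_div]
    exact inv_strictAnti₀ hr (by linarith)
  · intro l hl i y
    have hl0 : 0 < l := lt_of_lt_of_le (inv_pos.2 hr) hl.1
    by_cases h : φ (l • (y - x)) = 0
    · simp only [V, h, mul_zero, abs_zero]; positivity
    have hy := (hφ.mem_annulus hl0 h).2
    have hl2 : l ≤ 2 / r := hl.2.trans (by
      rw [show 2 / r = (r / 2)⁻¹ by rw [inv_div]]; exact inv_anti₀ (by positivity) h1)
    have hyr : |(y - x) i| ≤ r := (abs_apply_le_norm _ i).trans (hy.trans (by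
      rw [one_div]; exact inv_le_of_inv_le₀ hr hl.1))
    simp only [V]
    rw [abs_mul, abs_mul, abs_of_pos (pow_pos hl0 _), abs_of_nonneg (hφ.nonneg _)]
    calc l ^ (n - 1) * (|(y - x) i| * φ (l • (y - x)))
        ≤ (2 / r) ^ (n - 1) * (r * B) := by
          have := hφ.nonneg (l • (y - x))
          gcongr
          exact hφ.le _
      _ = _ := by ring
  · intro l hl i y hy
    have hl0 : 0 < l := lt_of_lt_of_le (inv_pos.2 hr) hl.1
    by_contra h
    have h' : φ (l • (y - x)) ≠ 0 := fun h0 ↦ h (by simp only [V, h0, mul_zero])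
    obtain ⟨ha, hb⟩ := hφ.mem_annulus hl0 h'
    refine hy ⟨mem_closedBall_iff_norm.2 (hb.trans ?_), fun hmem ↦ ?_⟩
    · rw [one_div]; exact inv_le_of_inv_le₀ hr hl.1
    · rw [mem_ball_iff_norm] at hmem
      have hl2 : l ≤ 2 / r := hl.2.trans (by
        rw [show 2 / r = (r / 2)⁻¹ by rw [inv_div]]; exact inv_anti₀ (by positivity) h1)
      have : r / 4 ≤ 1 / (2 * l) := by
        rw [le_div_iff₀ (by positivity)]
        rw [le_div_iff₀ hr] at hl2
        linarith
      linarith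

/-- The increment of the averages between two points at distance at most the scale. -/
lemma HasWeakPartials.abs_scaleAverage_horizontal_le (hw : HasWeakPartials F G Ω)
    (hB : 0 ≤ B) (hφ : IsAnnularKernel φ B) {x z : EuclideanSpace ℝ (Fin n)} {r : ℝ} (hr : 0 < r)
    (hΩ : closedBall x (3 * r) ⊆ Ω) (hz : dist x z ≤ r)
    (hfin : ∫⁻ y in closedBall x (3 * r), ∑ i, ‖G i y‖ₑ ≠ ⊤) :
    |scaleAverage φ F x r - scaleAverage φ F z r| ≤ B * r * r⁻¹ ^ n *
      (∫⁻ y in closedBall x (3 * r), ∑ i, ‖G i y‖ₑ).toReal := by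
  have hdφ : Continuous (fderiv ℝ φ) := hφ.contDiff.continuous_fderiv (by simp)
  have hcφ : Continuous φ := hφ.contDiff.continuous
  have hdiff : Differentiable ℝ φ := hφ.contDiff.differentiable (by simp)
  set v := z - x with hv
  have hvr : ‖v‖ ≤ r := by rwa [hv, ← dist_eq_norm, dist_comm]
  set l := r⁻¹ with hl
  have hl0 : 0 < l := inv_pos.2 hr
  -- Moving the centre with velocity `v` changes the kernel by the divergence of `-v` times the
  -- kernel.
  let V : ℝ → Fin n → EuclideanSpace ℝ (Fin n) → ℝ := fun τ i y ↦
    -(v i) * scaledKernel φ (x + τ • v) l y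
  let ψ' : ℝ → EuclideanSpace ℝ (Fin n) → ℝ := fun τ y ↦
    l ^ n * fderiv ℝ φ (l • (y - (x + τ • v))) (l • (-v))
  have hzero : ∀ τ ∈ Ioo (-1 : ℝ) 2, ∀ y ∉ closedBall x (3 * r),
      scaledKernel φ (x + τ • v) l y = 0 := by
    intro τ hτ y hy
    refine hφ.scaledKernel_eq_zero hr fun hmem ↦ hy ?_
    rw [mem_closedBall] at hmem ⊢
    have h1 := dist_triangle y (x + τ • v) x
    have h2 : dist (x + τ • v) x ≤ 2 * r := by
      rw [dist_eq_norm, add_sub_cancel_left, norm_smul]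
      have : ‖τ‖ ≤ 2 := by rw [Real.norm_eq_abs, abs_le]; constructor <;> linarith [hτ.1, hτ.2]
      gcongr
    linarith
  have hsub : Icc (0 : ℝ) 1 ⊆ Ioo (-1 : ℝ) 2 := fun τ hτ ↦
    ⟨by linarith [hτ.1], by linarith [hτ.2]⟩
  have key := hw.abs_integral_sub_le (K := closedBall x (3 * r)) (isCompact_closedBall _ _) hΩ
    (ψ := fun τ y ↦ scaledKernel φ (x + τ • v) l y) (ψ' := ψ') (V := V) (T := Ioo (-1) 2)
    isOpen_Ioo ?_ ?_ ?_ hzero ?_ ?_ ?_ (A := closedBall x (3 * r))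
    (M := B * r * l ^ n) (τ₀ := 0) (τ₁ := 1) (by positivity) zero_le_one hsub ?_ ?_ hfin
  · rw [abs_sub_comm, scaleAverage, scaleAverage]
    simpa [hv] using key
  · intro τ _ y
    have e1 : HasDerivAt (fun τ : ℝ ↦ l • (y - (x + τ • v))) (l • (-v)) τ := by
      have : HasDerivAt (fun τ : ℝ ↦ τ • v) v τ := by
        simpa using (hasDerivAt_id τ).smul_const v
      exact ((this.const_add x).const_sub y).const_smul l
    have e2 := (hdiff (l • (y - (x + τ • v)))).hasFDerivAt.comp_hasDerivAt τ e1
    exact e2.const_mul (l ^ n)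
  · exact fun τ ↦ (hφ.contDiff_scaledKernel _ l).continuous
  · simp only [Function.uncurry_def, ψ']
    refine Continuous.mul (by fun_prop) ?_
    exact (hdφ.comp (by fun_prop)).clm_apply (by fun_prop)
  · exact fun τ i ↦ contDiff_const.mul (hφ.contDiff_scaledKernel _ l)
  · intro τ hτ i y hy
    simp only [V, hzero τ hτ y hy, mul_zero]
  · intro τ y
    have hd : ∀ i, fderiv ℝ (V τ i) y (EuclideanSpace.single i 1) =
        -(v i) * (l ^ n * fderiv ℝ φ (l • (y - (x + τ • v))) (l • EuclideanSpace.single i 1)) := by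
      intro i
      have e1 : HasFDerivAt (fun y : EuclideanSpace ℝ (Fin n) ↦ l • (y - (x + τ • v)))
          (l • ContinuousLinearMap.id ℝ (EuclideanSpace ℝ (Fin n))) y :=
        ((hasFDerivAt_id y).sub_const _).const_smul l
      have e2 := (hdiff (l • (y - (x + τ • v)))).hasFDerivAt.comp y e1
      have e4 := (e2.const_mul (l ^ n)).const_mul (-(v i))
      have e5 : fderiv ℝ (V τ i) y = _ := e4.fderiv
      rw [e5]
      simp
    simp_rw [hd]
    simp only [ψ', map_smul, smul_eq_mul, map_neg]
    rw [← sum_mul_apply_single _ v]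
    simp only [Finset.mul_sum, ← Finset.sum_neg_distrib]
    exact Finset.sum_congr rfl fun i _ ↦ by ring
  · intro τ _ i y
    simp only [V]
    rw [abs_mul, abs_neg, abs_of_nonneg (hφ.scaledKernel_nonneg _ hl0.le y)]
    calc |v i| * scaledKernel φ (x + τ • v) l y ≤ r * (l ^ n * B) := by
          gcongr
          · exact hφ.scaledKernel_nonneg _ hl0.le y
          · exact (abs_apply_le_norm v i).trans hvr
          · exact hφ.scaledKernel_le _ hl0.le y
      _ = _ := by ring
  · intro τ hτ i y hy
    simp only [V, hzero τ (hsub hτ) y hy, mul_zero]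

end Averages

/-! ### From the gradient to the energy in the critical exponent. -/

section Energy

variable {n : ℕ} {φ : EuclideanSpace ℝ (Fin n) → ℝ} {B : ℝ}
  {F : EuclideanSpace ℝ (Fin n) → ℝ} {G : Fin n → EuclideanSpace ℝ (Fin n) → ℝ}
  {Ω : Set (EuclideanSpace ℝ (Fin n))}

/-- Hölder's inequality with a constant function, for natural exponents. -/
lemma lintegral_pow_le {α : Type*} [MeasurableSpace α] {μ : Measure α} {h : α → ℝ≥0∞}
    (hh : AEMeasurable h μ) (hn : 1 ≤ n) :
    (∫⁻ y, h y ∂μ) ^ n ≤ μ univ ^ (n - 1) * ∫⁻ y, h y ^ n ∂μ := by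
  have hn0 : (n : ℝ) ≠ 0 := by exact_mod_cast (by omega : n ≠ 0)
  have h1 := eLpNorm_le_eLpNorm_mul_rpow_measure_univ (μ := μ) (f := h) (p := 1) (q := n)
    (by exact_mod_cast hn) hh.aestronglyMeasurable
  rw [eLpNorm_one_eq_lintegral_enorm, eLpNorm_eq_lintegral_rpow_enorm_toReal
    (by exact_mod_cast (by omega : n ≠ 0)) (by simp)] at h1
  simp only [enorm_eq_self, ENNReal.toReal_natCast, ENNReal.rpow_natCast, ENNReal.toReal_one]
    at h1
  refine (pow_le_pow_left₀ zero_le h1 n).trans (le_of_eq ?_)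
  rw [mul_pow, ← ENNReal.rpow_natCast, ← ENNReal.rpow_mul, one_div_mul_cancel hn0,
    ENNReal.rpow_one, ← ENNReal.rpow_natCast (_ ^ _) n, ← ENNReal.rpow_mul, mul_comm]
  congr 1
  rw [← ENNReal.rpow_natCast, Nat.cast_sub hn]
  congr 1
  field_simp
  simp

/-- The measure with density the `n`-th power of the gradient. -/
def energyMeasure (G : Fin n → EuclideanSpace ℝ (Fin n) → ℝ)
    (Ω : Set (EuclideanSpace ℝ (Fin n))) : Measure (EuclideanSpace ℝ (Fin n)) :=
  (volume.restrict Ω).withDensity fun y ↦ (∑ i, ‖G i y‖ₑ) ^ n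

lemma energyMeasure_apply {A : Set (EuclideanSpace ℝ (Fin n))} (hA : MeasurableSet A)
    (hAΩ : A ⊆ Ω) : energyMeasure G Ω A = ∫⁻ y in A, (∑ i, ‖G i y‖ₑ) ^ n := by
  rw [energyMeasure, withDensity_apply _ hA, Measure.restrict_restrict hA, inter_eq_left.2 hAΩ]

/-- The volume of the unit ball. -/
def unitVolume (n : ℕ) : ℝ := volume.real (ball (0 : EuclideanSpace ℝ (Fin n)) 1)

lemma unitVolume_pos (n : ℕ) : 0 < unitVolume n :=
  ENNReal.toReal_pos (measure_ball_pos _ _ one_pos).ne' measure_ball_lt_top.ne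

lemma volume_closedBall_eq (x : EuclideanSpace ℝ (Fin n)) {r : ℝ} (hr : 0 ≤ r) :
    volume (closedBall x r) = ENNReal.ofReal (r ^ n * unitVolume n) := by
  rw [Measure.addHaar_closedBall _ _ hr, finrank_euclideanSpace_fin,
    ENNReal.ofReal_mul (by positivity), unitVolume, measureReal_def,
    ENNReal.ofReal_toReal measure_ball_lt_top.ne]

/-- The constant relating the increments of the averages to the energy. -/
def energyConst (n : ℕ) (B : ℝ) : ℝ := (B * 2 ^ (n - 1)) ^ n * (3 ^ n * unitVolume n) ^ (n - 1)

lemma energyConst_nonneg (hB : 0 ≤ B) : 0 ≤ energyConst n B := by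
  have := unitVolume_pos n
  unfold energyConst
  positivity

lemma HasWeakPartials.aemeasurable (hw : HasWeakPartials F G Ω) {A : Set (EuclideanSpace ℝ (Fin n))}
    (hAΩ : A ⊆ Ω) : AEMeasurable (fun y ↦ ∑ i, ‖G i y‖ₑ) (volume.restrict A) := by
  refine Finset.aemeasurable_fun_sum _ fun i _ ↦ ?_
  exact ((hw.locallyIntegrable_partial i).aestronglyMeasurable.mono_measure
    (Measure.restrict_mono hAΩ le_rfl)).enorm

lemma HasWeakPartials.lintegral_pow_le (hw : HasWeakPartials F G Ω) (hn : 1 ≤ n)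
    {x : EuclideanSpace ℝ (Fin n)} {r : ℝ} (hr : 0 < r) {A : Set (EuclideanSpace ℝ (Fin n))}
    (hA : MeasurableSet A) (hAΩ : A ⊆ Ω) (hAx : A ⊆ closedBall x (3 * r)) :
    (∫⁻ y in A, ∑ i, ‖G i y‖ₑ) ^ n ≤
      ENNReal.ofReal ((r ^ n * (3 ^ n * unitVolume n)) ^ (n - 1)) * energyMeasure G Ω A := by
  refine (ConformalWeight.lintegral_pow_le (hw.aemeasurable hAΩ) hn).trans ?_
  rw [energyMeasure_apply hA hAΩ, Measure.restrict_apply_univ]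
  gcongr
  rw [ENNReal.ofReal_pow (by have := unitVolume_pos n; positivity)]
  gcongr
  refine (measure_mono hAx).trans ?_
  rw [volume_closedBall_eq _ (by positivity), mul_pow]
  apply ENNReal.ofReal_le_ofReal
  linarith

lemma HasWeakPartials.lintegral_ne_top (hw : HasWeakPartials F G Ω) (hn : 1 ≤ n)
    (hfin : energyMeasure G Ω univ ≠ ⊤)
    {x : EuclideanSpace ℝ (Fin n)} {r : ℝ} (hr : 0 < r) {A : Set (EuclideanSpace ℝ (Fin n))}
    (hA : MeasurableSet A) (hAΩ : A ⊆ Ω) (hAx : A ⊆ closedBall x (3 * r)) :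
    ∫⁻ y in A, ∑ i, ‖G i y‖ₑ ≠ ⊤ := by
  intro h
  have := hw.lintegral_pow_le hn hr hA hAΩ hAx
  rw [h, ENNReal.top_pow (by omega), top_le_iff] at this
  exact ENNReal.mul_ne_top ENNReal.ofReal_ne_top
    (ne_top_of_le_ne_top hfin (measure_mono (subset_univ A))) this

/-- Hölder on a set inside a ball of radius `3 r` costs `r^(n (n-1))`, exactly cancelling the `n`-th
power of `(2 / r)^(n-1)`. The constant is therefore independent of the scale. -/
lemma HasWeakPartials.pow_le_energy (hw : HasWeakPartials F G Ω) (hn : 1 ≤ n) (hB : 0 ≤ B)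
    (hfin : energyMeasure G Ω univ ≠ ⊤)
    {x : EuclideanSpace ℝ (Fin n)} {r : ℝ} (hr : 0 < r) {A : Set (EuclideanSpace ℝ (Fin n))}
    (hA : MeasurableSet A) (hAΩ : A ⊆ Ω) (hAx : A ⊆ closedBall x (3 * r)) {u : ℝ} (hu : 0 ≤ u)
    (h : u ≤ B * (2 / r) ^ (n - 1) * (∫⁻ y in A, ∑ i, ‖G i y‖ₑ).toReal) :
    u ^ n ≤ (ENNReal.ofReal (energyConst n B) • energyMeasure G Ω).real A := by
  have hω := unitVolume_pos n
  have h1 := hw.lintegral_pow_le hn hr hA hAΩ hAx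
  have hfinA : energyMeasure G Ω A ≠ ⊤ :=
    ne_top_of_le_ne_top hfin (measure_mono (subset_univ A))
  have h2 := ENNReal.toReal_mono (ENNReal.mul_ne_top ENNReal.ofReal_ne_top hfinA) h1
  rw [ENNReal.toReal_pow, ENNReal.toReal_mul, ENNReal.toReal_ofReal (by positivity)] at h2
  rw [measureReal_ennreal_smul_apply, ENNReal.toReal_ofReal (energyConst_nonneg hB)]
  calc u ^ n ≤ (B * (2 / r) ^ (n - 1) * (∫⁻ y in A, ∑ i, ‖G i y‖ₑ).toReal) ^ n := by gcongr
    _ = (B * (2 / r) ^ (n - 1)) ^ n * (∫⁻ y in A, ∑ i, ‖G i y‖ₑ).toReal ^ n := mul_pow _ _ _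
    _ ≤ (B * (2 / r) ^ (n - 1)) ^ n * ((r ^ n * (3 ^ n * unitVolume n)) ^ (n - 1) *
        (energyMeasure G Ω A).toReal) := by gcongr
    _ = _ := by
        rw [energyConst, measureReal_def, div_pow, mul_pow (r ^ n), ← pow_mul, mul_pow B, div_pow,
          ← pow_mul r, mul_comm (n - 1) n]
        field_simp
        ring

/-- Averages of a function with weak partial derivatives in `Lⁿ` are controlled in terms of the
energy. -/
lemma HasWeakPartials.scaleControl (hw : HasWeakPartials F G Ω) (hn : 1 ≤ n) (hB : 0 ≤ B)
    (hφ : IsAnnularKernel φ B) {S : Set (EuclideanSpace ℝ (Fin n))} {R J : ℝ} (hJ : 1 ≤ J)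
    (hmass : ENNReal.ofReal (energyConst n B) * energyMeasure G Ω univ ≤ ENNReal.ofReal J)
    (hfin : energyMeasure G Ω univ ≠ ⊤)
    (hS : ∀ x ∈ S, closedBall x (3 * R) ⊆ Ω) :
    ScaleControl n (ENNReal.ofReal (energyConst n B) • energyMeasure G Ω) (scaleAverage φ F) S R J
    where
  one_le_dim := hn
  one_le := hJ
  mass_le := hmass
  vertical := by
    intro x hx r r' hr hR h1 h2
    have hsub : closedBall x r \ ball x (r / 4) ⊆ closedBall x (3 * r) :=
      sdiff_subset.trans (closedBall_subset_closedBall (by linarith))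
    have hΩ : closedBall x (3 * r) ⊆ Ω :=
      (closedBall_subset_closedBall (by linarith)).trans (hS x hx)
    have hm : MeasurableSet (closedBall x r \ ball x (r / 4)) :=
      measurableSet_closedBall.diff measurableSet_ball
    refine hw.pow_le_energy hn hB hfin hr hm (hsub.trans hΩ) hsub (abs_nonneg _) ?_
    exact hw.abs_scaleAverage_vertical_le hn hB hφ hr
      ((closedBall_subset_closedBall (by linarith)).trans hΩ) h1 h2
      (hw.lintegral_ne_top hn hfin hr hm (hsub.trans hΩ) hsub)
  horizontal := by
    intro x hx z _ r hr hR hd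
    have hΩ : closedBall x (3 * r) ⊆ Ω :=
      (closedBall_subset_closedBall (by linarith)).trans (hS x hx)
    refine le_of_pow_le_of_one_le hn hJ ((hw.pow_le_energy hn hB hfin hr
      measurableSet_closedBall hΩ subset_rfl (abs_nonneg _) ?_).trans (?_ : _ ≤ J))
    · refine (hw.abs_scaleAverage_horizontal_le hB hφ hr hΩ hd
        (hw.lintegral_ne_top hn hfin hr measurableSet_closedBall hΩ subset_rfl)).trans ?_
      refine mul_le_mul_of_nonneg_right ?_ ENNReal.toReal_nonneg
      rw [mul_assoc]
      refine mul_le_mul_of_nonneg_left ?_ hB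
      have e : r * r⁻¹ ^ n = r⁻¹ ^ (n - 1) := by
        obtain ⟨k, rfl⟩ := Nat.exists_eq_add_of_le' hn
        rw [Nat.add_sub_cancel, pow_succ]
        field_simp
      rw [e, div_eq_mul_inv]
      gcongr
      linarith [inv_pos.2 hr]
    · refine ENNReal.toReal_le_of_le_ofReal (by linarith) (le_trans ?_ hmass)
      rw [Measure.smul_apply, smul_eq_mul]
      gcongr
      exact subset_univ _

end Energy

/-! ### Comparison of `∫ exp (n F)` over balls with the averages. -/

section Exponential

variable {n : ℕ} {φ : EuclideanSpace ℝ (Fin n) → ℝ} {B : ℝ} {F : EuclideanSpace ℝ (Fin n) → ℝ}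

lemma IsAnnularKernel.continuous_scaleAverage (hφ : IsAnnularKernel φ B) (hF : Integrable F)
    {s : ℝ} (hs : 0 < s) : Continuous fun x ↦ scaleAverage φ F x s := by
  have hcφ : Continuous φ := hφ.contDiff.continuous
  refine continuous_of_dominated (bound := fun y ↦ ‖F y‖ * (s⁻¹ ^ n * B)) ?_ ?_ ?_ ?_
  · exact fun x ↦ hF.aestronglyMeasurable.mul
      (hφ.contDiff_scaledKernel x _).continuous.aestronglyMeasurable
  · refine fun x ↦ Eventually.of_forall fun y ↦ ?_
    rw [norm_mul, Real.norm_of_nonneg (hφ.scaledKernel_nonneg x (inv_pos.2 hs).le y)]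
    gcongr
    exact hφ.scaledKernel_le x (inv_pos.2 hs).le y
  · exact hF.norm.mul_const _
  · refine Eventually.of_forall fun y ↦ ?_
    unfold scaledKernel
    fun_prop

/-- The rescaled kernel has integral one and is at most `B * unitVolume n` times the uniform density
of the ball. This reduces convergence of the averages to Lebesgue differentiation. -/
lemma IsAnnularKernel.abs_scaleAverage_sub_le (hφ : IsAnnularKernel φ B) (hF : Integrable F)
    (x : EuclideanSpace ℝ (Fin n)) {s : ℝ} (hs : 0 < s) :
    |scaleAverage φ F x s - F x| ≤
      B * unitVolume n * ⨍ y in closedBall x s, ‖F y - F x‖ := by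
  have hk : Continuous (scaledKernel φ x s⁻¹) := (hφ.contDiff_scaledKernel x _).continuous
  have hk0 : ∀ y ∉ closedBall x s, scaledKernel φ x s⁻¹ y = 0 := fun y hy ↦
    hφ.scaledKernel_eq_zero hs hy
  have hω := unitVolume_pos n
  have hint1 : Integrable fun y ↦ F y * scaledKernel φ x s⁻¹ y :=
    integrable_mul_of_eq_zero (isCompact_closedBall x s) hF.integrableOn hk hk0
  have hint2 : Integrable fun y ↦ F x * scaledKernel φ x s⁻¹ y :=
    integrable_mul_of_eq_zero (isCompact_closedBall x s)
      (integrableOn_const (measure_closedBall_lt_top.ne)) hk hk0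
  have e1 : scaleAverage φ F x s - F x = ∫ y, (F y - F x) * scaledKernel φ x s⁻¹ y := by
    simp_rw [sub_mul]
    rw [integral_sub hint1 hint2, integral_const_mul, hφ.integral_scaledKernel x hs, mul_one]
    rfl
  have e2 : ∫ y, (F y - F x) * scaledKernel φ x s⁻¹ y =
      ∫ y in closedBall x s, (F y - F x) * scaledKernel φ x s⁻¹ y :=
    (setIntegral_eq_integral_of_forall_compl_eq_zero fun y hy ↦ by
      rw [hk0 y hy, mul_zero]).symm
  rw [e1, e2, ← Real.norm_eq_abs]
  have hsub_int : IntegrableOn (fun y ↦ F y - F x) (closedBall x s) :=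
    hF.integrableOn.sub (integrableOn_const (measure_closedBall_lt_top.ne))
  calc ‖∫ y in closedBall x s, (F y - F x) * scaledKernel φ x s⁻¹ y‖
      ≤ ∫ y in closedBall x s, ‖F y - F x‖ * (s⁻¹ ^ n * B) := by
        refine norm_integral_le_of_norm_le (hsub_int.norm.mul_const _) (Eventually.of_forall fun y ↦ ?_)
        rw [norm_mul, Real.norm_of_nonneg (hφ.scaledKernel_nonneg x (inv_pos.2 hs).le y)]
        gcongr
        exact hφ.scaledKernel_le x (inv_pos.2 hs).le y
    _ = _ := by
        rw [integral_mul_const, setAverage_eq, measureReal_def, volume_closedBall_eq _ hs.le,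
          ENNReal.toReal_ofReal (by positivity), smul_eq_mul, inv_pow]
        field_simp

lemma IsAnnularKernel.ae_tendsto_scaleAverage (hφ : IsAnnularKernel φ B) (hF : Integrable F)
    {r : ℝ} (hr : 0 < r) :
    ∀ᵐ x, Tendsto (fun m : ℕ ↦ scaleAverage φ F x (r / 2 ^ m)) atTop (𝓝 (F x)) := by
  filter_upwards [IsUnifLocDoublingMeasure.ae_tendsto_average_norm_sub volume
    hF.locallyIntegrable 1] with x hx
  have hpos : ∀ m : ℕ, 0 < r / 2 ^ m := fun m ↦ by positivity
  have hlim : Tendsto (fun m : ℕ ↦ r / 2 ^ m) atTop (𝓝[>] 0) := by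
    refine tendsto_nhdsWithin_iff.2 ⟨?_, Eventually.of_forall hpos⟩
    have := (tendsto_pow_atTop_nhds_zero_of_lt_one (r := (1 / 2 : ℝ)) (by norm_num)
      (by norm_num)).const_mul r
    simpa [div_eq_mul_inv] using this
  have h1 := hx (fun _ ↦ x) (fun m : ℕ ↦ r / 2 ^ m) hlim (Eventually.of_forall fun m ↦
    mem_closedBall_self (by rw [one_mul]; exact (hpos m).le))
  rw [tendsto_iff_norm_sub_tendsto_zero]
  refine squeeze_zero (fun _ ↦ norm_nonneg _)
    (fun m ↦ hφ.abs_scaleAverage_sub_le hF x (hpos m)) ?_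
  simpa using h1.const_mul (B * unitVolume n)

lemma IsAnnularKernel.scaleAverage_congr (hφ : IsAnnularKernel φ B)
    {F' : EuclideanSpace ℝ (Fin n) → ℝ} {x : EuclideanSpace ℝ (Fin n)} {s : ℝ} (hs : 0 < s)
    (h : ∀ y ∈ closedBall x s, F y = F' y) : scaleAverage φ F x s = scaleAverage φ F' x s := by
  refine integral_congr_ae (Eventually.of_forall fun y ↦ ?_)
  by_cases hy : y ∈ closedBall x s
  · simp only [h y hy]
  · simp only [hφ.scaledKernel_eq_zero hs hy, mul_zero]

/-- The constant in the exponential integrability estimate. -/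
def expConst (n : ℕ) (J : ℝ) : ℝ :=
  Real.exp (n * (J + 3 * J / (Real.log (3 / 2) / n) ^ (n - 1) + ScaleControl.geomBound n)) *
    (7 * J * (3 ^ n * unitVolume n))

/-- `lintegral_exp_le` bounds the integrals of `exp (n a)` at scale `r / 2^m` uniformly in `m`. The
averages converge to `F` almost everywhere, so Fatou's lemma concludes. -/
lemma ScaleControl.lintegral_closedBall_exp_le {ν : Measure (EuclideanSpace ℝ (Fin n))}
    {S : Set (EuclideanSpace ℝ (Fin n))} {R J : ℝ} (hφ : IsAnnularKernel φ B)
    (h : ScaleControl n ν (scaleAverage φ F) S R J)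
    {x : EuclideanSpace ℝ (Fin n)} {r : ℝ} (hr : 0 < r) (hR : r ≤ R) (hS : closedBall x r ⊆ S)
    (hF : IntegrableOn F (closedBall x (2 * r))) :
    ∫⁻ z in closedBall x r, ENNReal.ofReal (Real.exp (n * F z)) ≤
      ENNReal.ofReal (expConst n J * r ^ n * Real.exp (n * scaleAverage φ F x r)) := by
  have hω := unitVolume_pos n
  have hn := h.one_le_dim
  have hJ := h.one_le
  -- Truncation makes the function integrable on the whole space without changing the averages at
  -- points of the ball and at scales at most `r`.
  set F' : EuclideanSpace ℝ (Fin n) → ℝ := (closedBall x (2 * r)).indicator F with hF'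
  have hF'i : Integrable F' := hF.integrable_indicator measurableSet_closedBall
  have hle : ∀ m : ℕ, r / 2 ^ m ≤ r := fun m ↦ div_le_self hr.le (one_le_pow₀ (by norm_num))
  have hpos : ∀ m : ℕ, 0 < r / 2 ^ m := fun m ↦ by positivity
  have havg : ∀ z ∈ closedBall x r, ∀ m : ℕ,
      scaleAverage φ F' z (r / 2 ^ m) = scaleAverage φ F z (r / 2 ^ m) := by
    intro z hz m
    refine hφ.scaleAverage_congr (hpos m) fun y hy ↦ indicator_of_mem ?_ _
    rw [mem_closedBall] at hz hy ⊢
    linarith [dist_triangle y z x, hle m]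
  have hrn : r ^ n = r ^ (n - 1) * r := by rw [← pow_succ, Nat.sub_add_cancel hn]
  have hstep : ∀ m : ℕ, ∫⁻ z in closedBall x r,
      ENNReal.ofReal (Real.exp (n * scaleAverage φ F' z (r / 2 ^ m))) ≤
      ENNReal.ofReal (expConst n J * r ^ n * Real.exp (n * scaleAverage φ F x r)) := by
    intro m
    -- Lebesgue measure divided by `r^(n-1)` has linear growth up to scale `r`, since `t^n ≤ r^(n-1)
    -- t` for `t ≤ r`.
    have hκ : ∀ z : EuclideanSpace ℝ (Fin n), ∀ t, 0 < t → t ≤ r →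
        (ENNReal.ofReal (r ^ (n - 1))⁻¹ • (volume : Measure (EuclideanSpace ℝ (Fin n))))
          (closedBall z (3 * t)) ≤ ENNReal.ofReal (3 ^ n * unitVolume n * t) := by
      intro z t ht htr
      rw [Measure.smul_apply, smul_eq_mul, volume_closedBall_eq _ (by positivity),
        ← ENNReal.ofReal_mul (by positivity)]
      apply ENNReal.ofReal_le_ofReal
      have htn : t ^ n = t ^ (n - 1) * t := by rw [← pow_succ, Nat.sub_add_cancel hn]
      rw [mul_pow, htn, inv_mul_le_iff₀ (by positivity)]
      calc 3 ^ n * (t ^ (n - 1) * t) * unitVolume n = t ^ (n - 1) * (3 ^ n * unitVolume n * t) := by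
            ring
        _ ≤ _ := by gcongr
    have key := h.lintegral_exp_le (q := n) (D := 3 ^ n * unitVolume n)
      (by exact_mod_cast hn) (by positivity) hr hR hS m
      (ENNReal.ofReal (r ^ (n - 1))⁻¹ • volume)
      ((measure_mono (closedBall_subset_closedBall (by linarith))).trans (hκ x r hr le_rfl))
      (fun z _ t ht htr ↦ hκ z t (lt_of_lt_of_le (hpos m) ht) htr)
    rw [Measure.restrict_smul, lintegral_smul_measure, smul_eq_mul] at key
    have e : ∫⁻ z in closedBall x r,
        ENNReal.ofReal (Real.exp (n * scaleAverage φ F' z (r / 2 ^ m))) =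
        ∫⁻ z in closedBall x r,
          ENNReal.ofReal (Real.exp (n * scaleAverage φ F z (r / 2 ^ m))) :=
      setLIntegral_congr_fun measurableSet_closedBall fun z hz ↦ by rw [havg z hz m]
    rw [e]
    have h2 := mul_le_mul_right key (ENNReal.ofReal (r ^ (n - 1)))
    rw [← mul_assoc, ← ENNReal.ofReal_mul (by positivity), mul_inv_cancel₀ (by positivity),
      ENNReal.ofReal_one, one_mul, ← ENNReal.ofReal_mul (by positivity)] at h2
    refine h2.trans (le_of_eq ?_)
    rw [expConst, hrn]
    congr 1
    ring
  have hcont : ∀ m : ℕ, Measurable fun z ↦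
      ENNReal.ofReal (Real.exp (n * scaleAverage φ F' z (r / 2 ^ m))) := by
    intro m
    have := hφ.continuous_scaleAverage hF'i (hpos m)
    exact (ENNReal.continuous_ofReal.comp (Real.continuous_exp.comp
      (continuous_const.mul this))).measurable
  calc ∫⁻ z in closedBall x r, ENNReal.ofReal (Real.exp (n * F z))
      = ∫⁻ z in closedBall x r, liminf (fun m : ℕ ↦
          ENNReal.ofReal (Real.exp (n * scaleAverage φ F' z (r / 2 ^ m)))) atTop := by
        refine lintegral_congr_ae ?_
        filter_upwards [ae_restrict_mem measurableSet_closedBall,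
          ae_restrict_of_ae (hφ.ae_tendsto_scaleAverage hF'i hr)] with z hz hlim
        have hzF : F z = F' z := by
          rw [hF', indicator_of_mem]
          exact closedBall_subset_closedBall (by linarith) hz
        rw [hzF]
        refine (Tendsto.liminf_eq ?_).symm
        exact (ENNReal.continuous_ofReal.tendsto _).comp
          ((Real.continuous_exp.tendsto _).comp (hlim.const_mul (n : ℝ)))
    _ ≤ liminf (fun m : ℕ ↦ ∫⁻ z in closedBall x r,
          ENNReal.ofReal (Real.exp (n * scaleAverage φ F' z (r / 2 ^ m)))) atTop :=
        lintegral_liminf_le hcont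
    _ ≤ _ := by
        refine liminf_le_of_le ⟨0, Eventually.of_forall fun _ ↦ zero_le⟩ fun b hb ↦ ?_
        obtain ⟨m, hm⟩ := hb.exists
        exact hm.trans (hstep m)

lemma ofReal_integral_le_lintegral_ofReal {α : Type*} [MeasurableSpace α] {μ : Measure α}
    {g : α → ℝ} (hg : Integrable g μ) :
    ENNReal.ofReal (∫ y, g y ∂μ) ≤ ∫⁻ y, ENNReal.ofReal (g y) ∂μ := by
  have h1 : ∫ y, g y ∂μ ≤ ∫ y, max (g y) 0 ∂μ :=
    integral_mono hg hg.pos_part fun y ↦ le_max_left _ _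
  refine (ENNReal.ofReal_le_ofReal h1).trans ?_
  rw [ofReal_integral_eq_lintegral_ofReal hg.pos_part (Eventually.of_forall fun y ↦ le_max_right _ _)]
  refine lintegral_mono fun y ↦ ?_
  rw [ENNReal.ofReal_max, ENNReal.ofReal_zero, max_eq_left zero_le]

/-- Jensen's inequality for the averages. -/
lemma IsAnnularKernel.exp_scaleAverage_le (hφ : IsAnnularKernel φ B)
    {x : EuclideanSpace ℝ (Fin n)} {s : ℝ} (hs : 0 < s) (hF : IntegrableOn F (closedBall x s)) :
    ENNReal.ofReal (s ^ n * Real.exp (n * scaleAverage φ F x s)) ≤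
      ENNReal.ofReal B * ∫⁻ z in closedBall x s, ENNReal.ofReal (Real.exp (n * F z)) := by
  set A := scaleAverage φ F x s with hA
  have hB : 0 ≤ B := (hφ.nonneg 0).trans (hφ.le 0)
  have hk : Continuous (scaledKernel φ x s⁻¹) := (hφ.contDiff_scaledKernel x _).continuous
  have hk0 : ∀ y ∉ closedBall x s, scaledKernel φ x s⁻¹ y = 0 := fun y hy ↦
    hφ.scaledKernel_eq_zero hs hy
  have hint1 : Integrable fun y ↦ F y * scaledKernel φ x s⁻¹ y :=
    integrable_mul_of_eq_zero (isCompact_closedBall x s) hF hk hk0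
  have hint2 : Integrable (scaledKernel φ x s⁻¹) := by
    simpa using integrable_mul_of_eq_zero (F := fun _ ↦ (1 : ℝ)) (μ := volume)
      (isCompact_closedBall x s) (integrableOn_const (measure_closedBall_lt_top.ne)) hk hk0
  -- The tangent line of `exp (n ·)` at the average `A`, weighted by the kernel: its integral is
  -- `exp (n A)`, and it lies below `exp (n F)` times the kernel. Integrability of `exp (n F)` is
  -- not needed.
  set g : EuclideanSpace ℝ (Fin n) → ℝ := fun y ↦
    Real.exp (n * A) * (1 - n * A) * scaledKernel φ x s⁻¹ y +
      Real.exp (n * A) * n * (F y * scaledKernel φ x s⁻¹ y) with hg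
  have hgi : Integrable g := (hint2.const_mul _).add (hint1.const_mul _)
  have hgint : ∫ y, g y = Real.exp (n * A) := by
    rw [hg, integral_add (hint2.const_mul _) (hint1.const_mul _), integral_const_mul,
      integral_const_mul, hφ.integral_scaledKernel x hs]
    have : ∫ y, F y * scaledKernel φ x s⁻¹ y = A := rfl
    rw [this]
    ring
  have hle : ∀ y, ENNReal.ofReal (g y) ≤ (closedBall x s).indicator
      (fun y ↦ ENNReal.ofReal (s⁻¹ ^ n * B) * ENNReal.ofReal (Real.exp (n * F y))) y := by
    intro y
    by_cases hy : y ∈ closedBall x s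
    · rw [indicator_of_mem hy, ← ENNReal.ofReal_mul (by positivity)]
      apply ENNReal.ofReal_le_ofReal
      have h1 : Real.exp (n * A) * (1 + (n * F y - n * A)) ≤ Real.exp (n * F y) := by
        have := Real.add_one_le_exp (n * F y - n * A)
        calc _ ≤ Real.exp (n * A) * Real.exp (n * F y - n * A) := by
              gcongr; linarith
          _ = _ := by rw [← Real.exp_add]; ring_nf
      have h2 := hφ.scaledKernel_nonneg x (inv_pos.2 hs).le y
      calc g y = (Real.exp (n * A) * (1 + (n * F y - n * A))) * scaledKernel φ x s⁻¹ y := by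
            rw [hg]; ring
        _ ≤ Real.exp (n * F y) * (s⁻¹ ^ n * B) := by
            refine (mul_le_mul_of_nonneg_right h1 h2).trans ?_
            gcongr
            exact hφ.scaledKernel_le x (inv_pos.2 hs).le y
        _ = _ := by ring
    · simp [hg, hk0 y hy]
  have h3 : ENNReal.ofReal (Real.exp (n * A)) ≤ ENNReal.ofReal (s⁻¹ ^ n * B) *
      ∫⁻ z in closedBall x s, ENNReal.ofReal (Real.exp (n * F z)) := by
    rw [← hgint]
    refine (ofReal_integral_le_lintegral_ofReal hgi).trans ((lintegral_mono hle).trans ?_)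
    rw [lintegral_indicator measurableSet_closedBall, lintegral_const_mul' _ _ ENNReal.ofReal_ne_top]
  rw [ENNReal.ofReal_mul (by positivity)]
  refine (mul_le_mul_right h3 _).trans (le_of_eq ?_)
  rw [← mul_assoc, ← ENNReal.ofReal_mul (by positivity)]
  congr 2
  rw [inv_pow]
  field_simp

end Exponential

/-! ### Averages at comparable scales, and sums along segments. -/

section Comparison

namespace ScaleControl

variable {X : Type*} [PseudoMetricSpace X] [MeasurableSpace X]
  {n : ℕ} {ν : Measure X} {a : X → ℝ → ℝ} {S : Set X} {R J : ℝ}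

/-- The averages at two scales whose ratio is at most `Λ`. -/
lemma abs_sub_le_of_le_mul (h : ScaleControl n ν a S R J) {x : X} (hx : x ∈ S) {s s' Λ : ℝ}
    (hs' : 0 < s') (hss' : s' ≤ s) (hR : s ≤ R) (hΛ : s ≤ Λ * s') :
    |a x s - a x s'| ≤ (⌈Λ⌉₊ + 1) * J := by
  have hs : 0 < s := hs'.trans_le hss'
  have hJ := h.one_le
  obtain ⟨k, hk1, hk2⟩ := exists_nat_pow_near (x := s / s') (y := 2)
    ((one_le_div hs').2 hss') one_lt_two
  have hk1' : s' ≤ s / 2 ^ k := by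
    rw [le_div_iff₀ (by positivity)] at hk1 ⊢
    linarith
  have hk2' : s / 2 ^ k / 2 ≤ s' := by
    rw [div_lt_iff₀ hs', pow_succ] at hk2
    rw [div_div, div_le_iff₀ (by positivity)]
    linarith
  have hkΛ : (k : ℝ) ≤ ⌈Λ⌉₊ := by
    have h1 : (2 : ℝ) ^ k ≤ Λ := by
      refine hk1.trans ?_
      rw [div_le_iff₀ hs']; exact hΛ
    have h2 : (k : ℝ) < 2 ^ k := by exact_mod_cast Nat.lt_two_pow_self
    exact (h2.le.trans h1).trans (Nat.le_ceil Λ)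
  have hsk : s / 2 ^ k ≤ s := div_le_self hs.le (one_le_pow₀ (by norm_num))
  have h1 := h.abs_sub_le_mul hx hs hR k
  have h2 := h.vertical_le hx (r := s / 2 ^ k) (by positivity) (hsk.trans hR) hk2' hk1'
  calc |a x s - a x s'| ≤ |a x s - a x (s / 2 ^ k)| + |a x (s / 2 ^ k) - a x s'| :=
        abs_sub_le _ _ _
    _ ≤ k * J + J := add_le_add h1 h2
    _ ≤ _ := by nlinarith

/-- The averages at the same scale and at two points whose distance is at most `Λ` times the
scale. -/
lemma abs_sub_le_of_dist_le_mul (h : ScaleControl n ν a S R J) {x z : X} (hx : x ∈ S) (hz : z ∈ S)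
    {s Λ : ℝ} (hs : 0 < s) (hΛ : 1 ≤ Λ) (hR : Λ * s ≤ R) (hd : dist x z ≤ Λ * s) :
    |a x s - a z s| ≤ (2 * ⌈Λ⌉₊ + 3) * J := by
  have hle : s ≤ Λ * s := le_mul_of_one_le_left hs.le hΛ
  -- Up to scale `Λ s` at `x`, across to `z` at that scale, and down again.
  have h1 := h.abs_sub_le_of_le_mul hx hs hle hR le_rfl
  have h2 := h.abs_sub_le_of_le_mul hz hs hle hR le_rfl
  have h3 := h.horizontal x hx z hz (Λ * s) (by positivity) hR hd
  rw [abs_sub_comm] at h1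
  calc |a x s - a z s| ≤ |a x s - a x (Λ * s)| + |a x (Λ * s) - a z s| := abs_sub_le _ _ _
    _ ≤ |a x s - a x (Λ * s)| + (|a x (Λ * s) - a z (Λ * s)| + |a z (Λ * s) - a z s|) := by
        gcongr; exact abs_sub_le _ _ _
    _ ≤ _ := by linarith

end ScaleControl

lemma card_le_of_forall_sub_le {s : Finset ℕ} {b : ℝ}
    (h : ∀ i ∈ s, ∀ j ∈ s, (i : ℝ) - j ≤ b) (hb : 0 ≤ b) : (s.card : ℝ) ≤ b + 1 := by
  rcases s.eq_empty_or_nonempty with rfl | hne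
  · simp; linarith
  set m := s.min' hne
  set M := s.max' hne
  have hsub : s ⊆ Finset.Icc m M := fun i hi ↦
    Finset.mem_Icc.2 ⟨s.min'_le i hi, s.le_max' i hi⟩
  have h1 := Finset.card_le_card hsub
  rw [Nat.card_Icc] at h1
  have h2 := h M (s.max'_mem hne) m (s.min'_mem hne)
  have h3 : m ≤ M := s.min'_le _ (s.max'_mem hne)
  have h4 : (s.card : ℝ) ≤ ((M + 1 - m : ℕ) : ℝ) := by exact_mod_cast h1
  rw [Nat.cast_sub (by omega)] at h4
  push_cast at h4
  linarith

/-- The constant in the estimate of exponential sums along segments. -/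
def segmentConst (n : ℕ) (J : ℝ) : ℝ :=
  Real.exp (1 * (J + 3 * J / (Real.log (3 / 2) / 1) ^ (n - 1) + ScaleControl.geomBound n)) *
    (7 * J * 7)

/-- Riemann sums of the exponential of the averages along a segment are bounded. -/
lemma ScaleControl.sum_segment_exp_le {X : Type*} [NormedAddCommGroup X] [NormedSpace ℝ X]
    [TopologicalSpace.SeparableSpace X] [MeasurableSpace X] [BorelSpace X]
    {n : ℕ} {ν : Measure X} {a : X → ℝ → ℝ} {S : Set X} {R J : ℝ}
    (h : ScaleControl n ν a S R J) {y v : X} (hv : v ≠ 0) (hR : ‖v‖ ≤ R)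
    (hS : closedBall y ‖v‖ ⊆ S) (m : ℕ) :
    ∑ i ∈ Finset.range (2 ^ m), ‖v‖ / 2 ^ m *
      Real.exp (a (y + ((i : ℝ) / 2 ^ m) • v) (‖v‖ / 2 ^ m)) ≤
      segmentConst n J * ‖v‖ * Real.exp (a y ‖v‖) := by
  classical
  have hv0 : 0 < ‖v‖ := norm_pos_iff.2 hv
  have hJ := h.one_le
  set ε : ℝ := ‖v‖ / 2 ^ m with hε
  have hε0 : 0 < ε := by positivity
  set z : ℕ → X := fun i ↦ y + ((i : ℝ) / 2 ^ m) • v with hz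
  have hzd : ∀ i j, dist (z i) (z j) = |(i : ℝ) - j| * ε := by
    intro i j
    rw [hz, dist_eq_norm, add_sub_add_left_eq_sub, ← sub_smul, norm_smul, ← sub_div,
      norm_div, Real.norm_eq_abs, Real.norm_of_nonneg (by positivity : (0 : ℝ) ≤ 2 ^ m), hε]
    ring
  -- Masses `ε` at points spaced by `ε`. A ball of radius `3t` contains at most `6t/ε + 1` of them,
  -- so for `t ≥ ε` its mass is at most `6t + ε ≤ 7t`.
  set κ : Measure X := ∑ i ∈ Finset.range (2 ^ m), ENNReal.ofReal ε • Measure.dirac (z i) with hκ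
  have hκapp : ∀ A : Set X, MeasurableSet A → κ A =
      ∑ i ∈ Finset.range (2 ^ m), ENNReal.ofReal ε * A.indicator 1 (z i) := by
    intro A hA
    rw [hκ, Measure.finsetSum_apply]
    refine Finset.sum_congr rfl fun i _ ↦ ?_
    rw [Measure.smul_apply, smul_eq_mul, Measure.dirac_apply' _ hA]
  have hball : ∀ w : X, ∀ t, ε ≤ t → κ (closedBall w (3 * t)) ≤ ENNReal.ofReal (7 * t) := by
    intro w t ht
    have ht0 : 0 < t := hε0.trans_le ht
    rw [hκapp _ measurableSet_closedBall, ← Finset.mul_sum]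
    set s := (Finset.range (2 ^ m)).filter (fun i ↦ z i ∈ closedBall w (3 * t)) with hs
    have hsum : ∑ i ∈ Finset.range (2 ^ m), (closedBall w (3 * t)).indicator (1 : X → ℝ≥0∞) (z i) =
        (s.card : ℝ≥0∞) := by
      rw [hs, Finset.card_filter]
      push_cast
      refine Finset.sum_congr rfl fun i _ ↦ ?_
      by_cases hi : z i ∈ closedBall w (3 * t)
      · rw [indicator_of_mem hi, if_pos hi]; rfl
      · rw [indicator_of_notMem hi, if_neg hi]
    have hcard : (s.card : ℝ) ≤ 6 * t / ε + 1 := by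
      refine card_le_of_forall_sub_le (fun i hi j hj ↦ ?_) (by positivity)
      have hi' := (Finset.mem_filter.1 hi).2
      have hj' := (Finset.mem_filter.1 hj).2
      rw [mem_closedBall] at hi' hj'
      have := dist_triangle_right (z i) (z j) w
      rw [hzd] at this
      rw [le_div_iff₀ hε0]
      nlinarith [le_abs_self ((i : ℝ) - j)]
    rw [hsum, ← ENNReal.ofReal_natCast, ← ENNReal.ofReal_mul hε0.le]
    apply ENNReal.ofReal_le_ofReal
    calc ε * s.card ≤ ε * (6 * t / ε + 1) := by gcongr
      _ = 6 * t + ε := by field_simp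
      _ ≤ 7 * t := by linarith
  have hzmem : ∀ i ∈ Finset.range (2 ^ m), z i ∈ closedBall y ‖v‖ := by
    intro i hi
    have h0 : z 0 = y := by simp [hz]
    rw [mem_closedBall, ← h0, hzd]
    have hi' : (i : ℝ) ≤ 2 ^ m := by exact_mod_cast (Finset.mem_range.1 hi).le
    rw [Nat.cast_zero, sub_zero, abs_of_nonneg (by positivity), hε]
    calc (i : ℝ) * (‖v‖ / 2 ^ m) ≤ 2 ^ m * (‖v‖ / 2 ^ m) := by gcongr
      _ = ‖v‖ := by field_simp
  have hεv : ε ≤ ‖v‖ := div_le_self hv0.le (one_le_pow₀ (by norm_num))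
  have key := h.lintegral_exp_le (q := 1) (D := 7) one_pos (by norm_num) hv0 hR hS m κ
    ((measure_mono (closedBall_subset_closedBall (by linarith))).trans (hball y ‖v‖ hεv))
    (fun w _ t ht _ ↦ hball w t ht)
  rw [← ENNReal.ofReal_le_ofReal_iff (by unfold segmentConst; positivity),
    ENNReal.ofReal_sum_of_nonneg fun i _ ↦ by positivity]
  calc ∑ i ∈ Finset.range (2 ^ m), ENNReal.ofReal (ε * Real.exp (a (z i) ε))
      ≤ ∫⁻ w in closedBall y ‖v‖, ENNReal.ofReal (Real.exp (1 * a w ε)) ∂κ := by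
        rw [hκ, ← Measure.restrictₗ_apply, map_sum, lintegral_finsetSum_measure]
        refine Finset.sum_le_sum fun i hi ↦ ?_
        rw [Measure.restrictₗ_apply, Measure.restrict_smul, lintegral_smul_measure,
          restrict_dirac, if_pos (hzmem i hi), lintegral_dirac, one_mul,
          ENNReal.ofReal_mul hε0.le, smul_eq_mul]
    _ ≤ _ := key.trans (le_of_eq (by rw [segmentConst, one_mul (a y ‖v‖)]))

end Comparison

/-! ### Weights in a bilipschitz chart: measure of balls and doubling. -/

section Model

variable {n : ℕ} {M : Type*} [EMetricSpace M]

/-- The map `Ψ` is bilipschitz, with constant `L`, on the ball of radius `R` around `c`, and its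
image contains the ball of radius `r` around `Ψ c`. -/
structure BilipschitzChart (Ψ : EuclideanSpace ℝ (Fin n) → M) (c : EuclideanSpace ℝ (Fin n))
    (R L r : ℝ) : Prop where
  one_le : 1 ≤ L
  pos : 0 < r
  mul_le : L * r ≤ R / 16
  edist_le : ∀ y ∈ closedBall c R, ∀ y' ∈ closedBall c R,
    edist (Ψ y) (Ψ y') ≤ ENNReal.ofReal L * edist y y'
  le_edist : ∀ y ∈ closedBall c R, ∀ y' ∈ closedBall c R,
    edist y y' ≤ ENNReal.ofReal L * edist (Ψ y) (Ψ y')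
  surj : ∀ z, edist (Ψ c) z < ENNReal.ofReal r → ∃ y ∈ closedBall c R, Ψ y = z

variable {Ψ : EuclideanSpace ℝ (Fin n) → M} {c : EuclideanSpace ℝ (Fin n)} {R L r : ℝ}

lemma BilipschitzChart.radius_pos (h : BilipschitzChart Ψ c R L r) : 0 < R := by
  have := mul_pos (lt_of_lt_of_le one_pos h.one_le) h.pos
  linarith [h.mul_le]

lemma BilipschitzChart.le_radius (h : BilipschitzChart Ψ c R L r) : r ≤ R / 16 :=
  (le_mul_of_one_le_left h.pos.le h.one_le).trans h.mul_le

lemma BilipschitzChart.edist_le_ofReal (h : BilipschitzChart Ψ c R L r)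
    {y y' : EuclideanSpace ℝ (Fin n)} (hy : y ∈ closedBall c R) (hy' : y' ∈ closedBall c R) :
    edist (Ψ y) (Ψ y') ≤ ENNReal.ofReal (L * dist y y') := by
  rw [ENNReal.ofReal_mul (by linarith [h.one_le]), ← edist_dist]
  exact h.edist_le y hy y' hy'

lemma BilipschitzChart.dist_le_of_edist_le (h : BilipschitzChart Ψ c R L r)
    {y y' : EuclideanSpace ℝ (Fin n)} (hy : y ∈ closedBall c R) (hy' : y' ∈ closedBall c R) {t : ℝ}
    (ht : 0 ≤ t) (hd : edist (Ψ y) (Ψ y') ≤ ENNReal.ofReal t) : dist y y' ≤ L * t := by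
  have hL : 0 ≤ L := by linarith [h.one_le]
  have := (h.le_edist y hy y' hy').trans (mul_le_mul_right hd _)
  rw [← ENNReal.ofReal_mul hL, edist_dist] at this
  exact (ENNReal.ofReal_le_ofReal_iff (by positivity)).1 this

/-- The margin between `R / 16` and `R` leaves room for the balls and segments drawn around such
points later. -/
lemma BilipschitzChart.exists_coord (h : BilipschitzChart Ψ c R L r) {z : M}
    (hz : edist (Ψ c) z < ENNReal.ofReal r) : ∃ y ∈ closedBall c (R / 16), Ψ y = z := by
  obtain ⟨y, hy, rfl⟩ := h.surj z hz
  refine ⟨y, ?_, rfl⟩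
  have hc : c ∈ closedBall c R := mem_closedBall_self h.radius_pos.le
  rw [mem_closedBall, dist_comm]
  exact (h.dist_le_of_edist_le hc hy h.pos.le hz.le).trans h.mul_le

variable [MeasurableSpace M]

/-- In the chart `Ψ`, the measure `μ` has a density comparable with `exp (n F)`, and the averages
of `F` are controlled. -/
structure WeightModel (Ψ : EuclideanSpace ℝ (Fin n) → M) (c : EuclideanSpace ℝ (Fin n))
    (R L : ℝ) (φ : EuclideanSpace ℝ (Fin n) → ℝ) (J : ℝ) (μ : Measure M)
    (F : EuclideanSpace ℝ (Fin n) → ℝ) (ν : Measure (EuclideanSpace ℝ (Fin n))) : Prop where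
  scaleControl : ScaleControl n ν (scaleAverage φ F) (closedBall c (R / 4)) (R / 8) J
  integrableOn : IntegrableOn F (closedBall c (R / 2))
  measure_le : ∀ (A : Set (EuclideanSpace ℝ (Fin n))) (s : Set M), MeasurableSet A →
    A ⊆ closedBall c (R / 2) → s ⊆ Ψ '' A →
      μ s ≤ ENNReal.ofReal L * ∫⁻ y in A, ENNReal.ofReal (Real.exp (n * F y))
  le_measure : ∀ (A : Set (EuclideanSpace ℝ (Fin n))) (s : Set M), MeasurableSet A →
    A ⊆ closedBall c (R / 2) → Ψ '' A ⊆ s →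
      ∫⁻ y in A, ENNReal.ofReal (Real.exp (n * F y)) ≤ ENNReal.ofReal L * μ s

variable {φ : EuclideanSpace ℝ (Fin n) → ℝ} {B : ℝ}

/-- The measure of small balls is comparable with `(ρ exp (a y ρ)) ^ n`. -/
lemma BilipschitzChart.exists_measure_ball_const (h : BilipschitzChart Ψ c R L r)
    (hφ : IsAnnularKernel φ B) (J : ℝ) :
    ∃ K : ℝ, 1 ≤ K ∧ ∀ μ F ν, WeightModel Ψ c R L φ J μ F ν → ∀ y ∈ closedBall c (R / 8),
      edist (Ψ c) (Ψ y) ≤ ENNReal.ofReal (r / 2) → ∀ ρ, 0 < ρ → ρ ≤ r / 2 →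
      μ (eball (Ψ y) (ENNReal.ofReal ρ)) ≤
        ENNReal.ofReal (K * (ρ * Real.exp (scaleAverage φ F y ρ))) ^ n ∧
      ENNReal.ofReal (ρ * Real.exp (scaleAverage φ F y ρ)) ^ n ≤
        ENNReal.ofReal K ^ n * μ (eball (Ψ y) (ENNReal.ofReal ρ)) := by
  have hL := h.one_le
  have hL0 : 0 < L := by linarith
  have hB : 0 ≤ B := (hφ.nonneg 0).trans (hφ.le 0)
  set K₁ : ℝ := L * (expConst n J * L ^ n * Real.exp (n * ((⌈L⌉₊ + 1) * J))) with hK₁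
  set K₂ : ℝ := (2 * L) ^ n * Real.exp (n * ((⌈2 * L⌉₊ + 1) * J)) * (B * L) with hK₂
  refine ⟨max 1 (max K₁ K₂), le_max_left _ _, ?_⟩
  intro μ F ν hw y hy hpy ρ hρ hρr
  have hsc := hw.scaleControl
  have hn := hsc.one_le_dim
  have hR := h.radius_pos
  set K := max 1 (max K₁ K₂) with hK
  have hK1 : 1 ≤ K := le_max_left _ _
  have hKn : K ≤ K ^ n := le_self_pow₀ hK1 (by omega)
  set a := scaleAverage φ F with ha
  have hLρ : L * ρ ≤ R / 32 := by nlinarith [h.mul_le]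
  have hρR : ρ ≤ R / 32 := (le_mul_of_one_le_left hρ.le hL).trans hLρ
  rw [mem_closedBall] at hy
  have hyS : y ∈ closedBall c (R / 4) := mem_closedBall.2 (by linarith)
  have hyR : y ∈ closedBall c R := mem_closedBall.2 (by linarith)
  have hsub : ∀ t ≤ R / 8, closedBall y t ⊆ closedBall c (R / 4) := fun t ht z hz ↦ by
    rw [mem_closedBall] at hz ⊢
    linarith [dist_triangle z y c]
  have hsub2 : closedBall c (R / 4) ⊆ closedBall c (R / 2) :=
    closedBall_subset_closedBall (by linarith)
  constructor
  · have himg : eball (Ψ y) (ENNReal.ofReal ρ) ⊆ Ψ '' closedBall y (L * ρ) := by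
      intro z hz
      rw [mem_eball] at hz
      have hpz : edist (Ψ c) z < ENNReal.ofReal r := by
        calc edist (Ψ c) z ≤ edist (Ψ c) (Ψ y) + edist (Ψ y) z := edist_triangle _ _ _
          _ < ENNReal.ofReal (r / 2) + ENNReal.ofReal (r / 2) := by
              refine ENNReal.add_lt_add_of_le_of_lt (ne_top_of_le_ne_top ENNReal.ofReal_ne_top hpy)
                hpy ?_
              rw [edist_comm]
              exact hz.trans_le (ENNReal.ofReal_le_ofReal hρr)
          _ = ENNReal.ofReal r := by
              rw [← ENNReal.ofReal_add (by linarith [h.pos]) (by linarith [h.pos])]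
              congr 1; ring
      obtain ⟨w, hw', rfl⟩ := h.surj z hpz
      exact ⟨w, mem_closedBall.2 (h.dist_le_of_edist_le hw' hyR hρ.le hz.le), rfl⟩
    have h1 := hw.measure_le _ _ measurableSet_closedBall
      ((hsub _ (by linarith)).trans hsub2) himg
    have h2 := hsc.lintegral_closedBall_exp_le hφ (x := y) (r := L * ρ) (by positivity)
      (by linarith) (hsub _ (by linarith))
      (hw.integrableOn.mono_set ((hsub _ (by linarith)).trans hsub2))
    have h3 := hsc.abs_sub_le_of_le_mul hyS hρ (le_mul_of_one_le_left hρ.le hL) (by linarith)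
      (le_refl (L * ρ))
    have hexpC : 0 ≤ expConst n J := by
      have := unitVolume_pos n
      have := hsc.one_le
      unfold expConst
      positivity
    refine h1.trans ((mul_le_mul_right h2 _).trans ?_)
    rw [← ENNReal.ofReal_mul hL0.le, ← ENNReal.ofReal_pow (by positivity)]
    apply ENNReal.ofReal_le_ofReal
    calc L * (expConst n J * (L * ρ) ^ n * Real.exp (n * a y (L * ρ)))
        ≤ L * (expConst n J * (L * ρ) ^ n *
          (Real.exp (n * ((⌈L⌉₊ + 1) * J)) * Real.exp (n * a y ρ))) := by
          gcongr
          rw [← Real.exp_add, ← mul_add]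
          apply Real.exp_le_exp.2
          gcongr
          linarith [le_abs_self (a y (L * ρ) - a y ρ)]
      _ = K₁ * (ρ * Real.exp (a y ρ)) ^ n := by
          rw [hK₁, mul_pow L, mul_pow ρ, Real.exp_nat_mul (a y ρ) n]; ring
      _ ≤ K ^ n * (ρ * Real.exp (a y ρ)) ^ n := by
          gcongr
          exact ((le_max_left _ _).trans (le_max_right _ _)).trans hKn
      _ = _ := (mul_pow _ _ _).symm
  · set s := ρ / (2 * L) with hs
    have hs0 : 0 < s := by positivity
    have hsρ : s ≤ ρ := div_le_self hρ.le (by linarith)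
    have hρs : ρ = 2 * L * s := by rw [hs]; field_simp
    have himg : Ψ '' closedBall y s ⊆ eball (Ψ y) (ENNReal.ofReal ρ) := by
      rintro _ ⟨w, hw', rfl⟩
      have hwR : w ∈ closedBall c R := by
        rw [mem_closedBall] at hw' ⊢
        linarith [dist_triangle w y c]
      refine (h.edist_le_ofReal hwR hyR).trans_lt ?_
      rw [ENNReal.ofReal_lt_ofReal_iff hρ]
      calc L * dist w y ≤ L * s := by gcongr; exact hw'
        _ < 2 * L * s := by nlinarith [mul_pos hL0 hs0]
        _ = ρ := hρs.symm
    have h1 := hw.le_measure _ _ measurableSet_closedBall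
      ((hsub _ (by linarith)).trans hsub2) himg
    have h2 := hφ.exp_scaleAverage_le (x := y) hs0
      (hw.integrableOn.mono_set ((hsub _ (by linarith)).trans hsub2))
    have h3 := hsc.abs_sub_le_of_le_mul hyS hs0 hsρ (by linarith) hρs.le
    rw [← ENNReal.ofReal_pow (by positivity)]
    calc ENNReal.ofReal ((ρ * Real.exp (a y ρ)) ^ n)
        ≤ ENNReal.ofReal ((2 * L) ^ n * Real.exp (n * ((⌈2 * L⌉₊ + 1) * J)) *
          (s ^ n * Real.exp (n * a y s))) := by
          apply ENNReal.ofReal_le_ofReal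
          rw [mul_pow, ← Real.exp_nat_mul]
          calc ρ ^ n * Real.exp (n * a y ρ) ≤ ρ ^ n *
                (Real.exp (n * ((⌈2 * L⌉₊ + 1) * J)) * Real.exp (n * a y s)) := by
                gcongr
                rw [← Real.exp_add, ← mul_add]
                apply Real.exp_le_exp.2
                gcongr
                linarith [le_abs_self (a y ρ - a y s)]
            _ = _ := by rw [hρs, mul_pow]; ring
      _ ≤ ENNReal.ofReal ((2 * L) ^ n * Real.exp (n * ((⌈2 * L⌉₊ + 1) * J))) *
          (ENNReal.ofReal B * (ENNReal.ofReal L * μ (eball (Ψ y) (ENNReal.ofReal ρ)))) := by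
          rw [ENNReal.ofReal_mul (by positivity)]
          gcongr
          exact h2.trans (by gcongr)
      _ = ENNReal.ofReal K₂ * μ (eball (Ψ y) (ENNReal.ofReal ρ)) := by
          rw [hK₂, ENNReal.ofReal_mul (q := B * L) (by positivity), ENNReal.ofReal_mul hB]
          ring
      _ ≤ _ := by
          gcongr
          rw [← ENNReal.ofReal_pow (by linarith)]
          exact ENNReal.ofReal_le_ofReal
            (((le_max_right _ _).trans (le_max_right _ _)).trans hKn)

/-- The doubling property. -/
lemma BilipschitzChart.exists_doubling_const (h : BilipschitzChart Ψ c R L r)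
    (hφ : IsAnnularKernel φ B) (J : ℝ) :
    ∃ K : ℝ, 1 ≤ K ∧ ∀ μ F ν, WeightModel Ψ c R L φ J μ F ν → ∀ x,
      edist (Ψ c) x ≤ ENNReal.ofReal (r / 2) → ∀ ρ, 0 < ρ → ρ ≤ r / 4 →
      μ (eball x (ENNReal.ofReal (2 * ρ))) ≤
        ENNReal.ofReal K ^ n * μ (eball x (ENNReal.ofReal ρ)) ∧
      μ (eball x (ENNReal.ofReal ρ)) < ⊤ := by
  obtain ⟨K, hK1, hK⟩ := h.exists_measure_ball_const hφ J
  have hL := h.one_le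
  have hK0 : 0 < K := by linarith
  refine ⟨max 1 (K * (2 * Real.exp ((⌈(2 : ℝ)⌉₊ + 1) * J)) * K), le_max_left _ _, ?_⟩
  intro μ F ν hw x hx ρ hρ hρr
  have hsc := hw.scaleControl
  have hR := h.radius_pos
  have hrR := h.le_radius
  have hr := h.pos
  obtain ⟨y, hy, rfl⟩ := h.exists_coord (hx.trans_lt
    ((ENNReal.ofReal_lt_ofReal_iff h.pos).2 (by linarith [h.pos])))
  have hy8 : y ∈ closedBall c (R / 8) := closedBall_subset_closedBall (by linarith) hy
  have h1 := (hK μ F ν hw y hy8 hx (2 * ρ) (by positivity) (by linarith)).1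
  have h2 := hK μ F ν hw y hy8 hx ρ hρ (by linarith)
  refine ⟨?_, h2.1.trans_lt (ENNReal.pow_lt_top ENNReal.ofReal_lt_top)⟩
  have h3 := hsc.abs_sub_le_of_le_mul (closedBall_subset_closedBall (by linarith) hy)
    (s := 2 * ρ) hρ (by linarith) (by linarith) le_rfl
  set a := scaleAverage φ F
  calc μ (eball (Ψ y) (ENNReal.ofReal (2 * ρ)))
      ≤ ENNReal.ofReal (K * (2 * ρ * Real.exp (a y (2 * ρ)))) ^ n := h1
    _ ≤ ENNReal.ofReal (K * (2 * Real.exp ((⌈(2 : ℝ)⌉₊ + 1) * J)) *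
        (ρ * Real.exp (a y ρ))) ^ n := by
        refine pow_le_pow_left₀ zero_le (ENNReal.ofReal_le_ofReal ?_) n
        have : Real.exp (a y (2 * ρ)) ≤ Real.exp ((⌈(2 : ℝ)⌉₊ + 1) * J) * Real.exp (a y ρ) := by
          rw [← Real.exp_add]
          apply Real.exp_le_exp.2
          linarith [le_abs_self (a y (2 * ρ) - a y ρ)]
        calc _ ≤ K * (2 * ρ * (Real.exp ((⌈(2 : ℝ)⌉₊ + 1) * J) * Real.exp (a y ρ))) := by gcongr
          _ = _ := by ring
    _ = ENNReal.ofReal (K * (2 * Real.exp ((⌈(2 : ℝ)⌉₊ + 1) * J))) ^ n *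
        ENNReal.ofReal (ρ * Real.exp (a y ρ)) ^ n := by
        rw [ENNReal.ofReal_mul (by positivity), mul_pow]
    _ ≤ ENNReal.ofReal (K * (2 * Real.exp ((⌈(2 : ℝ)⌉₊ + 1) * J))) ^ n *
        (ENNReal.ofReal K ^ n * μ (eball (Ψ y) (ENNReal.ofReal ρ))) := by
        gcongr
        exact h2.2
    _ = ENNReal.ofReal (K * (2 * Real.exp ((⌈(2 : ℝ)⌉₊ + 1) * J)) * K) ^ n *
        μ (eball (Ψ y) (ENNReal.ofReal ρ)) := by
        rw [ENNReal.ofReal_mul (q := K) (by positivity), mul_pow, ← mul_assoc]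
    _ ≤ _ := by
        gcongr
        exact le_max_right _ _

end Model

/-! ### The gauge `δ_f` and the upper bound of the distance. -/

section LocalGauge

variable {n : ℕ} {M : Type*} [EMetricSpace M] [ChartedSpace (EuclideanSpace ℝ (Fin n)) M]
  [RiemannianBundle (fun x : M ↦ TangentSpace (𝓡 n) x)] [MeasurableSpace M]

/-- The factor by which the definition of the gauge normalizes the root of the volume. -/
def gaugeFactor (n : ℕ) : ℝ :=
  2 * ((volume (ball (0 : EuclideanSpace ℝ (Fin n)) 1))⁻¹ ^ (1 / (n : ℝ))).toReal

lemma ofReal_gaugeFactor (n : ℕ) : ENNReal.ofReal (gaugeFactor n) =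
    2 * (volume (ball (0 : EuclideanSpace ℝ (Fin n)) 1))⁻¹ ^ (1 / (n : ℝ)) := by
  rw [gaugeFactor, ENNReal.ofReal_mul (by norm_num), ENNReal.ofReal_toReal, ENNReal.ofReal_ofNat]
  exact ENNReal.rpow_ne_top_of_nonneg (by positivity)
    (ENNReal.inv_ne_top.2 (measure_ball_pos _ _ one_pos).ne')

lemma gaugeFactor_pos (n : ℕ) : 0 < gaugeFactor n := by
  rw [← ENNReal.ofReal_pos, ofReal_gaugeFactor]
  refine ENNReal.mul_pos (by norm_num) (ENNReal.rpow_pos ?_ ?_).ne'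
  · exact ENNReal.inv_pos.2 measure_ball_lt_top.ne
  · exact ENNReal.inv_ne_top.2 (measure_ball_pos _ _ one_pos).ne'

lemma gauge_eq (n : ℕ) (m : ℝ≥0∞) :
    2 * (m / volume (ball (0 : EuclideanSpace ℝ (Fin n)) 1)) ^ (1 / (n : ℝ)) =
      ENNReal.ofReal (gaugeFactor n) * m ^ (1 / (n : ℝ)) := by
  rw [ofReal_gaugeFactor, div_eq_mul_inv, ENNReal.mul_rpow_of_nonneg _ _ (by positivity)]
  ring

lemma rpow_inv_le_of_le_pow (hn : 1 ≤ n) {m b : ℝ≥0∞} (h : m ≤ b ^ n) : m ^ (1 / (n : ℝ)) ≤ b := by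
  have := ENNReal.rpow_le_rpow h (by positivity : 0 ≤ 1 / (n : ℝ))
  rwa [one_div, ENNReal.pow_rpow_inv_natCast (by omega), ← one_div] at this

lemma le_rpow_inv_of_pow_le (hn : 1 ≤ n) {m b : ℝ≥0∞} (h : b ^ n ≤ m) : b ≤ m ^ (1 / (n : ℝ)) := by
  have := ENNReal.rpow_le_rpow h (by positivity : 0 ≤ 1 / (n : ℝ))
  rwa [one_div, ENNReal.pow_rpow_inv_natCast (by omega), ← one_div] at this

lemma ofReal_div_pow_le {x K : ℝ} {m : ℝ≥0∞} (hK : 0 < K)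
    (h : ENNReal.ofReal x ^ n ≤ ENNReal.ofReal K ^ n * m) : ENNReal.ofReal (x / K) ^ n ≤ m := by
  rw [ENNReal.ofReal_div_of_pos hK, div_eq_mul_inv, mul_pow, ← ENNReal.inv_pow, ← div_eq_mul_inv]
  exact ENNReal.div_le_of_le_mul' h

variable {Ψ : EuclideanSpace ℝ (Fin n) → M} {c : EuclideanSpace ℝ (Fin n)} {R L r : ℝ}
  {φ : EuclideanSpace ℝ (Fin n) → ℝ} {B : ℝ}

/-- Two points at finite distance have a midpoint. -/
def HasMidpoints (M : Type*) [EMetricSpace M] : Prop :=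
  ∀ x y : M, edist x y ≠ ⊤ → ∃ m, edist m x = edist x y / 2 ∧ edist m y = edist x y / 2

/-- The midpoint ball is contained in the ball of radius `edist x y` around `x`. Midpoints must
exist, since an infimum over no midpoint would be infinite. -/
lemma ballGauge_le_of_measure_le (hn : 1 ≤ n) (hmid : HasMidpoints M) {f : M → ℝ} {x y : M}
    {t : ℝ≥0∞} (ht : t ≠ ⊤) (hd : edist x y ≤ t) {b : ℝ≥0∞}
    (hb : conformalVolume n f (eball x t) ≤ b ^ n) :
    ballGauge n f x y ≤ ENNReal.ofReal (gaugeFactor n) * b := by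
  obtain ⟨m, hm⟩ := hmid x y (ne_top_of_le_ne_top ht hd)
  refine (iInf₂_le m hm).trans ?_
  rw [gauge_eq]
  gcongr
  refine rpow_inv_le_of_le_pow hn ((measure_mono fun z hz ↦ ?_).trans hb)
  rw [mem_eball] at hz ⊢
  have hx : edist m x ≠ ⊤ := by
    rw [hm.1]
    exact (ENNReal.div_lt_top (ne_top_of_le_ne_top ht hd) (by norm_num)).ne
  calc edist z x ≤ edist z m + edist m x := edist_triangle _ _ _
    _ < edist x y / 2 + edist x y / 2 := ENNReal.add_lt_add_of_lt_of_le hx hz hm.1.le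
    _ = edist x y := ENNReal.add_halves _
    _ ≤ t := hd

/-- The lower bound of the gauge in terms of the averages. -/
lemma BilipschitzChart.exists_le_ballGauge (h : BilipschitzChart Ψ c R L r)
    (hφ : IsAnnularKernel φ B) (J : ℝ) :
    ∃ k : ℝ, 0 < k ∧ ∀ (f : M → ℝ) F ν, WeightModel Ψ c R L φ J (conformalVolume n f) F ν →
      ∀ z ∈ closedBall c (R / 8), edist (Ψ c) (Ψ z) ≤ ENNReal.ofReal (3 * r / 8) →
      ∀ x t, 0 < t → t ≤ r / 8 → edist (Ψ z) x = ENNReal.ofReal (2 * t) →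
      ENNReal.ofReal (k * (t * Real.exp (scaleAverage φ F z t))) ≤ ballGauge n f (Ψ z) x := by
  obtain ⟨K, hK1, hK⟩ := h.exists_measure_ball_const hφ J
  have hL := h.one_le
  have hg := gaugeFactor_pos n
  set C : ℝ := Real.exp ((2 * ⌈L⌉₊ + 3) * J) with hC
  have hC0 : 0 < C := Real.exp_pos _
  have hK0 : 0 < K := by linarith
  refine ⟨gaugeFactor n / (K * C), by positivity, ?_⟩
  intro f F ν hw z hz hpz x t ht htr hzx
  have hsc := hw.scaleControl
  have hn := hsc.one_le_dim
  have hR := h.radius_pos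
  -- The bound is proved for every midpoint. Its coordinates are within `L t` of `z`, so the
  -- averages at scale `t` differ by a bounded amount.
  refine le_iInf₂ fun m hm ↦ ?_
  have hhalf : edist (Ψ z) x / 2 = ENNReal.ofReal t := by
    rw [hzx, ENNReal.ofReal_mul (by norm_num), ENNReal.ofReal_ofNat, mul_comm,
      ENNReal.mul_div_cancel_right (by norm_num) (by norm_num)]
  rw [hhalf] at hm ⊢
  have hpm : edist (Ψ c) m ≤ ENNReal.ofReal (r / 2) := by
    calc edist (Ψ c) m ≤ edist (Ψ c) (Ψ z) + edist (Ψ z) m := edist_triangle _ _ _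
      _ ≤ ENNReal.ofReal (3 * r / 8) + ENNReal.ofReal (r / 8) := by
          rw [edist_comm (Ψ z), hm.1]
          gcongr
      _ = _ := by
          rw [← ENNReal.ofReal_add (by linarith [h.pos]) (by linarith [h.pos])]
          congr 1; ring
  obtain ⟨w, hwR, rfl⟩ := h.exists_coord (hpm.trans_lt
    ((ENNReal.ofReal_lt_ofReal_iff h.pos).2 (by linarith [h.pos])))
  have hLt : L * t ≤ R / 128 := by nlinarith [h.mul_le]
  have hwR' : w ∈ closedBall c R := closedBall_subset_closedBall (by linarith) hwR
  have hzR' : z ∈ closedBall c R := closedBall_subset_closedBall (by linarith) hz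
  have hd : dist z w ≤ L * t :=
    h.dist_le_of_edist_le hzR' hwR' ht.le (by rw [edist_comm, hm.1])
  have h1 := hsc.abs_sub_le_of_dist_le_mul
    (closedBall_subset_closedBall (by linarith) hz)
    (closedBall_subset_closedBall (by linarith) hwR) ht hL (by linarith) hd
  have h2 := (hK _ F ν hw w (closedBall_subset_closedBall (by linarith) hwR) hpm t ht
    (by linarith)).2
  rw [gauge_eq]
  have h3 := le_rpow_inv_of_pow_le hn (ofReal_div_pow_le hK0 h2)
  calc ENNReal.ofReal (gaugeFactor n / (K * C) * (t * Real.exp (scaleAverage φ F z t)))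
      ≤ ENNReal.ofReal (gaugeFactor n * (t * Real.exp (scaleAverage φ F w t) / K)) := by
        apply ENNReal.ofReal_le_ofReal
        have h4 : Real.exp (scaleAverage φ F z t) ≤ C * Real.exp (scaleAverage φ F w t) := by
          rw [hC, ← Real.exp_add]
          apply Real.exp_le_exp.2
          linarith [le_abs_self (scaleAverage φ F z t - scaleAverage φ F w t)]
        calc _ ≤ gaugeFactor n / (K * C) * (t * (C * Real.exp (scaleAverage φ F w t))) := by gcongr
          _ = _ := by field_simp
    _ ≤ _ := by
        rw [ENNReal.ofReal_mul hg.le]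
        gcongr

lemma weightEDist_self (f : M → ℝ) (x : M) : weightEDist n f x x = 0 := by
  refine le_antisymm (iSup₂_le fun ε _ ↦ ?_) zero_le
  refine iInf_le_of_le 0 (iInf_le_of_le (fun _ ↦ x) (iInf_le_of_le ⟨rfl, rfl, by simp⟩ ?_))
  simp

/-- The upper bound of the distance by the measure. -/
lemma BilipschitzChart.exists_weightEDist_le (h : BilipschitzChart Ψ c R L r)
    (hφ : IsAnnularKernel φ B) (hmid : HasMidpoints M) (J : ℝ) :
    ∃ K : ℝ, 1 ≤ K ∧ ∀ (f : M → ℝ) F ν, WeightModel Ψ c R L φ J (conformalVolume n f) F ν →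
      ∀ x, edist (Ψ c) x ≤ ENNReal.ofReal (r / 4) →
      ∀ x', edist x x' ≤ ENNReal.ofReal (r / (16 * L ^ 2)) →
      weightEDist n f x x' ^ n ≤
        ENNReal.ofReal K ^ n * conformalVolume n f (eball x (edist x x')) := by
  obtain ⟨K, hK1, hK⟩ := h.exists_measure_ball_const hφ J
  have hL := h.one_le
  have hL0 : 0 < L := by linarith
  have hK0 : 0 < K := by linarith
  have hg := gaugeFactor_pos n
  set C₁ : ℝ := gaugeFactor n * (K * (L * Real.exp ((⌈L⌉₊ + 1) * J))) with hC₁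
  set C₂ : ℝ := L * Real.exp (2 * ((⌈L ^ 2⌉₊ + 1) * J)) with hC₂
  have hC₁0 : 0 < C₁ := by positivity
  refine ⟨max 1 (C₁ * (segmentConst n J * C₂) * K), le_max_left _ _, ?_⟩
  intro f F ν hw x hx x' hxx'
  have hsc := hw.scaleControl
  have hn := hsc.one_le_dim
  have hJ := hsc.one_le
  have hR := h.radius_pos
  have hrR := h.mul_le
  have hr := h.pos
  have hseg : 0 ≤ segmentConst n J := by unfold segmentConst; positivity
  by_cases hne : x = x'
  · rw [← hne, weightEDist_self, zero_pow (by omega)]; exact zero_le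
  set d : ℝ := (edist x x').toReal with hd
  have hdtop : edist x x' ≠ ⊤ := ne_top_of_le_ne_top ENNReal.ofReal_ne_top hxx'
  have hed : edist x x' = ENNReal.ofReal d := (ENNReal.ofReal_toReal hdtop).symm
  have hd0 : 0 < d := ENNReal.toReal_pos (edist_pos.2 hne).ne' hdtop
  have hdr : d ≤ r / (16 * L ^ 2) := ENNReal.toReal_le_of_le_ofReal (by positivity) hxx'
  have hLd : L ^ 2 * d ≤ r / 16 := by
    rw [le_div_iff₀ (by positivity)] at hdr
    linarith
  have hL2 : L ≤ L ^ 2 := le_self_pow₀ hL (by norm_num)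
  have hd1 : d ≤ L * d := le_mul_of_one_le_left hd0.le hL
  have hd2 : L * d ≤ L ^ 2 * d := by gcongr
  have hrR' : r ≤ R / 16 := h.le_radius
  obtain ⟨y, hy, rfl⟩ := h.exists_coord (hx.trans_lt
    ((ENNReal.ofReal_lt_ofReal_iff h.pos).2 (by linarith [h.pos])))
  have hpx' : edist (Ψ c) x' < ENNReal.ofReal r := by
    calc edist (Ψ c) x' ≤ edist (Ψ c) (Ψ y) + edist (Ψ y) x' := edist_triangle _ _ _
      _ ≤ ENNReal.ofReal (r / 4) + ENNReal.ofReal d := by rw [hed]; gcongr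
      _ < ENNReal.ofReal r := by
          rw [← ENNReal.ofReal_add (by positivity) hd0.le, ENNReal.ofReal_lt_ofReal_iff hr]
          linarith
  obtain ⟨y', hy', rfl⟩ := h.exists_coord hpx'
  have hyR : y ∈ closedBall c R := closedBall_subset_closedBall (by linarith) hy
  have hy'R : y' ∈ closedBall c R := closedBall_subset_closedBall (by linarith) hy'
  set v := y' - y with hv
  have hvd : ‖v‖ = dist y y' := by rw [hv, dist_comm, dist_eq_norm]
  have hs1 : ‖v‖ ≤ L * d := by
    rw [hvd]; exact h.dist_le_of_edist_le hyR hy'R hd0.le hed.le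
  have hs2 : d ≤ L * ‖v‖ := by
    have := h.edist_le_ofReal hyR hy'R
    rw [hed, ← hvd] at this
    exact (ENNReal.ofReal_le_ofReal_iff (by positivity)).1 this
  have hv0 : v ≠ 0 := by
    rintro h0
    rw [h0, norm_zero] at hs2
    linarith
  have hvpos : 0 < ‖v‖ := norm_pos_iff.2 hv0
  set a := scaleAverage φ F with ha
  have hyc : dist y c ≤ R / 16 := hy
  have hS4 : y ∈ closedBall c (R / 4) := closedBall_subset_closedBall (by linarith) hy
  have hsubS : closedBall y ‖v‖ ⊆ closedBall c (R / 8) := fun z hz ↦ by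
    rw [mem_closedBall] at hz ⊢
    linarith [dist_triangle z y c]
  have hS84 : closedBall c (R / 8) ⊆ closedBall c (R / 4) :=
    closedBall_subset_closedBall (by linarith)
  have hS8 : closedBall c (R / 8) ⊆ closedBall c R :=
    closedBall_subset_closedBall (by linarith)
  have hmain : weightEDist n f (Ψ y) (Ψ y') ≤
      ENNReal.ofReal (C₁ * (segmentConst n J * ‖v‖ * Real.exp (a y ‖v‖))) := by
    refine iSup₂_le fun ε hε ↦ ?_
    -- The competing chains are the images of dyadic subdivisions of the coordinate segment, refined
    -- until the steps are shorter than `ε`; the bound on their sums does not depend on the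
    -- refinement.
    have hlim : Tendsto (fun m : ℕ ↦ ENNReal.ofReal (L * (‖v‖ / 2 ^ m))) atTop (𝓝 0) := by
      rw [← ENNReal.ofReal_zero]
      refine (ENNReal.continuous_ofReal.tendsto 0).comp ?_
      have := (tendsto_pow_atTop_nhds_zero_of_lt_one (r := (1 / 2 : ℝ)) (by norm_num)
        (by norm_num)).const_mul (L * ‖v‖)
      simpa [div_eq_mul_inv, mul_assoc] using this
    obtain ⟨m, hm⟩ := (hlim.eventually (gt_mem_nhds hε)).exists
    set z : ℕ → EuclideanSpace ℝ (Fin n) := fun i ↦ y + ((i : ℝ) / 2 ^ m) • v with hz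
    set e : ℝ := ‖v‖ / 2 ^ m with he
    have he0 : 0 < e := by positivity
    have hev : e ≤ ‖v‖ := div_le_self hvpos.le (one_le_pow₀ (by norm_num))
    have hzmem : ∀ i ≤ 2 ^ m, z i ∈ closedBall y ‖v‖ := by
      intro i hi
      rw [hz, mem_closedBall, dist_eq_norm, add_sub_cancel_left, norm_smul,
        Real.norm_of_nonneg (by positivity)]
      refine mul_le_of_le_one_left hvpos.le ?_
      rw [div_le_one (by positivity)]
      exact_mod_cast hi
    have hstep : ∀ i, dist (z i) (z (i + 1)) = e := by
      intro i
      rw [hz, dist_eq_norm, add_sub_add_left_eq_sub, ← sub_smul, norm_smul, ← sub_div, he]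
      push_cast
      rw [sub_add_cancel_left, norm_div, norm_neg, norm_one,
        Real.norm_of_nonneg (by positivity : (0 : ℝ) ≤ 2 ^ m)]
      ring
    have hedstep : ∀ i < 2 ^ m, edist (Ψ (z i)) (Ψ (z (i + 1))) ≤ ENNReal.ofReal (L * e) := by
      intro i hi
      rw [← hstep i]
      exact h.edist_le_ofReal (hS8 (hsubS (hzmem i hi.le))) (hS8 (hsubS (hzmem (i + 1) hi)))
    have hchain : Ψ (z 0) = Ψ y ∧ Ψ (z (2 ^ m)) = Ψ y' ∧
        ∀ i < 2 ^ m, edist (Ψ (z i)) (Ψ (z (i + 1))) ≤ ε := by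
      refine ⟨by simp [hz], ?_, fun i hi ↦ (hedstep i hi).trans hm.le⟩
      simp [hz, hv]
    refine iInf_le_of_le (2 ^ m) (iInf_le_of_le (fun i ↦ Ψ (z i)) (iInf_le_of_le hchain ?_))
    have hLe : L * e ≤ r / 16 := by
      calc L * e ≤ L * (L * d) := by gcongr; exact hev.trans hs1
        _ = L ^ 2 * d := by ring
        _ ≤ _ := hLd
    have hterm : ∀ i ∈ Finset.range (2 ^ m), ballGauge n f (Ψ (z i)) (Ψ (z (i + 1))) ≤
        ENNReal.ofReal (C₁ * (e * Real.exp (a (z i) e))) := by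
      intro i hi
      have hi' := Finset.mem_range.1 hi
      have hz8 := hsubS (hzmem i hi'.le)
      have hpz : edist (Ψ c) (Ψ (z i)) ≤ ENNReal.ofReal (r / 2) := by
        calc edist (Ψ c) (Ψ (z i)) ≤ edist (Ψ c) (Ψ y) + edist (Ψ y) (Ψ (z i)) :=
              edist_triangle _ _ _
          _ ≤ ENNReal.ofReal (r / 4) + ENNReal.ofReal (L ^ 2 * d) := by
              gcongr
              refine (h.edist_le_ofReal hyR (hS8 hz8)).trans (ENNReal.ofReal_le_ofReal ?_)
              calc L * dist y (z i) ≤ L * (L * d) := by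
                    gcongr
                    rw [dist_comm]
                    exact (hzmem i hi'.le).trans hs1
                _ = L ^ 2 * d := by ring
          _ ≤ _ := by
              rw [← ENNReal.ofReal_add (by positivity) (by positivity)]
              exact ENNReal.ofReal_le_ofReal (by linarith)
      have h1 := (hK _ F ν hw (z i) hz8 hpz (L * e) (by positivity) (by linarith)).1
      refine (ballGauge_le_of_measure_le hn hmid ENNReal.ofReal_ne_top (hedstep i hi') h1).trans ?_
      rw [← ENNReal.ofReal_mul hg.le]
      apply ENNReal.ofReal_le_ofReal
      have h2 := hsc.abs_sub_le_of_le_mul (hS84 hz8) he0 (le_mul_of_one_le_left he0.le hL)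
        (by linarith) (le_refl (L * e))
      have h3 : Real.exp (a (z i) (L * e)) ≤
          Real.exp ((⌈L⌉₊ + 1) * J) * Real.exp (a (z i) e) := by
        rw [← Real.exp_add]
        apply Real.exp_le_exp.2
        linarith [le_abs_self (a (z i) (L * e) - a (z i) e)]
      calc _ ≤ gaugeFactor n * (K * (L * e *
            (Real.exp ((⌈L⌉₊ + 1) * J) * Real.exp (a (z i) e)))) := by gcongr
        _ = _ := by rw [hC₁]; ring
    refine (Finset.sum_le_sum hterm).trans ?_
    rw [← ENNReal.ofReal_sum_of_nonneg fun i _ ↦ by positivity, ← Finset.mul_sum]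
    apply ENNReal.ofReal_le_ofReal
    gcongr
    exact hsc.sum_segment_exp_le hv0 (by linarith) (hsubS.trans hS84) m
  -- The scales `‖v‖` and `d` are not ordered, so both are compared with `L d`, which dominates
  -- them.
  have hcomp : ‖v‖ * Real.exp (a y ‖v‖) ≤ C₂ * (d * Real.exp (a y d)) := by
    have e1 := hsc.abs_sub_le_of_le_mul hS4 hvpos hs1 (by linarith)
      (Λ := L ^ 2) (by nlinarith)
    have e2 := hsc.abs_sub_le_of_le_mul hS4 hd0 hd1 (by linarith) (Λ := L ^ 2) (by nlinarith)
    have e3 : Real.exp (a y ‖v‖) ≤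
        Real.exp (2 * ((⌈L ^ 2⌉₊ + 1) * J)) * Real.exp (a y d) := by
      rw [← Real.exp_add]
      apply Real.exp_le_exp.2
      linarith [neg_abs_le (a y (L * d) - a y ‖v‖), le_abs_self (a y (L * d) - a y d)]
    calc _ ≤ L * d * (Real.exp (2 * ((⌈L ^ 2⌉₊ + 1) * J)) * Real.exp (a y d)) := by gcongr
      _ = _ := by rw [hC₂]; ring
  have h2 := (hK _ F ν hw y (closedBall_subset_closedBall (by linarith) hy)
    (hx.trans (ENNReal.ofReal_le_ofReal (by linarith))) d hd0 (by linarith)).2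
  rw [hed]
  calc weightEDist n f (Ψ y) (Ψ y') ^ n
      ≤ ENNReal.ofReal (C₁ * (segmentConst n J * C₂) * (d * Real.exp (a y d))) ^ n := by
        gcongr
        refine hmain.trans (ENNReal.ofReal_le_ofReal ?_)
        calc _ = C₁ * segmentConst n J * (‖v‖ * Real.exp (a y ‖v‖)) := by ring
          _ ≤ C₁ * segmentConst n J * (C₂ * (d * Real.exp (a y d))) := by gcongr
          _ = _ := by ring
    _ = ENNReal.ofReal (C₁ * (segmentConst n J * C₂)) ^ n *
        ENNReal.ofReal (d * Real.exp (a y d)) ^ n := by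
        rw [ENNReal.ofReal_mul (by positivity), mul_pow]
    _ ≤ ENNReal.ofReal (C₁ * (segmentConst n J * C₂)) ^ n *
        (ENNReal.ofReal K ^ n * conformalVolume n f (eball (Ψ y) (ENNReal.ofReal d))) := by
        gcongr
    _ = ENNReal.ofReal (C₁ * (segmentConst n J * C₂) * K) ^ n *
        conformalVolume n f (eball (Ψ y) (ENNReal.ofReal d)) := by
        rw [ENNReal.ofReal_mul (q := K) (by positivity), mul_pow, ← mul_assoc]
    _ ≤ _ := by
        gcongr
        exact le_max_right _ _

end LocalGauge

/-! ### The lower bound of the distance. -/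

section LocalDistance

variable {n : ℕ} {M : Type*} [EMetricSpace M] [ChartedSpace (EuclideanSpace ℝ (Fin n)) M]
  [RiemannianBundle (fun x : M ↦ TangentSpace (𝓡 n) x)] [MeasurableSpace M]
  {Ψ : EuclideanSpace ℝ (Fin n) → M} {c : EuclideanSpace ℝ (Fin n)} {R L r : ℝ}
  {φ : EuclideanSpace ℝ (Fin n) → ℝ} {B : ℝ}

/-- The lower bound of the distance by the measure. -/
lemma BilipschitzChart.exists_le_weightEDist (h : BilipschitzChart Ψ c R L r)
    (hφ : IsAnnularKernel φ B) (J : ℝ) :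
    ∃ K : ℝ, 1 ≤ K ∧ ∀ (f : M → ℝ) F ν, WeightModel Ψ c R L φ J (conformalVolume n f) F ν →
      ∀ x, edist (Ψ c) x ≤ ENNReal.ofReal (r / 4) →
      ∀ x', edist x x' ≤ ENNReal.ofReal (r / (16 * L ^ 2)) →
      conformalVolume n f (eball x (edist x x')) ≤
        ENNReal.ofReal K ^ n * weightEDist n f x x' ^ n := by
  classical
  obtain ⟨K, hK1, hK⟩ := h.exists_measure_ball_const hφ J
  obtain ⟨k, hk0, hk⟩ := h.exists_le_ballGauge hφ J
  have hL := h.one_le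
  have hL0 : 0 < L := by linarith
  have hK0 : 0 < K := by linarith
  set C₁ : ℝ := Real.exp (-(2 * J + 4 * (3 + 2 * (2 * L)) * J * L ^ 2 *
    ScaleControl.geomBound n)) / (4 * (2 * L) * L ^ 2) with hC₁
  have hC₁0 : 0 < C₁ := by positivity
  set C₂ : ℝ := Real.exp (-((⌈L⌉₊ + 1) * J)) with hC₂
  have hC₂0 : 0 < C₂ := Real.exp_pos _
  set k₁ : ℝ := k * (C₁ * C₂) with hk₁
  have hk₁0 : 0 < k₁ := by positivity
  refine ⟨max 1 (K / k₁), le_max_left _ _, ?_⟩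
  intro f F ν hw x hx x' hxx'
  have hsc := hw.scaleControl
  have hn := hsc.one_le_dim
  have hJ := hsc.one_le
  have hR := h.radius_pos
  have hrR := h.mul_le
  have hr := h.pos
  by_cases hne : x = x'
  · rw [← hne, edist_self]; simp
  set d : ℝ := (edist x x').toReal with hd
  have hdtop : edist x x' ≠ ⊤ := ne_top_of_le_ne_top ENNReal.ofReal_ne_top hxx'
  have hed : edist x x' = ENNReal.ofReal d := (ENNReal.ofReal_toReal hdtop).symm
  have hd0 : 0 < d := ENNReal.toReal_pos (edist_pos.2 hne).ne' hdtop
  have hdr : d ≤ r / (16 * L ^ 2) := ENNReal.toReal_le_of_le_ofReal (by positivity) hxx'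
  have hLd : L ^ 2 * d ≤ r / 16 := by
    rw [le_div_iff₀ (by positivity)] at hdr
    linarith
  have hL2 : L ≤ L ^ 2 := le_self_pow₀ hL (by norm_num)
  have hd1 : d ≤ L * d := le_mul_of_one_le_left hd0.le hL
  have hd2 : L * d ≤ L ^ 2 * d := by gcongr
  have hrR' : r ≤ R / 16 := h.le_radius
  obtain ⟨y, hy, rfl⟩ := h.exists_coord (hx.trans_lt
    ((ENNReal.ofReal_lt_ofReal_iff h.pos).2 (by linarith [h.pos])))
  have hyR : y ∈ closedBall c R := closedBall_subset_closedBall (by linarith) hy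
  have hS4 : y ∈ closedBall c (R / 4) := closedBall_subset_closedBall (by linarith) hy
  set a := scaleAverage φ F with ha
  have hmain : ENNReal.ofReal (k₁ * (d * Real.exp (a y d))) ≤ weightEDist n f (Ψ y) x' := by
    -- As the distance is a supremum over `ε`, one value suffices for a lower bound. Steps of length
    -- at most `d` keep the relevant part of the chain in the chart.
    refine le_iSup₂_of_le (edist (Ψ y) x') (edist_pos.2 hne) ?_
    refine le_iInf fun N ↦ le_iInf fun p ↦ le_iInf fun hp ↦ ?_
    obtain ⟨hp0, hpN, hstep⟩ := hp
    -- The chain is cut at its first exit from the ball of radius `d`; up to then it stays within `2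
    -- d` of the starting point.
    have hex : ∃ j, ENNReal.ofReal d ≤ edist (Ψ y) (p j) := ⟨N, by rw [hpN, hed]⟩
    set j := Nat.find hex with hj
    have hj1 : ENNReal.ofReal d ≤ edist (Ψ y) (p j) := Nat.find_spec hex
    have hjN : j ≤ N := Nat.find_min' hex (by rw [hpN, hed])
    have hjlt : ∀ i < j, edist (Ψ y) (p i) < ENNReal.ofReal d := fun i hi ↦
      not_le.1 (Nat.find_min hex hi)
    have hstep' : ∀ i < j, edist (p i) (p (i + 1)) ≤ ENNReal.ofReal d := fun i hi ↦ by
      rw [← hed]; exact hstep i (hi.trans_le hjN)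
    have hle : ∀ i ≤ j, edist (Ψ y) (p i) ≤ ENNReal.ofReal (2 * d) := by
      intro i hi
      rcases Nat.eq_zero_or_pos i with h0 | hpos
      · rw [h0, hp0, edist_self]; exact zero_le
      · obtain ⟨l, rfl⟩ := Nat.exists_eq_succ_of_ne_zero hpos.ne'
        have hl : l < j := hi
        calc edist (Ψ y) (p (l + 1)) ≤ edist (Ψ y) (p l) + edist (p l) (p (l + 1)) :=
              edist_triangle _ _ _
          _ ≤ ENNReal.ofReal d + ENNReal.ofReal d := add_le_add (hjlt l hl).le (hstep' l hl)
          _ = _ := by rw [← ENNReal.ofReal_add hd0.le hd0.le, two_mul]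
    have hpc : ∀ i ≤ j, edist (Ψ c) (p i) ≤ ENNReal.ofReal (3 * r / 8) := by
      intro i hi
      calc edist (Ψ c) (p i) ≤ edist (Ψ c) (Ψ y) + edist (Ψ y) (p i) := edist_triangle _ _ _
        _ ≤ ENNReal.ofReal (r / 4) + ENNReal.ofReal (2 * d) := add_le_add hx (hle i hi)
        _ ≤ _ := by
            rw [← ENNReal.ofReal_add (by positivity) (by positivity)]
            exact ENNReal.ofReal_le_ofReal (by linarith)
    have hcoord : ∀ i, ∃ q, i ≤ j → q ∈ closedBall c (R / 16) ∧ Ψ q = p i := by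
      intro i
      by_cases hi : i ≤ j
      · obtain ⟨q, hq, hq'⟩ := h.exists_coord ((hpc i hi).trans_lt
          ((ENNReal.ofReal_lt_ofReal_iff h.pos).2 (by linarith [h.pos])))
        exact ⟨q, fun _ ↦ ⟨hq, hq'⟩⟩
      · exact ⟨c, fun h ↦ absurd h hi⟩
    choose q hq using hcoord
    have hqR : ∀ i ≤ j, q i ∈ closedBall c R := fun i hi ↦
      closedBall_subset_closedBall (by linarith) (hq i hi).1
    have hq0 : q 0 = y := by
      have h1 := (hq 0 (Nat.zero_le _)).2
      rw [hp0] at h1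
      have := h.dist_le_of_edist_le (hqR 0 (Nat.zero_le _)) hyR le_rfl (by rw [h1, edist_self]; simp)
      rw [mul_zero] at this
      exact dist_le_zero.1 this
    set t : ℕ → ℝ := fun i ↦ (edist (p i) (p (i + 1))).toReal / 2 with ht
    have ht0 : ∀ i, 0 ≤ t i := fun i ↦ by positivity
    have htd : ∀ i < j, t i ≤ d / 2 := fun i hi ↦ by
      have := ENNReal.toReal_le_of_le_ofReal hd0.le (hstep' i hi)
      simp only [ht]
      linarith
    have het : ∀ i < j, edist (p i) (p (i + 1)) = ENNReal.ofReal (2 * t i) := fun i hi ↦ by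
      simp only [ht]
      rw [mul_div_cancel₀ _ (by norm_num), ENNReal.ofReal_toReal]
      exact ne_top_of_le_ne_top ENNReal.ofReal_ne_top (hstep' i hi)
    -- In coordinates: distances grow by at most `L`, hence `s = L d`. The exit point is at distance
    -- at least `d / L = s / L^2`, hence `Γ = L^2`. Each `m i` is the left end of its step, of
    -- length at most `L * (2 t i)`, hence the constant `2 * L`.
    have key := hsc.le_sum_exp_of_chain (L := 2 * L) (Γ := L ^ 2) (s := L * d) (y := y) (N := j)
      (p := q) (m := q) (t := t) (by positivity) (one_le_pow₀ hL) (by positivity) (by linarith) hS4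
      hq0 ?_ (fun i _ ↦ ht0 i) (fun i hi ↦ (htd i hi).trans (by linarith))
      (fun i hi ↦ closedBall_subset_closedBall (by linarith) (hq i hi.le).1) ?_ ?_ ?_
    rotate_left
    · have e : L * d / L ^ 2 = d / L := by field_simp
      rw [e, div_le_iff₀ hL0, mul_comm]
      have := h.edist_le_ofReal (hqR j le_rfl) hyR
      rw [(hq j le_rfl).2, edist_comm] at this
      exact (ENNReal.ofReal_le_ofReal_iff (by positivity)).1 (hj1.trans this)
    · intro i hi
      refine h.dist_le_of_edist_le hyR (hqR i hi.le) hd0.le ?_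
      rw [(hq i hi.le).2]
      exact (hjlt i hi).le
    · intro i hi
      rw [dist_self]
      have := ht0 i
      positivity
    · intro i hi
      have := h.dist_le_of_edist_le (hqR (i + 1) hi) (hqR i hi.le) (t := 2 * t i)
        (by have := ht0 i; positivity) (by
          rw [(hq (i + 1) hi).2, (hq i hi.le).2, edist_comm, het i hi])
      linarith
    have hsumle : ENNReal.ofReal (k * ∑ i ∈ Finset.range j, t i * Real.exp (a (q i) (t i))) ≤
        ∑ i ∈ Finset.range N, ballGauge n f (p i) (p (i + 1)) := by
      rw [Finset.mul_sum, ENNReal.ofReal_sum_of_nonneg fun i _ ↦ by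
        have := ht0 i; positivity]
      refine le_trans (Finset.sum_le_sum fun i hi ↦ ?_)
        (Finset.sum_le_sum_of_subset (Finset.range_subset_range.2 hjN))
      have hij := Finset.mem_range.1 hi
      rcases (ht0 i).eq_or_lt with h0 | hpos
      · rw [← h0]; simp
      · have := hk f F ν hw (q i) (closedBall_subset_closedBall (by linarith) (hq i hij.le).1)
          (by rw [(hq i hij.le).2]; exact hpc i hij.le) (p (i + 1)) (t i) hpos
          (by linarith [htd i hij]) (by rw [(hq i hij.le).2]; exact het i hij)
        rwa [(hq i hij.le).2] at this
    refine le_trans (ENNReal.ofReal_le_ofReal ?_) hsumle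
    rw [hk₁, mul_assoc]
    refine mul_le_mul_of_nonneg_left (le_trans ?_ key) hk0.le
    rw [← hC₁, mul_assoc]
    refine mul_le_mul_of_nonneg_left ?_ hC₁0.le
    have h2 := hsc.abs_sub_le_of_le_mul hS4 hd0 hd1 (by linarith) (le_refl (L * d))
    have h3 : C₂ * Real.exp (a y d) ≤ Real.exp (a y (L * d)) := by
      rw [hC₂, ← Real.exp_add]
      apply Real.exp_le_exp.2
      linarith [neg_abs_le (a y (L * d) - a y d)]
    calc C₂ * (d * Real.exp (a y d)) = d * (C₂ * Real.exp (a y d)) := by ring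
      _ ≤ L * d * Real.exp (a y (L * d)) := by gcongr
  have h2 := (hK _ F ν hw y (closedBall_subset_closedBall (by linarith) hy)
    (hx.trans (ENNReal.ofReal_le_ofReal (by linarith))) d hd0 (by linarith)).1
  rw [hed]
  calc conformalVolume n f (eball (Ψ y) (ENNReal.ofReal d))
      ≤ ENNReal.ofReal (K * (d * Real.exp (a y d))) ^ n := h2
    _ = ENNReal.ofReal (K / k₁) ^ n * ENNReal.ofReal (k₁ * (d * Real.exp (a y d))) ^ n := by
        rw [← mul_pow, ← ENNReal.ofReal_mul (by positivity)]
        congr 2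
        field_simp
    _ ≤ _ := by
        gcongr
        exact le_max_right _ _

/-- The local form of the main estimates, around the centre of a bilipschitz chart. -/
lemma BilipschitzChart.exists_local_const (h : BilipschitzChart Ψ c R L r)
    (hφ : IsAnnularKernel φ B) (hmid : HasMidpoints M) (J : ℝ) :
    ∃ K : ℝ, 1 ≤ K ∧ ∀ (f : M → ℝ) F ν, WeightModel Ψ c R L φ J (conformalVolume n f) F ν →
      ∀ x, edist (Ψ c) x ≤ ENNReal.ofReal (r / 4) →
      (∀ ρ, 0 < ρ → ρ ≤ r / 4 →
        conformalVolume n f (eball x (ENNReal.ofReal (2 * ρ))) ≤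
          ENNReal.ofReal K ^ n * conformalVolume n f (eball x (ENNReal.ofReal ρ)) ∧
        conformalVolume n f (eball x (ENNReal.ofReal ρ)) < ⊤) ∧
      ∀ x', edist x x' ≤ ENNReal.ofReal (r / (16 * L ^ 2)) →
        weightEDist n f x x' ^ n ≤
          ENNReal.ofReal K ^ n * conformalVolume n f (eball x (edist x x')) ∧
        conformalVolume n f (eball x (edist x x')) ≤
          ENNReal.ofReal K ^ n * weightEDist n f x x' ^ n := by
  obtain ⟨K₁, h₁, hK₁⟩ := h.exists_doubling_const hφ J
  obtain ⟨K₂, h₂, hK₂⟩ := h.exists_weightEDist_le hφ hmid J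
  obtain ⟨K₃, h₃, hK₃⟩ := h.exists_le_weightEDist hφ J
  refine ⟨max K₁ (max K₂ K₃), h₁.trans (le_max_left _ _), ?_⟩
  intro f F ν hw x hx
  have hr := h.pos
  refine ⟨fun ρ hρ hρr ↦ ?_, fun x' hx' ↦ ⟨?_, ?_⟩⟩
  · obtain ⟨h4, h5⟩ := hK₁ _ F ν hw x (hx.trans (ENNReal.ofReal_le_ofReal (by linarith))) ρ hρ hρr
    refine ⟨h4.trans ?_, h5⟩
    gcongr
    exact le_max_left _ _
  · refine (hK₂ f F ν hw x hx x' hx').trans ?_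
    gcongr
    exact (le_max_left _ _).trans (le_max_right _ _)
  · refine (hK₃ f F ν hw x hx x' hx').trans ?_
    gcongr
    exact (le_max_right _ _).trans (le_max_right _ _)

end LocalDistance

/-! ### The Riemannian metric in a chart. -/

section ChartFrame

variable {n : ℕ} {M : Type*} [TopologicalSpace M] [ChartedSpace (EuclideanSpace ℝ (Fin n)) M]

theorem chartFrame_eq_mfderivWithin (p : M) (y : EuclideanSpace ℝ (Fin n)) :
    chartFrame p y = mfderivWithin 𝓘(ℝ, EuclideanSpace ℝ (Fin n)) (𝓡 n)
      (extChartAt (𝓡 n) p).symm (range (𝓡 n)) y := by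
  rw [chartFrame, ModelWithCorners.Boundaryless.range_eq_univ, mfderivWithin_univ]

/-- The differential at `x` of the preferred chart at `p`. -/
def chartCoframe (p x : M) : TangentSpace (𝓡 n) x →L[ℝ] EuclideanSpace ℝ (Fin n) :=
  mfderiv (𝓡 n) 𝓘(ℝ, EuclideanSpace ℝ (Fin n)) (extChartAt (𝓡 n) p) x

variable [IsManifold (𝓡 n) ∞ M]

theorem chartCoframe_chartFrame (p : M) {y : EuclideanSpace ℝ (Fin n)}
    (hy : y ∈ (extChartAt (𝓡 n) p).target) (v : EuclideanSpace ℝ (Fin n)) :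
    chartCoframe p ((extChartAt (𝓡 n) p).symm y) (chartFrame p y v) = v := by
  rw [chartFrame_eq_mfderivWithin]
  exact congr($(mfderiv_extChartAt_comp_mfderivWithin_extChartAt_symm hy) v)

variable [RiemannianBundle (fun x : M ↦ TangentSpace (𝓡 n) x)]

section Bounds

variable [IsContinuousRiemannianBundle (EuclideanSpace ℝ (Fin n))
  (fun x : M ↦ TangentSpace (𝓡 n) x)]

theorem exists_norm_chartFrame_le (p : M) :
    ∃ C : ℝ, 0 < C ∧ ∀ᶠ y in 𝓝 (extChartAt (𝓡 n) p p),
      ∀ v : EuclideanSpace ℝ (Fin n), ‖chartFrame p y v‖ ≤ C * ‖v‖ := by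
  obtain ⟨C, hC, h⟩ := eventually_norm_mfderivWithin_symm_extChartAt_lt (𝓡 n) p
  refine ⟨C, hC, ?_⟩
  have h2 : range (𝓡 n) = univ := by simp
  rw [h2, nhdsWithin_univ] at h
  filter_upwards [h] with y hy v
  let _ := @normedAddCommGroupTangentSpaceVectorSpace (EuclideanSpace ℝ (Fin n)) _ _ y
  let _ := @normedSpaceTangentSpaceVectorSpace (EuclideanSpace ℝ (Fin n)) _ _ y
  rw [chartFrame_eq_mfderivWithin, h2]
  exact (ContinuousLinearMap.le_of_opNorm_le _ hy.le v)

theorem exists_norm_chartCoframe_le (p : M) :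
    ∃ C : ℝ, 0 < C ∧ ∀ᶠ x in 𝓝 p, ∀ v : TangentSpace (𝓡 n) x,
      ‖chartCoframe p x v‖ ≤ C * ‖v‖ := by
  obtain ⟨C, hC, h⟩ := eventually_norm_mfderiv_extChartAt_lt (𝓡 n) p
  refine ⟨C, hC, ?_⟩
  filter_upwards [h] with y hy v
  let _ := @normedAddCommGroupTangentSpaceVectorSpace (EuclideanSpace ℝ (Fin n)) _ _
    (extChartAt (𝓡 n) p y)
  let _ := @normedSpaceTangentSpaceVectorSpace (EuclideanSpace ℝ (Fin n)) _ _
    (extChartAt (𝓡 n) p y)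
  exact (ContinuousLinearMap.le_of_opNorm_le _ hy.le v)

end Bounds

/-- On the ball of radius `R` around the coordinates of `p`, the metric is comparable with the
Euclidean one, with constant `L`. -/
structure ChartBounds (p : M) (R L : ℝ) : Prop where
  pos : 0 < R
  one_le : 1 ≤ L
  subset_target : closedBall (extChartAt (𝓡 n) p p) R ⊆ (extChartAt (𝓡 n) p).target
  norm_le : ∀ y ∈ closedBall (extChartAt (𝓡 n) p p) R, ∀ v : EuclideanSpace ℝ (Fin n),
    ‖chartFrame p y v‖ ≤ L * ‖v‖
  norm_coframe_le : ∀ x ∈ (extChartAt (𝓡 n) p).source,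
    extChartAt (𝓡 n) p x ∈ closedBall (extChartAt (𝓡 n) p p) R → ∀ v : TangentSpace (𝓡 n) x,
      ‖chartCoframe p x v‖ ≤ L * ‖v‖

theorem ChartBounds.le_norm {p : M} {R L : ℝ} (h : ChartBounds (n := n) p R L)
    {y : EuclideanSpace ℝ (Fin n)} (hy : y ∈ closedBall (extChartAt (𝓡 n) p p) R)
    (v : EuclideanSpace ℝ (Fin n)) : ‖v‖ ≤ L * ‖chartFrame p y v‖ := by
  have ht := h.subset_target hy
  have h1 := h.norm_coframe_le ((extChartAt (𝓡 n) p).symm y) ((extChartAt (𝓡 n) p).map_target ht)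
    (by rwa [(extChartAt (𝓡 n) p).right_inv ht]) (chartFrame p y v)
  rwa [chartCoframe_chartFrame p ht] at h1

theorem exists_chartBounds [IsContinuousRiemannianBundle (EuclideanSpace ℝ (Fin n))
    (fun x : M ↦ TangentSpace (𝓡 n) x)] (p : M) : ∃ R L : ℝ, ChartBounds (n := n) p R L := by
  obtain ⟨C, hC, h⟩ := exists_norm_chartFrame_le (n := n) p
  obtain ⟨C', hC', h'⟩ := exists_norm_chartCoframe_le (n := n) p
  have h1 : ∀ᶠ y in 𝓝 (extChartAt (𝓡 n) p p), ∀ v : TangentSpace (𝓡 n)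
      ((extChartAt (𝓡 n) p).symm y),
      ‖chartCoframe p ((extChartAt (𝓡 n) p).symm y) v‖ ≤ C' * ‖v‖ := by
    have hc := continuousAt_extChartAt_symm (I := 𝓡 n) p
    rw [ContinuousAt, extChartAt_to_inv] at hc
    exact hc.eventually h'
  have h2 := extChartAt_target_mem_nhds (I := 𝓡 n) p
  obtain ⟨R, hR, hsub⟩ := nhds_basis_closedBall.mem_iff.1 (inter_mem (inter_mem h h1) h2)
  refine ⟨R, max 1 (max C C'), hR, le_max_left _ _, fun y hy ↦ (hsub hy).2, fun y hy v ↦ ?_,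
    fun x hx hy v ↦ ?_⟩
  · refine ((hsub hy).1.1 v).trans ?_
    gcongr
    exact (le_max_left _ _).trans (le_max_right _ _)
  · have h3 := (hsub hy).1.2
    have h4 : (extChartAt (𝓡 n) p).symm (extChartAt (𝓡 n) p x) = x :=
      (extChartAt (𝓡 n) p).left_inv hx
    -- The bound lives in the tangent space at `symm (chart x)`; it is transported along the
    -- equality of this point with `x`.
    have h5 : ∀ x', x' = x → (∀ v : TangentSpace (𝓡 n) x', ‖chartCoframe p x' v‖ ≤ C' * ‖v‖) →
        ∀ v : TangentSpace (𝓡 n) x, ‖chartCoframe p x v‖ ≤ C' * ‖v‖ := by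
      rintro x' rfl h
      exact h
    refine (h5 _ h4 h3 v).trans ?_
    gcongr
    exact (le_max_right _ _).trans (le_max_right _ _)

/-- A path that remains in the chart is mapped to a Euclidean path at most `L` times as long. -/
theorem ChartBounds.edist_extChartAt_le {p : M} {R L : ℝ} (h : ChartBounds (n := n) p R L)
    {γ : ℝ → M} (hγ : ContMDiffOn 𝓘(ℝ, ℝ) (𝓡 n) 1 γ (Icc 0 1))
    (hs : ∀ t ∈ Icc (0 : ℝ) 1, γ t ∈ (extChartAt (𝓡 n) p).source ∧
      extChartAt (𝓡 n) p (γ t) ∈ closedBall (extChartAt (𝓡 n) p p) R) :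
    edist (extChartAt (𝓡 n) p (γ 0)) (extChartAt (𝓡 n) p (γ 1)) ≤
      ENNReal.ofReal L * pathELength (𝓡 n) γ 0 1 := by
  have hsrc : ∀ t ∈ Icc (0 : ℝ) 1, γ t ∈ (chartAt (EuclideanSpace ℝ (Fin n)) p).source :=
    fun t ht ↦ by simpa [extChartAt_source] using (hs t ht).1
  let γ' := extChartAt (𝓡 n) p ∘ γ
  have hC : ContMDiffOn 𝓘(ℝ, ℝ) 𝓘(ℝ, EuclideanSpace ℝ (Fin n)) 1 γ' (Icc 0 1) :=
    contMDiffOn_extChartAt.comp (I' := 𝓡 n)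
      (t := (chartAt (EuclideanSpace ℝ (Fin n)) p).source) hγ hsrc
  calc edist (extChartAt (𝓡 n) p (γ 0)) (extChartAt (𝓡 n) p (γ 1))
    _ = ‖γ' 1 - γ' 0‖ₑ := by rw [edist_comm, edist_eq_enorm_sub]; rfl
    _ ≤ ∫⁻ t in Icc 0 1, ‖derivWithin γ' (Icc 0 1) t‖ₑ := by
      apply enorm_sub_le_lintegral_derivWithin_Icc_of_contDiffOn_Icc _ zero_le_one
      rwa [← contMDiffOn_iff_contDiffOn]
    _ ≤ ∫⁻ t in Icc 0 1, ENNReal.ofReal L * ‖mfderivWithin 𝓘(ℝ, ℝ) (𝓡 n) γ (Icc 0 1) t 1‖ₑ := by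
      apply setLIntegral_mono' measurableSet_Icc (fun t ht ↦ ?_)
      have h1 : mfderivWithin 𝓘(ℝ, ℝ) 𝓘(ℝ, EuclideanSpace ℝ (Fin n)) γ' (Icc 0 1) t =
          (mfderiv (𝓡 n) 𝓘(ℝ, EuclideanSpace ℝ (Fin n)) (extChartAt (𝓡 n) p) (γ t)) ∘L
            (mfderivWithin 𝓘(ℝ, ℝ) (𝓡 n) γ (Icc 0 1) t) := by
        apply mfderiv_comp_mfderivWithin
        · exact mdifferentiableAt_extChartAt (hsrc t ht)
        · exact hγ.mdifferentiableOn one_ne_zero _ ht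
        · rw [uniqueMDiffWithinAt_iff_uniqueDiffWithinAt]
          exact uniqueDiffOn_Icc zero_lt_one _ ht
      have h2 : derivWithin γ' (Icc 0 1) t =
          chartCoframe p (γ t) (mfderivWithin 𝓘(ℝ, ℝ) (𝓡 n) γ (Icc 0 1) t 1) := by
        rw [← fderivWithin_derivWithin, ← mfderivWithin_eq_fderivWithin]
        exact congr($h1 1)
      rw [h2, ← ofReal_norm, ← ofReal_norm, ← ENNReal.ofReal_mul (by linarith [h.one_le])]
      exact ENNReal.ofReal_le_ofReal (h.norm_coframe_le _ (hs t ht).1 (hs t ht).2 _)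
    _ = ENNReal.ofReal L * pathELength (𝓡 n) γ 0 1 := by
      rw [lintegral_const_mul' _ _ ENNReal.ofReal_ne_top,
          pathELength_eq_lintegral_mfderivWithin_Icc]

end ChartFrame

/-! ### Charts are bilipschitz on small balls. -/

section Bilipschitz

variable {n : ℕ} {M : Type*} [EMetricSpace M] [ChartedSpace (EuclideanSpace ℝ (Fin n)) M]
  [RiemannianBundle (fun x : M ↦ TangentSpace (𝓡 n) x)] [IsRiemannianManifold (𝓡 n) M]

theorem edist_le_pathELength {γ : ℝ → M} {a b s t : ℝ}
    (hγ : ContMDiffOn 𝓘(ℝ, ℝ) (𝓡 n) 1 γ (Icc a b)) (hs : a ≤ s) (hst : s ≤ t) (ht : t ≤ b) :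
    edist (γ s) (γ t) ≤ pathELength (𝓡 n) γ s t := by
  rw [IsRiemannianManifold.out (I := 𝓡 n)]
  exact riemannianEDist_le_pathELength (hγ.mono (Icc_subset_Icc hs ht)) rfl rfl hst

/-- A path of length at most `t` starting at `x` stays in the ball of radius `t`. -/
theorem edist_le_of_pathELength_le {γ : ℝ → M} {t : ℝ≥0∞}
    (hγ : ContMDiffOn 𝓘(ℝ, ℝ) (𝓡 n) 1 γ (Icc 0 1)) (hl : pathELength (𝓡 n) γ 0 1 ≤ t) {s : ℝ}
    (hs : s ∈ Icc (0 : ℝ) 1) : edist (γ 0) (γ s) ≤ t :=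
  ((edist_le_pathELength hγ le_rfl hs.1 hs.2).trans (pathELength_mono le_rfl hs.2)).trans hl

variable [IsManifold (𝓡 n) ∞ M]

/-- The straight segment between the coordinates, mapped to the manifold, is a competitor of length
at most `L` times its Euclidean length. -/
theorem ChartBounds.edist_symm_le {p : M} {R L : ℝ} (h : ChartBounds (n := n) p R L)
    {y y' : EuclideanSpace ℝ (Fin n)} (hy : y ∈ closedBall (extChartAt (𝓡 n) p p) R)
    (hy' : y' ∈ closedBall (extChartAt (𝓡 n) p p) R) :
    edist ((extChartAt (𝓡 n) p).symm y) ((extChartAt (𝓡 n) p).symm y') ≤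
      ENNReal.ofReal L * edist y y' := by
  let η := ContinuousAffineMap.lineMap (R := ℝ) y y'
  set γ := (extChartAt (𝓡 n) p).symm ∘ η
  have hη : Icc 0 1 ⊆ ⇑η ⁻¹' closedBall (extChartAt (𝓡 n) p p) R := by
    simp only [← image_subset_iff, ContinuousAffineMap.coe_lineMap_eq,
     ← segment_eq_image_lineMap, η]
    exact (convex_closedBall _ _).segment_subset hy hy'
  have hηt : Icc 0 1 ⊆ ⇑η ⁻¹' (extChartAt (𝓡 n) p).target :=
    hη.trans (preimage_mono h.subset_target)
  have η_smooth : ContMDiffOn 𝓘(ℝ, ℝ) 𝓘(ℝ, EuclideanSpace ℝ (Fin n)) 1 η (Icc 0 1) := by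
    apply ContMDiff.contMDiffOn
    rw [contMDiff_iff_contDiff]
    exact ContinuousAffineMap.contDiff _
  have hle : edist ((extChartAt (𝓡 n) p).symm y) ((extChartAt (𝓡 n) p).symm y') ≤
      pathELength (𝓡 n) γ 0 1 := by
    rw [IsRiemannianManifold.out (I := 𝓡 n)]
    apply riemannianEDist_le_pathELength _ _ _ zero_le_one
    · exact (contMDiffOn_extChartAt_symm p).comp η_smooth hηt
    · simp [γ, η, ContinuousAffineMap.coe_lineMap_eq]
    · simp [γ, η, ContinuousAffineMap.coe_lineMap_eq]
  refine hle.trans ?_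
  rw [← lintegral_fderiv_lineMap_eq_edist, pathELength_eq_lintegral_mfderivWithin_Icc,
    ← lintegral_const_mul' _ _ ENNReal.ofReal_ne_top]
  apply setLIntegral_mono' measurableSet_Icc (fun t ht ↦ ?_)
  have h1 : mfderivWithin 𝓘(ℝ, ℝ) (𝓡 n) γ (Icc 0 1) t =
      (chartFrame p (η t)) ∘L
        (mfderivWithin 𝓘(ℝ, ℝ) 𝓘(ℝ, EuclideanSpace ℝ (Fin n)) η (Icc 0 1) t) := by
    rw [chartFrame_eq_mfderivWithin]
    apply mfderivWithin_comp
    · exact mdifferentiableWithinAt_extChartAt_symm (hηt ht)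
    · exact η_smooth.mdifferentiableOn one_ne_zero t ht
    · exact hηt.trans (preimage_mono (extChartAt_target_subset_range p))
    · rw [uniqueMDiffWithinAt_iff_uniqueDiffWithinAt]
      exact uniqueDiffOn_Icc zero_lt_one t ht
  have h2 : mfderivWithin 𝓘(ℝ, ℝ) (𝓡 n) γ (Icc 0 1) t 1 =
      chartFrame p (η t) (fderivWithin ℝ η (Icc 0 1) t 1) := by
    rw [← mfderivWithin_eq_fderivWithin]
    exact congr($h1 1)
  rw [h2, ← ofReal_norm, ← ofReal_norm, ← ENNReal.ofReal_mul (by linarith [h.one_le])]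
  exact ENNReal.ofReal_le_ofReal (h.norm_le _ (hη ht) _)

/-- For the lower Lipschitz bound, almost minimal paths must not leave the chart. They are confined
because a path cannot go further than its length, once the radius of the chart is reduced. -/
theorem ChartBounds.exists_bilipschitzChart {p : M} {R L : ℝ} (h : ChartBounds (n := n) p R L) :
    ∃ R' r : ℝ, R' ≤ R ∧
      BilipschitzChart (extChartAt (𝓡 n) p).symm (extChartAt (𝓡 n) p p) R' L r := by
  set c := extChartAt (𝓡 n) p p with hc
  have hL := h.one_le
  have hL0 : 0 < L := by linarith
  have hΨc : (extChartAt (𝓡 n) p).symm c = p := extChartAt_to_inv p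
  have key : ∀ ρ : ℝ, 0 < ρ → ∃ r : ℝ, 0 < r ∧ ∀ z, edist p z < ENNReal.ofReal r →
      z ∈ (extChartAt (𝓡 n) p).source ∧ extChartAt (𝓡 n) p z ∈ closedBall c ρ := by
    intro ρ hρ
    have h1 : (extChartAt (𝓡 n) p).source ∩ extChartAt (𝓡 n) p ⁻¹' closedBall c ρ ∈ 𝓝 p :=
      inter_mem (extChartAt_source_mem_nhds p)
        ((continuousAt_extChartAt p).preimage_mem_nhds (closedBall_mem_nhds _ hρ))
    obtain ⟨ε, hε, hsub⟩ := EMetric.mem_nhds_iff.1 h1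
    -- The radius `ε` may be infinite, hence the minimum with one.
    refine ⟨(min ε 1).toReal, ENNReal.toReal_pos (by simp [hε.ne']) (by simp), fun z hz ↦ ?_⟩
    rw [ENNReal.ofReal_toReal (by simp)] at hz
    exact hsub (by rw [mem_eball, edist_comm]; exact hz.trans_le (min_le_left _ _))
  obtain ⟨r₁, hr₁, hk₁⟩ := key R h.pos
  -- Points of the smaller ball are within `L R'` of `p`, and paths of length less than `3 L R'`
  -- suffice to join them; the total `4 L R'` does not exceed `r₁`.
  set R' := min R (r₁ / (4 * L)) with hR'
  have hR'0 : 0 < R' := lt_min h.pos (by positivity)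
  have hR'R : R' ≤ R := min_le_left _ _
  have hR'r : 4 * L * R' ≤ r₁ := by
    have := min_le_right R (r₁ / (4 * L))
    rw [← hR', le_div_iff₀ (by positivity)] at this
    linarith
  obtain ⟨r₂, hr₂, hk₂⟩ := key R' hR'0
  have hbig : closedBall c R' ⊆ closedBall c R := closedBall_subset_closedBall hR'R
  refine ⟨R', min r₂ (R' / 16 / L), hR'R, hL, lt_min hr₂ (by positivity), ?_,
    fun y hy y' hy' ↦ h.edist_symm_le (hbig hy) (hbig hy'), fun y hy y' hy' ↦ ?_, fun z hz ↦ ?_⟩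
  · calc L * min r₂ (R' / 16 / L) ≤ L * (R' / 16 / L) := by gcongr; exact min_le_right _ _
      _ = R' / 16 := by field_simp
  · have hup := h.edist_symm_le (hbig hy) (hbig hy')
    have hupc := h.edist_symm_le (mem_closedBall_self h.pos.le) (hbig hy)
    rw [hΨc] at hupc
    have hlt : edist ((extChartAt (𝓡 n) p).symm y) ((extChartAt (𝓡 n) p).symm y') <
        ENNReal.ofReal (3 * L * R') := by
      refine hup.trans_lt ?_
      rw [edist_dist, ← ENNReal.ofReal_mul hL0.le]
      refine (ENNReal.ofReal_lt_ofReal_iff (by positivity)).2 ?_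
      rw [mem_closedBall] at hy hy'
      have : dist y y' ≤ 2 * R' := by linarith [dist_triangle_right y y' c]
      nlinarith [mul_pos hL0 hR'0, mul_le_mul_of_nonneg_left this hL0.le]
    have hmain : ∀ t, edist ((extChartAt (𝓡 n) p).symm y) ((extChartAt (𝓡 n) p).symm y') < t →
        t ≤ ENNReal.ofReal (3 * L * R') → edist y y' ≤ ENNReal.ofReal L * t := by
      intro t ht ht'
      rw [IsRiemannianManifold.out (I := 𝓡 n)] at ht
      obtain ⟨γ, h0, h1, hγ, hl⟩ := exists_lt_of_riemannianEDist_lt ht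
      have hstay : ∀ s ∈ Icc (0 : ℝ) 1, γ s ∈ (extChartAt (𝓡 n) p).source ∧
          extChartAt (𝓡 n) p (γ s) ∈ closedBall c R := by
        intro s hs
        have h2 := edist_le_of_pathELength_le hγ le_rfl hs
        rw [h0] at h2
        apply hk₁
        calc edist p (γ s) ≤ edist p ((extChartAt (𝓡 n) p).symm y) +
              edist ((extChartAt (𝓡 n) p).symm y) (γ s) := edist_triangle _ _ _
          _ < ENNReal.ofReal (L * R') + ENNReal.ofReal (3 * L * R') := by
              have h4 : edist p ((extChartAt (𝓡 n) p).symm y) ≤ ENNReal.ofReal (L * R') := by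
                refine hupc.trans ?_
                rw [edist_dist, ← ENNReal.ofReal_mul hL0.le, dist_comm]
                gcongr
                exact hy
              exact ENNReal.add_lt_add_of_le_of_lt (ne_top_of_le_ne_top ENNReal.ofReal_ne_top h4)
                h4 (h2.trans_lt (hl.trans_le ht'))
          _ ≤ ENNReal.ofReal r₁ := by
              rw [← ENNReal.ofReal_add (by positivity) (by positivity)]
              exact ENNReal.ofReal_le_ofReal (by linarith)
      have h3 := h.edist_extChartAt_le hγ hstay
      rw [h0, h1, (extChartAt (𝓡 n) p).right_inv (h.subset_target (hbig hy)),
        (extChartAt (𝓡 n) p).right_inv (h.subset_target (hbig hy'))] at h3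
      exact h3.trans (by gcongr)
    have hL' : ENNReal.ofReal L ≠ 0 := (ENNReal.ofReal_pos.2 hL0).ne'
    rw [mul_comm, ← ENNReal.div_le_iff hL' ENNReal.ofReal_ne_top]
    refine le_of_forall_gt_imp_ge_of_dense fun t ht ↦ ?_
    rw [ENNReal.div_le_iff hL' ENNReal.ofReal_ne_top, mul_comm]
    exact (hmain (min t (ENNReal.ofReal (3 * L * R'))) (lt_min ht hlt) (min_le_right _ _)).trans
      (by gcongr; exact min_le_left _ _)
  · rw [hΨc] at hz
    have h1 := hk₂ z (hz.trans_le (ENNReal.ofReal_le_ofReal (min_le_left _ _)))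
    exact ⟨_, h1.2, (extChartAt (𝓡 n) p).left_inv h1.1⟩

end Bilipschitz

/-! ### Existence of midpoints. -/

section Midpoints

/-- On an almost minimal path the distance to `x` takes the value `edist x y / 2` by continuity; the
length left over bounds the distance to `y`. -/
theorem exists_approx_midpoint (n : ℕ) {M : Type*} [EMetricSpace M]
    [ChartedSpace (EuclideanSpace ℝ (Fin n)) M]
    [RiemannianBundle (fun x : M ↦ TangentSpace (𝓡 n) x)] [IsRiemannianManifold (𝓡 n) M]
    {x y : M} (hxy : edist x y ≠ ⊤) {ε : ℝ≥0∞} (hε : ε ≠ 0) :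
    ∃ m : M, edist m x = edist x y / 2 ∧ edist m y ≤ edist x y / 2 + ε := by
  have hlt : riemannianEDist (𝓡 n) x y < edist x y + ε := by
    rw [← IsRiemannianManifold.out (I := 𝓡 n)]
    exact ENNReal.lt_add_right hxy hε
  obtain ⟨γ, h0, h1, hγ, hl⟩ := exists_lt_of_riemannianEDist_lt hlt
  have hc : ContinuousOn (fun t ↦ edist (γ t) x) (Icc 0 1) := fun t ht ↦
    (hγ.continuousOn t ht).edist continuousWithinAt_const
  have hmem : edist x y / 2 ∈ Icc (edist (γ 0) x) (edist (γ 1) x) := by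
    rw [h0, h1, edist_self, edist_comm y x]
    exact ⟨zero_le, ENNReal.half_le_self⟩
  obtain ⟨t, ht, hmt⟩ := intermediate_value_Icc zero_le_one hc hmem
  refine ⟨γ t, hmt, ?_⟩
  have h2 : edist (γ t) x + edist (γ t) y ≤ edist x y + ε := by
    refine le_trans ?_ hl.le
    rw [← pathELength_add ht.1 ht.2]
    gcongr
    · rw [← h0, edist_comm]
      exact edist_le_pathELength hγ le_rfl ht.1 ht.2
    · rw [← h1]
      exact edist_le_pathELength hγ ht.1 ht.2 le_rfl
  have h3 : edist (γ t) x = edist x y / 2 := hmt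
  rw [h3] at h2
  nth_rewrite 2 [← ENNReal.add_halves (edist x y)] at h2
  rw [add_assoc] at h2
  exact (ENNReal.add_le_add_iff_left (ENNReal.div_lt_top hxy (by norm_num)).ne).1 h2

/-- By compactness the distance to `y` attains its minimum on the sphere of radius `edist x y / 2`
around `x`; approximate midpoints and the triangle inequality identify the minimum. -/
theorem hasMidpoints (n : ℕ) {M : Type*} [EMetricSpace M]
    [ChartedSpace (EuclideanSpace ℝ (Fin n)) M]
    [RiemannianBundle (fun x : M ↦ TangentSpace (𝓡 n) x)] [IsRiemannianManifold (𝓡 n) M] [CompactSpace M] : HasMidpoints M := by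
  intro x y hxy
  have hcl : IsClosed {m : M | edist m x = edist x y / 2} :=
    isClosed_eq (continuous_id.edist continuous_const) continuous_const
  obtain ⟨m₀, hm₀, -⟩ := exists_approx_midpoint n hxy one_ne_zero
  obtain ⟨m, hm, hmin⟩ := hcl.isCompact.exists_isMinOn ⟨m₀, hm₀⟩
    (continuous_id.edist continuous_const : Continuous fun m : M ↦ edist m y).continuousOn
  have hm' : edist m x = edist x y / 2 := hm
  have hfin : edist x y / 2 ≠ ⊤ := (ENNReal.div_lt_top hxy (by norm_num)).ne
  refine ⟨m, hm, le_antisymm ?_ ?_⟩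
  · refine ENNReal.le_of_forall_pos_le_add fun ε hε _ ↦ ?_
    obtain ⟨m₁, hm₁, hm₁'⟩ := exists_approx_midpoint n hxy (ε := ε) (by simpa using hε.ne')
    exact (hmin hm₁).trans hm₁'
  · have h1 : edist x y ≤ edist m x + edist m y := by
      rw [edist_comm m x]
      exact edist_triangle _ _ _
    rw [hm'] at h1
    nth_rewrite 1 [← ENNReal.add_halves (edist x y)] at h1
    exact (ENNReal.add_le_add_iff_left hfin).1 h1

end Midpoints

theorem isContinuousRiemannianBundle_of_contMDiff {n : ℕ} {M : Type*} [TopologicalSpace M]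
    [ChartedSpace (EuclideanSpace ℝ (Fin n)) M] [IsManifold (𝓡 n) ∞ M]
    [RiemannianBundle (fun x : M ↦ TangentSpace (𝓡 n) x)]
    [h : IsContMDiffRiemannianBundle (𝓡 n) ∞ (EuclideanSpace ℝ (Fin n))
      (fun x : M ↦ TangentSpace (𝓡 n) x)] :
    IsContinuousRiemannianBundle (EuclideanSpace ℝ (Fin n))
      (fun x : M ↦ TangentSpace (𝓡 n) x) := by
  obtain ⟨g, hg, hg'⟩ := h.exists_contMDiff
  exact ⟨g, hg.continuous, hg'⟩

/-! ### Gram determinants. -/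

section Gram

variable {n : ℕ} {V : Type*} [NormedAddCommGroup V] [InnerProductSpace ℝ V]

/-- The Gram matrix of the images of the standard basis vectors. -/
def gramMatrix (A : EuclideanSpace ℝ (Fin n) →ₗ[ℝ] V) : Matrix (Fin n) (Fin n) ℝ :=
  Matrix.of fun i j ↦ inner ℝ (A (EuclideanSpace.single i 1)) (A (EuclideanSpace.single j 1))

lemma map_eq_sum_smul_single (A : EuclideanSpace ℝ (Fin n) →ₗ[ℝ] V)
    (v : EuclideanSpace ℝ (Fin n)) : A v = ∑ i, v i • A (EuclideanSpace.single i 1) := by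
  conv_lhs => rw [← (EuclideanSpace.basisFun (Fin n) ℝ).sum_repr v]
  simp [map_sum]

lemma isHermitian_gramMatrix (A : EuclideanSpace ℝ (Fin n) →ₗ[ℝ] V) :
    (gramMatrix A).IsHermitian := by
  ext i j
  simp [gramMatrix, real_inner_comm]

lemma dotProduct_gramMatrix_mulVec (A : EuclideanSpace ℝ (Fin n) →ₗ[ℝ] V)
    (v : EuclideanSpace ℝ (Fin n)) :
    v.ofLp ⬝ᵥ (gramMatrix A).mulVec v.ofLp = ‖A v‖ ^ 2 := by
  rw [← real_inner_self_eq_norm_sq, map_eq_sum_smul_single A v, sum_inner]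
  simp only [inner_sum, real_inner_smul_left, real_inner_smul_right, dotProduct, Matrix.mulVec,
    gramMatrix, Matrix.of_apply, Finset.mul_sum]
  refine Finset.sum_congr rfl fun i _ ↦ Finset.sum_congr rfl fun j _ ↦ ?_
  ring

/-- In an orthonormal eigenbasis the eigenvalues are the squares `‖A e_i‖^2`, so the root of the
determinant is a product of `n` numbers, each between `1 / L` and `L`. -/
lemma sqrt_det_gramMatrix_mem (A : EuclideanSpace ℝ (Fin n) →ₗ[ℝ] V) {L : ℝ}
    (h1 : ∀ v, ‖A v‖ ≤ L * ‖v‖) (h2 : ∀ v, ‖v‖ ≤ L * ‖A v‖) :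
    √(gramMatrix A).det ≤ L ^ n ∧ 1 ≤ L ^ n * √(gramMatrix A).det := by
  have hA := isHermitian_gramMatrix A
  have hev : ∀ i, hA.eigenvalues i = ‖A (hA.eigenvectorBasis i)‖ ^ 2 := fun i ↦ by
    rw [hA.eigenvalues_eq, ← dotProduct_gramMatrix_mulVec]
    simp
  have hdet : √(gramMatrix A).det = ∏ i, ‖A (hA.eigenvectorBasis i)‖ := by
    rw [hA.det_eq_prod_eigenvalues]
    simp only [hev, Finset.prod_pow, RCLike.ofReal_real_eq_id, id]
    exact Real.sqrt_sq (Finset.prod_nonneg fun _ _ ↦ norm_nonneg _)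
  have hone : ∀ i, ‖hA.eigenvectorBasis i‖ = 1 := fun i ↦ hA.eigenvectorBasis.orthonormal.1 i
  rw [hdet]
  constructor
  · calc ∏ i, ‖A (hA.eigenvectorBasis i)‖ ≤ ∏ _i : Fin n, L :=
          Finset.prod_le_prod (fun _ _ ↦ norm_nonneg _) fun i _ ↦ by
            simpa [hone] using h1 (hA.eigenvectorBasis i)
      _ = L ^ n := by simp
  · calc (1 : ℝ) = ∏ _i : Fin n, 1 := by simp
      _ ≤ ∏ i, (L * ‖A (hA.eigenvectorBasis i)‖) :=
          Finset.prod_le_prod (fun _ _ ↦ zero_le_one) fun i _ ↦ by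
            simpa [hone] using h2 (hA.eigenvectorBasis i)
      _ = _ := by simp [Finset.prod_mul_distrib]

/-- The Gram matrix transforms as a bilinear form, by `Jᵀ G J`, so its determinant picks up the
square of `det J`. -/
lemma sqrt_det_gramMatrix_comp (A : EuclideanSpace ℝ (Fin n) →ₗ[ℝ] V)
    (J : EuclideanSpace ℝ (Fin n) →ₗ[ℝ] EuclideanSpace ℝ (Fin n)) :
    √(gramMatrix (A ∘ₗ J)).det = |LinearMap.det J| * √(gramMatrix A).det := by
  let b := (EuclideanSpace.basisFun (Fin n) ℝ).toBasis
  have hb : ∀ i, b i = EuclideanSpace.single i 1 := fun i ↦ by simp [b]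
  have h : gramMatrix (A ∘ₗ J) =
      (LinearMap.toMatrix b b J).transpose * gramMatrix A * LinearMap.toMatrix b b J := by
    ext i j
    simp only [gramMatrix, Matrix.of_apply, LinearMap.comp_apply]
    rw [map_eq_sum_smul_single A (J (EuclideanSpace.single i 1)),
      map_eq_sum_smul_single A (J (EuclideanSpace.single j 1)), sum_inner]
    simp only [inner_sum, real_inner_smul_left, real_inner_smul_right, Matrix.mul_apply,
      Matrix.transpose_apply, LinearMap.toMatrix_apply, Matrix.of_apply, hb, Finset.sum_mul]
    rw [Finset.sum_comm]
    refine Finset.sum_congr rfl fun k _ ↦ Finset.sum_congr rfl fun l _ ↦ ?_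
    simp [b]
    ring
  rw [h, Matrix.det_mul, Matrix.det_mul, Matrix.det_transpose, LinearMap.det_toMatrix,
    mul_right_comm, ← sq, Real.sqrt_mul (sq_nonneg _), Real.sqrt_sq_eq_abs]

end Gram

/-! ### Transition maps. -/

section Transition

variable {n : ℕ} {M : Type*} [TopologicalSpace M] [ChartedSpace (EuclideanSpace ℝ (Fin n)) M]
  [IsManifold (𝓡 n) ∞ M]

theorem chartFrame_chartCoframe (p : M) {x : M}
    (hx : x ∈ (extChartAt (𝓡 n) p).source) (v : TangentSpace (𝓡 n) x) :
    (chartFrame p (extChartAt (𝓡 n) p x) (chartCoframe p x v) : EuclideanSpace ℝ (Fin n)) = v := by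
  rw [chartFrame_eq_mfderivWithin]
  exact congr($(mfderivWithin_extChartAt_symm_comp_mfderiv_extChartAt' hx) v)

/-- The differential of the transition map from the chart at `x₀` to the chart at `x₁`. -/
def transitionDeriv (x₀ x₁ : M) (y : EuclideanSpace ℝ (Fin n)) :
    EuclideanSpace ℝ (Fin n) →L[ℝ] EuclideanSpace ℝ (Fin n) :=
  chartCoframe x₁ ((extChartAt (𝓡 n) x₀).symm y) ∘L chartFrame x₀ y

lemma hasFDerivAt_transition {x₀ x₁ : M} {y : EuclideanSpace ℝ (Fin n)}
    (hy : y ∈ (extChartAt (𝓡 n) x₀).target)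
    (hy' : (extChartAt (𝓡 n) x₀).symm y ∈ (extChartAt (𝓡 n) x₁).source) :
    HasFDerivAt (extChartAt (𝓡 n) x₁ ∘ (extChartAt (𝓡 n) x₀).symm) (transitionDeriv x₀ x₁ y) y := by
  refine hasMFDerivAt_iff_hasFDerivAt.1 ?_
  refine HasMFDerivAt.comp (I' := 𝓡 n) y (MDifferentiableAt.hasMFDerivAt ?_)
    (MDifferentiableAt.hasMFDerivAt ?_)
  · exact mdifferentiableAt_extChartAt (by simpa [extChartAt_source] using hy')
  · have := mdifferentiableWithinAt_extChartAt_symm hy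
    rwa [ModelWithCorners.Boundaryless.range_eq_univ, mdifferentiableWithinAt_univ] at this

end Transition

/-! ### The volume density under a change of chart. -/

section ChartVolume

variable {n : ℕ} {M : Type*} [TopologicalSpace M] [ChartedSpace (EuclideanSpace ℝ (Fin n)) M]
  [RiemannianBundle (fun x : M ↦ TangentSpace (𝓡 n) x)]

lemma metricMatrix_eq_gramMatrix (x₀ : M) (y : EuclideanSpace ℝ (Fin n)) :
    metricMatrix x₀ y = gramMatrix (chartFrame x₀ y).toLinearMap := rfl

/-- All tangent spaces are copies of `ℝⁿ`, but their inner products depend on the base point; equal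
base points allow the comparison. -/
lemma gramMatrix_congr {x x' : M} (h : x = x')
    (A : EuclideanSpace ℝ (Fin n) →ₗ[ℝ] TangentSpace (𝓡 n) x)
    (A' : EuclideanSpace ℝ (Fin n) →ₗ[ℝ] TangentSpace (𝓡 n) x')
    (hA : ∀ v, (A v : EuclideanSpace ℝ (Fin n)) = A' v) : gramMatrix A = gramMatrix A' := by
  subst h
  congr 1
  ext1 v
  exact hA v

variable [IsManifold (𝓡 n) ∞ M]

lemma sqrt_det_metricMatrix_transition {x₀ x₁ : M} {y : EuclideanSpace ℝ (Fin n)}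
    (hy' : (extChartAt (𝓡 n) x₀).symm y ∈ (extChartAt (𝓡 n) x₁).source) :
    √(metricMatrix x₀ y).det = |(transitionDeriv x₀ x₁ y).det| *
      √(metricMatrix x₁ (extChartAt (𝓡 n) x₁ ((extChartAt (𝓡 n) x₀).symm y))).det := by
  rw [metricMatrix_eq_gramMatrix, metricMatrix_eq_gramMatrix, ContinuousLinearMap.det,
    ← sqrt_det_gramMatrix_comp]
  congr 2
  refine gramMatrix_congr ((extChartAt (𝓡 n) x₁).left_inv hy').symm _ _ fun v ↦ ?_
  exact (chartFrame_chartCoframe x₁ hy' _).symm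

lemma ChartBounds.sqrt_det_mem {p : M} {R L : ℝ}
    (h : ChartBounds (n := n) p R L)
    {y : EuclideanSpace ℝ (Fin n)}
    (hy : y ∈ closedBall (extChartAt (𝓡 n) p p) R) :
    √(metricMatrix p y).det ≤ L ^ n ∧ 1 ≤ L ^ n * √(metricMatrix p y).det :=
  sqrt_det_gramMatrix_mem _ (h.norm_le y hy) (h.le_norm hy)

end ChartVolume

/-! ### Riemannian volume in a chart. -/

section Volume

lemma measurableSet_inter_preimage_of_continuousOn {X Y : Type*} [TopologicalSpace X]
    [MeasurableSpace X] [BorelSpace X] [TopologicalSpace Y] [MeasurableSpace Y] [BorelSpace Y]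
    {f : X → Y} {s : Set X} {t : Set Y} (hf : ContinuousOn f s) (hs : MeasurableSet s)
    (ht : MeasurableSet t) : MeasurableSet (s ∩ f ⁻¹' t) := by
  have h1 : MeasurableSet (s.domRestrict f ⁻¹' t) := hf.domRestrict.measurable ht
  convert hs.subtype_image h1 using 1
  ext x
  simp [Set.domRestrict, and_comm]

variable {n : ℕ} {M : Type*} [TopologicalSpace M] [ChartedSpace (EuclideanSpace ℝ (Fin n)) M]
  [RiemannianBundle (fun x : M ↦ TangentSpace (𝓡 n) x)]
  [MeasurableSpace M] [BorelSpace M]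

lemma chartVolume_apply (x₀ : M) {S : Set M} (hS : MeasurableSet S) :
    chartVolume (n := n) x₀ S =
      ∫⁻ y in (extChartAt (𝓡 n) x₀).target ∩ (extChartAt (𝓡 n) x₀).symm ⁻¹' S,
        ENNReal.ofReal √(metricMatrix x₀ y).det := by
  have hc := continuousOn_extChartAt_symm (I := 𝓡 n) x₀
  have ht : MeasurableSet (extChartAt (𝓡 n) x₀).target :=
    (isOpen_extChartAt_target (I := 𝓡 n) x₀).measurableSet
  have hA := measurableSet_inter_preimage_of_continuousOn hc ht hS
  set A := (extChartAt (𝓡 n) x₀).target ∩ (extChartAt (𝓡 n) x₀).symm ⁻¹' S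
  set ρ : EuclideanSpace ℝ (Fin n) → ℝ≥0∞ := fun y ↦ ENNReal.ofReal √(metricMatrix x₀ y).det
  rw [chartVolume, Measure.map_apply_of_aemeasurable
    ((hc.aemeasurable ht).mono_ac (withDensity_absolutelyContinuous _ _)) hS]
  have h0 : ((volume.restrict (extChartAt (𝓡 n) x₀).target).withDensity ρ)
      (extChartAt (𝓡 n) x₀).targetᶜ = 0 := by
    refine withDensity_absolutelyContinuous _ _ ?_
    rw [Measure.restrict_apply ht.compl]
    simp
  rw [← measure_inter_conull' (t := (extChartAt (𝓡 n) x₀).target), inter_comm,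
    withDensity_apply _ hA, Measure.restrict_restrict hA]
  · congr 2
    exact inter_eq_self_of_subset_left inter_subset_left
  · exact measure_mono_null (fun x hx ↦ hx.2) h0

lemma chartVolume_compl_source (x₀ : M) :
    chartVolume (n := n) x₀ (extChartAt (𝓡 n) x₀).sourceᶜ = 0 := by
  rw [chartVolume_apply x₀ (isOpen_extChartAt_source (I := 𝓡 n) x₀).measurableSet.compl]
  have : (extChartAt (𝓡 n) x₀).target ∩
      (extChartAt (𝓡 n) x₀).symm ⁻¹' (extChartAt (𝓡 n) x₀).sourceᶜ = ∅ := by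
    ext y
    simp only [mem_inter_iff, mem_preimage, mem_compl_iff, mem_empty_iff_false, iff_false, not_and,
      not_not]
    exact fun hy ↦ (extChartAt (𝓡 n) x₀).map_target hy
  rw [this]
  simp

variable {p : M} {R L : ℝ}

lemma ChartBounds.measurableSet_image (h : ChartBounds (n := n) p R L)
    {A : Set (EuclideanSpace ℝ (Fin n))} (hA : MeasurableSet A)
    (hAR : A ⊆ closedBall (extChartAt (𝓡 n) p p) R) :
    MeasurableSet ((extChartAt (𝓡 n) p).symm '' A) := by
  rw [PartialEquiv.symm_image_eq_source_inter_preimage _ (hAR.trans h.subset_target)]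
  exact measurableSet_inter_preimage_of_continuousOn (continuousOn_extChartAt p)
    (isOpen_extChartAt_source (I := 𝓡 n) p).measurableSet hA

variable [IsManifold (𝓡 n) ∞ M]

/-- The change of variables formula for the transition map, whose Jacobian is exactly the factor
between the two densities. -/
lemma chartVolume_congr (x₀ x₁ : M) {S : Set M} (hS : MeasurableSet S)
    (h₀ : S ⊆ (extChartAt (𝓡 n) x₀).source) (h₁ : S ⊆ (extChartAt (𝓡 n) x₁).source) :
    chartVolume (n := n) x₀ S = chartVolume (n := n) x₁ S := by
  rw [chartVolume_apply x₀ hS, chartVolume_apply x₁ hS]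
  have hA := measurableSet_inter_preimage_of_continuousOn
    (continuousOn_extChartAt_symm (I := 𝓡 n) x₀)
    (isOpen_extChartAt_target (I := 𝓡 n) x₀).measurableSet hS
  have himg : (extChartAt (𝓡 n) x₁).target ∩ (extChartAt (𝓡 n) x₁).symm ⁻¹' S =
      (extChartAt (𝓡 n) x₁ ∘ (extChartAt (𝓡 n) x₀).symm) ''
        ((extChartAt (𝓡 n) x₀).target ∩ (extChartAt (𝓡 n) x₀).symm ⁻¹' S) := by
    ext z
    constructor
    · rintro ⟨hz, hzS⟩
      refine ⟨extChartAt (𝓡 n) x₀ ((extChartAt (𝓡 n) x₁).symm z),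
        ⟨(extChartAt (𝓡 n) x₀).map_source (h₀ hzS), ?_⟩, ?_⟩
      · rw [mem_preimage, (extChartAt (𝓡 n) x₀).left_inv (h₀ hzS)]
        exact hzS
      · rw [Function.comp_apply, (extChartAt (𝓡 n) x₀).left_inv (h₀ hzS),
          (extChartAt (𝓡 n) x₁).right_inv hz]
    · rintro ⟨y, ⟨hy, hyS⟩, rfl⟩
      refine ⟨(extChartAt (𝓡 n) x₁).map_source (h₁ hyS), ?_⟩
      rw [mem_preimage, Function.comp_apply, (extChartAt (𝓡 n) x₁).left_inv (h₁ hyS)]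
      exact hyS
  have hinj : InjOn (extChartAt (𝓡 n) x₁ ∘ (extChartAt (𝓡 n) x₀).symm)
      ((extChartAt (𝓡 n) x₀).target ∩ (extChartAt (𝓡 n) x₀).symm ⁻¹' S) :=
    (extChartAt (𝓡 n) x₁).injOn.comp ((extChartAt (𝓡 n) x₀).symm.injOn.mono inter_subset_left)
      fun y hy ↦ h₁ hy.2
  rw [himg, lintegral_image_eq_lintegral_abs_det_fderiv_mul volume hA
    (fun y hy ↦ (hasFDerivAt_transition hy.1 (h₁ hy.2)).hasFDerivWithinAt) hinj]
  refine setLIntegral_congr_fun hA fun y hy ↦ ?_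
  simp only [Function.comp_apply]
  rw [sqrt_det_metricMatrix_transition (h₁ hy.2), ENNReal.ofReal_mul (abs_nonneg _)]

/-- The Riemannian volume coincides with the chart volume on the chart domain. -/
theorem riemannianVolume_apply (x₁ : M) {S : Set M} (hS : MeasurableSet S)
    (h₁ : S ⊆ (extChartAt (𝓡 n) x₁).source) :
    riemannianVolume n M S = chartVolume (n := n) x₁ S := by
  refine le_antisymm ?_ (le_iSup (fun x₀ : M ↦ chartVolume (n := n) x₀) x₁ S)
  have hs₁ : MeasurableSet (extChartAt (𝓡 n) x₁).source :=
    (isOpen_extChartAt_source (I := 𝓡 n) x₁).measurableSet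
  -- A supremum of measures is not computed set by set, so a common upper bound is exhibited: the
  -- chart volume on the chart domain, and the largest measure outside of it.
  have hle : riemannianVolume n M ≤
      chartVolume (n := n) x₁ + (⊤ : Measure M).restrict (extChartAt (𝓡 n) x₁).sourceᶜ := by
    refine iSup_le fun x₀ ↦ Measure.le_iff.2 fun T hT ↦ ?_
    rw [Measure.add_apply, Measure.restrict_apply hT, ← measure_inter_add_sdiff T hs₁]
    refine add_le_add ?_ ?_
    · have hs₀ : MeasurableSet (extChartAt (𝓡 n) x₀).source :=
        (isOpen_extChartAt_source (I := 𝓡 n) x₀).measurableSet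
      rw [← measure_inter_conull' (t := (extChartAt (𝓡 n) x₀).source)
        (measure_mono_null (fun x hx ↦ hx.2) (chartVolume_compl_source x₀)),
        chartVolume_congr x₀ x₁ ((hT.inter hs₁).inter hs₀) inter_subset_right
          (inter_subset_left.trans inter_subset_right)]
      exact measure_mono (inter_subset_left.trans inter_subset_left)
    · exact (le_top : chartVolume (n := n) x₀ ≤ ⊤) _
  refine (hle S).trans_eq ?_
  rw [Measure.add_apply, Measure.restrict_apply hS]
  have : S ∩ (extChartAt (𝓡 n) x₁).sourceᶜ = ∅ := by
    rw [← sdiff_eq, sdiff_eq_empty]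
    exact h₁
  rw [this, measure_empty, add_zero]

lemma ChartBounds.riemannianVolume_image (h : ChartBounds (n := n) p R L)
    {A : Set (EuclideanSpace ℝ (Fin n))} (hA : MeasurableSet A)
    (hAR : A ⊆ closedBall (extChartAt (𝓡 n) p p) R) :
    riemannianVolume n M ((extChartAt (𝓡 n) p).symm '' A) =
      ∫⁻ y in A, ENNReal.ofReal √(metricMatrix p y).det := by
  have hAt := hAR.trans h.subset_target
  have hsub : (extChartAt (𝓡 n) p).symm '' A ⊆ (extChartAt (𝓡 n) p).source := by
    rintro _ ⟨y, hy, rfl⟩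
    exact (extChartAt (𝓡 n) p).map_target (hAt hy)
  rw [riemannianVolume_apply p (h.measurableSet_image hA hAR) hsub,
    chartVolume_apply p (h.measurableSet_image hA hAR)]
  congr 2
  ext y
  constructor
  · rintro ⟨hy, y', hy', he⟩
    rwa [← (extChartAt (𝓡 n) p).symm.injOn (hAt hy') hy he]
  · exact fun hy ↦ ⟨hAt hy, y, hy, rfl⟩

lemma ChartBounds.riemannianVolume_image_le (h : ChartBounds (n := n) p R L)
    {A : Set (EuclideanSpace ℝ (Fin n))} (hA : MeasurableSet A)
    (hAR : A ⊆ closedBall (extChartAt (𝓡 n) p p) R) :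
    riemannianVolume n M ((extChartAt (𝓡 n) p).symm '' A) ≤
      ENNReal.ofReal (L ^ n) * volume A := by
  rw [h.riemannianVolume_image hA hAR, ← setLIntegral_const]
  exact setLIntegral_mono' hA fun y hy ↦ ENNReal.ofReal_le_ofReal (h.sqrt_det_mem (hAR hy)).1

lemma ChartBounds.volume_le (h : ChartBounds (n := n) p R L)
    {A : Set (EuclideanSpace ℝ (Fin n))} (hA : MeasurableSet A)
    (hAR : A ⊆ closedBall (extChartAt (𝓡 n) p p) R) :
    volume A ≤ ENNReal.ofReal (L ^ n) *
      riemannianVolume n M ((extChartAt (𝓡 n) p).symm '' A) := by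
  rw [h.riemannianVolume_image hA hAR, ← lintegral_const_mul' _ _ ENNReal.ofReal_ne_top,
    ← setLIntegral_one]
  refine setLIntegral_mono' hA fun y hy ↦ ?_
  have hL : 0 ≤ L := by linarith [h.one_le]
  rw [← ENNReal.ofReal_mul (by positivity), ← ENNReal.ofReal_one]
  exact ENNReal.ofReal_le_ofReal (h.sqrt_det_mem (hAR hy)).2

/-- The function `g` is not assumed measurable. The measures are therefore compared on sets, the
larger side being a pushforward, for which `lintegral_map_le` holds without measurability. -/
theorem ChartBounds.setLIntegral_image_le (h : ChartBounds (n := n) p R L)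
    {A : Set (EuclideanSpace ℝ (Fin n))} (hA : MeasurableSet A)
    (hAR : A ⊆ closedBall (extChartAt (𝓡 n) p p) R) (g : M → ℝ≥0∞) :
    ∫⁻ x in (extChartAt (𝓡 n) p).symm '' A, g x ∂riemannianVolume n M ≤
      ENNReal.ofReal (L ^ n) * ∫⁻ y in A, g ((extChartAt (𝓡 n) p).symm y) := by
  have hAt := hAR.trans h.subset_target
  have hc : ContinuousOn (extChartAt (𝓡 n) p).symm A :=
    (continuousOn_extChartAt_symm (I := 𝓡 n) p).mono hAt
  have hle : (riemannianVolume n M).restrict ((extChartAt (𝓡 n) p).symm '' A) ≤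
      ENNReal.ofReal (L ^ n) • (volume.restrict A).map (extChartAt (𝓡 n) p).symm := by
    refine Measure.le_iff.2 fun T hT ↦ ?_
    have hB := measurableSet_inter_preimage_of_continuousOn hc hA hT
    rw [Measure.restrict_apply hT, Measure.smul_apply, smul_eq_mul,
      Measure.map_apply_of_aemeasurable (hc.aemeasurable hA) hT, Measure.restrict_apply' hA,
      inter_comm, ← image_inter_preimage, inter_comm _ A]
    exact h.riemannianVolume_image_le hB (inter_subset_left.trans hAR)
  refine (lintegral_mono' hle le_rfl).trans ?_
  rw [lintegral_smul_measure, smul_eq_mul]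
  gcongr
  exact lintegral_map_le _ _

theorem ChartBounds.setLIntegral_le_image (h : ChartBounds (n := n) p R L)
    {A : Set (EuclideanSpace ℝ (Fin n))} (hA : MeasurableSet A)
    (hAR : A ⊆ closedBall (extChartAt (𝓡 n) p p) R) (g : M → ℝ≥0∞) :
    ∫⁻ y in A, g ((extChartAt (𝓡 n) p).symm y) ≤
      ENNReal.ofReal (L ^ n) *
        ∫⁻ x in (extChartAt (𝓡 n) p).symm '' A, g x ∂riemannianVolume n M := by
  have hAt := hAR.trans h.subset_target
  have hS := h.measurableSet_image hA hAR
  have hsub : (extChartAt (𝓡 n) p).symm '' A ⊆ (extChartAt (𝓡 n) p).source := by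
    rintro _ ⟨y, hy, rfl⟩
    exact (extChartAt (𝓡 n) p).map_target (hAt hy)
  have hc : ContinuousOn (extChartAt (𝓡 n) p) ((extChartAt (𝓡 n) p).symm '' A) :=
    (continuousOn_extChartAt (I := 𝓡 n) p).mono hsub
  have hle : volume.restrict A ≤ ENNReal.ofReal (L ^ n) •
      ((riemannianVolume n M).restrict ((extChartAt (𝓡 n) p).symm '' A)).map
        (extChartAt (𝓡 n) p) := by
    refine Measure.le_iff.2 fun B hB ↦ ?_
    rw [Measure.restrict_apply hB, Measure.smul_apply, smul_eq_mul,
      Measure.map_apply_of_aemeasurable (hc.aemeasurable hS) hB, Measure.restrict_apply' hS]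
    refine (h.volume_le (hB.inter hA) (inter_subset_right.trans hAR)).trans ?_
    gcongr
    rintro _ ⟨y, hy, rfl⟩
    refine ⟨?_, mem_image_of_mem _ hy.2⟩
    rw [mem_preimage, (extChartAt (𝓡 n) p).right_inv (hAt hy.2)]
    exact hy.1
  refine (lintegral_mono' hle le_rfl).trans ?_
  rw [lintegral_smul_measure, smul_eq_mul]
  gcongr
  refine (lintegral_map_le _ _).trans_eq (setLIntegral_congr_fun hS fun x hx ↦ ?_)
  simp only [(extChartAt (𝓡 n) p).left_inv (hsub hx)]

end Volume

/-! ### Energy bounds in a chart. -/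

section LocalModel

variable {n : ℕ} {M : Type*} [TopologicalSpace M] [ChartedSpace (EuclideanSpace ℝ (Fin n)) M]

/-- The components of the covector field `α` in the preferred chart at `p`. -/
def chartComponent (p : M) (α : (x : M) → TangentSpace (𝓡 n) x →L[ℝ] ℝ) (i : Fin n)
    (y : EuclideanSpace ℝ (Fin n)) : ℝ :=
  α ((extChartAt (𝓡 n) p).symm y) (chartFrame p y (EuclideanSpace.single i 1))

lemma HasWeakDifferential.hasWeakPartials {f : M → ℝ} {α : (x : M) → TangentSpace (𝓡 n) x →L[ℝ] ℝ}
    (h : HasWeakDifferential f α) (p : M) {Ω : Set (EuclideanSpace ℝ (Fin n))}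
    (hΩ : Ω ⊆ (extChartAt (𝓡 n) p).target) :
    HasWeakPartials (fun y ↦ f ((extChartAt (𝓡 n) p).symm y)) (chartComponent p α) Ω where
  locallyIntegrable := (h.locallyIntegrable p).mono_set hΩ
  locallyIntegrable_partial _ := (h.locallyIntegrable_differential p _).mono_set hΩ
  integral_eq _ ψ hψ hc hs := h.integral_eq p _ ψ hψ hc (hs.trans hΩ)

variable [RiemannianBundle (fun x : M ↦ TangentSpace (𝓡 n) x)]

theorem ChartBounds.mono {p : M} {R L R' L' : ℝ} (h : ChartBounds (n := n) p R L) (hR' : 0 < R')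
    (hR : R' ≤ R) (hL : L ≤ L') : ChartBounds (n := n) p R' L' where
  pos := hR'
  one_le := h.one_le.trans hL
  subset_target := (closedBall_subset_closedBall hR).trans h.subset_target
  norm_le y hy v := (h.norm_le y (closedBall_subset_closedBall hR hy) v).trans (by gcongr)
  norm_coframe_le x hx hy v :=
    (h.norm_coframe_le x hx (closedBall_subset_closedBall hR hy) v).trans (by gcongr)

lemma ChartBounds.sum_enorm_chartComponent_le {p : M} {R L : ℝ} (h : ChartBounds (n := n) p R L)
    (α : (x : M) → TangentSpace (𝓡 n) x →L[ℝ] ℝ) {y : EuclideanSpace ℝ (Fin n)}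
    (hy : y ∈ closedBall (extChartAt (𝓡 n) p p) R) :
    ∑ i, ‖chartComponent p α i y‖ₑ ≤
      ENNReal.ofReal (n * L) * ‖α ((extChartAt (𝓡 n) p).symm y)‖ₑ := by
  have hi : ∀ i, ‖chartComponent p α i y‖ₑ ≤
      ENNReal.ofReal L * ‖α ((extChartAt (𝓡 n) p).symm y)‖ₑ := fun i ↦ by
    rw [← ofReal_norm, ← ofReal_norm, ← ENNReal.ofReal_mul (by linarith [h.one_le]), mul_comm]
    refine ENNReal.ofReal_le_ofReal ((ContinuousLinearMap.le_opNorm _ _).trans ?_)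
    gcongr
    simpa using h.norm_le y hy (EuclideanSpace.single i 1)
  refine (Finset.sum_le_sum fun i _ ↦ hi i).trans ?_
  rw [Finset.sum_const, Finset.card_univ, Fintype.card_fin, nsmul_eq_mul, ← mul_assoc,
    ENNReal.ofReal_mul (by positivity), ENNReal.ofReal_natCast]

variable [MeasurableSpace M]

lemma lintegral_enorm_pow_eq (hn : 1 ≤ n) (α : (x : M) → TangentSpace (𝓡 n) x →L[ℝ] ℝ) :
    ∫⁻ x, ‖α x‖ₑ ^ n ∂riemannianVolume n M = covectorLpNorm α ^ n := by
  have hn0 : (n : ℝ) ≠ 0 := by positivity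
  rw [covectorLpNorm, eLpNorm_eq_lintegral_rpow_enorm_toReal (by simp; omega) (by simp),
    ← ENNReal.rpow_natCast _ n, ← ENNReal.rpow_mul]
  have h : ∀ x, ‖‖α x‖‖ₑ = ‖α x‖ₑ := fun x ↦ by
    rw [← ofReal_norm, ← ofReal_norm, Real.norm_of_nonneg (ContinuousLinearMap.opNorm_nonneg _)]
  simp [hn0, h]

variable [BorelSpace M] [IsManifold (𝓡 n) ∞ M]

lemma ChartBounds.energyMeasure_le {p : M} {R L : ℝ} (h : ChartBounds (n := n) p R L)
    (hn : 1 ≤ n) (α : (x : M) → TangentSpace (𝓡 n) x →L[ℝ] ℝ) :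
    energyMeasure (chartComponent p α) (ball (extChartAt (𝓡 n) p p) R) univ ≤
      ENNReal.ofReal (n * L) ^ n * ENNReal.ofReal (L ^ n) * covectorLpNorm α ^ n := by
  have hsub := ball_subset_closedBall (x := extChartAt (𝓡 n) p p) (ε := R)
  rw [energyMeasure, withDensity_apply _ MeasurableSet.univ, Measure.restrict_univ]
  calc ∫⁻ y in ball (extChartAt (𝓡 n) p p) R, (∑ i, ‖chartComponent p α i y‖ₑ) ^ n
      ≤ ∫⁻ y in ball (extChartAt (𝓡 n) p p) R, ENNReal.ofReal (n * L) ^ n *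
          ‖α ((extChartAt (𝓡 n) p).symm y)‖ₑ ^ n := by
        refine setLIntegral_mono' measurableSet_ball fun y hy ↦ ?_
        rw [← mul_pow]
        gcongr
        exact h.sum_enorm_chartComponent_le α (hsub hy)
    _ = ENNReal.ofReal (n * L) ^ n * ∫⁻ y in ball (extChartAt (𝓡 n) p p) R,
          ‖α ((extChartAt (𝓡 n) p).symm y)‖ₑ ^ n :=
        lintegral_const_mul' _ _ (ENNReal.pow_ne_top ENNReal.ofReal_ne_top)
    _ ≤ ENNReal.ofReal (n * L) ^ n * (ENNReal.ofReal (L ^ n) *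
          ∫⁻ x, ‖α x‖ₑ ^ n ∂riemannianVolume n M) := by
        gcongr
        refine (h.setLIntegral_le_image measurableSet_ball hsub fun x ↦ ‖α x‖ₑ ^ n).trans ?_
        gcongr
        exact Measure.restrict_le_self
    _ = _ := by rw [lintegral_enorm_pow_eq hn, mul_assoc]

variable {φ : EuclideanSpace ℝ (Fin n) → ℝ} {B : ℝ}

/-- In a bounded chart, the weights `exp (n f)` with a bound on the energy of `f` are modelled on
functions whose averages are controlled. -/
theorem ChartBounds.exists_weightModel {p : M} {R₀ L R : ℝ} (h : ChartBounds (n := n) p R₀ L)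
    (hn : 1 ≤ n) (hφ : IsAnnularKernel φ B) (hR : 0 < R) (hR₀ : R ≤ R₀) (I : ℝ) :
    ∃ J : ℝ, ∀ (f : M → ℝ) (α : (x : M) → TangentSpace (𝓡 n) x →L[ℝ] ℝ),
      HasWeakDifferential f α → covectorLpNorm α ≤ ENNReal.ofReal I → ∃ ν,
        WeightModel (extChartAt (𝓡 n) p).symm (extChartAt (𝓡 n) p p) R (L ^ n) φ J
          (conformalVolume n f) (fun y ↦ f ((extChartAt (𝓡 n) p).symm y)) ν := by
  have hB : 0 ≤ B := (hφ.nonneg 0).trans (hφ.le 0)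
  replace h := h.mono hR hR₀ le_rfl
  set c := extChartAt (𝓡 n) p p
  set C : ℝ≥0∞ := ENNReal.ofReal (n * L) ^ n * ENNReal.ofReal (L ^ n) * ENNReal.ofReal I ^ n
    with hC
  have hCtop : C ≠ ⊤ := by
    simp only [hC]
    finiteness
  -- `J` is determined by the chart, the kernel and the energy bound `I`, before `f` is chosen.
  refine ⟨max 1 (ENNReal.ofReal (energyConst n B) * C).toReal, fun f α hw hI ↦
    ⟨ENNReal.ofReal (energyConst n B) • energyMeasure (chartComponent p α) (ball c R),
      ?_, ?_, ?_, ?_⟩⟩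
  rotate_left
  · exact (hw.locallyIntegrable p).integrableOn_compact_subset
      ((closedBall_subset_closedBall (by linarith)).trans h.subset_target)
      (isCompact_closedBall _ _)
  · intro A s hA hAR hs
    have hAR' : A ⊆ closedBall c R := hAR.trans (closedBall_subset_closedBall (by linarith))
    refine (measure_mono hs).trans ?_
    rw [conformalVolume, withDensity_apply _ (h.measurableSet_image hA hAR')]
    exact h.setLIntegral_image_le hA hAR' fun x ↦ ENNReal.ofReal (Real.exp (n * f x))
  · intro A s hA hAR hs
    have hAR' : A ⊆ closedBall c R := hAR.trans (closedBall_subset_closedBall (by linarith))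
    refine le_trans ?_ (mul_le_mul_right (measure_mono hs) _)
    rw [conformalVolume, withDensity_apply _ (h.measurableSet_image hA hAR')]
    exact h.setLIntegral_le_image hA hAR' fun x ↦ ENNReal.ofReal (Real.exp (n * f x))
  · have hE : energyMeasure (chartComponent p α) (ball c R) univ ≤ C := by
      refine (h.energyMeasure_le hn α).trans ?_
      rw [hC]
      gcongr
    refine (hw.hasWeakPartials p (ball_subset_closedBall.trans h.subset_target)).scaleControl hn hB
      hφ (le_max_left _ _) ?_ (ne_top_of_le_ne_top hCtop hE) ?_
    · refine ((mul_le_mul_right hE _).trans_eq (ENNReal.ofReal_toReal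
        (ENNReal.mul_ne_top ENNReal.ofReal_ne_top hCtop)).symm).trans ?_
      exact ENNReal.ofReal_le_ofReal (le_max_right _ _)
    · intro x hx z hz
      rw [mem_closedBall] at hx hz
      rw [mem_ball]
      linarith [dist_triangle z x c]

end LocalModel

/-! ### Uniform constants by compactness. -/

section Uniform

variable {n : ℕ} {M : Type*} [EMetricSpace M] [ChartedSpace (EuclideanSpace ℝ (Fin n)) M]
  [RiemannianBundle (fun x : M ↦ TangentSpace (𝓡 n) x)] [MeasurableSpace M]

variable (n) in
/-- Doubling and comparison of the distance with the measure of balls, with constant `K`, at the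
point `x` and at scales at most `η`. -/
structure GoodAt (f : M → ℝ) (d : M → M → ℝ≥0∞) (K η : ℝ) (x : M) : Prop where
  doubling : ∀ ρ : ℝ, 0 < ρ → ρ ≤ η → conformalVolume n f (eball x (ENNReal.ofReal (2 * ρ))) ≤
    ENNReal.ofReal K ^ n * conformalVolume n f (eball x (ENNReal.ofReal ρ))
  lt_top : ∀ ρ : ℝ, 0 < ρ → ρ ≤ η → conformalVolume n f (eball x (ENNReal.ofReal ρ)) < ⊤
  dist_pow_le : ∀ x', edist x x' ≤ ENNReal.ofReal η →
    d x x' ^ n ≤ ENNReal.ofReal K ^ n * conformalVolume n f (eball x (edist x x'))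
  le_dist_pow : ∀ x', edist x x' ≤ ENNReal.ofReal η →
    conformalVolume n f (eball x (edist x x')) ≤ ENNReal.ofReal K ^ n * d x x' ^ n

variable {f : M → ℝ} {d d' : M → M → ℝ≥0∞} {K η : ℝ} {x : M}

lemma GoodAt.mono (h : GoodAt n f d K η x) {K' η' : ℝ} (hK : K ≤ K') (hη : η' ≤ η) :
    GoodAt n f d K' η' x where
  doubling ρ h0 h1 := (h.doubling ρ h0 (h1.trans hη)).trans (by gcongr)
  lt_top ρ h0 h1 := h.lt_top ρ h0 (h1.trans hη)
  dist_pow_le x' hx := (h.dist_pow_le x' (hx.trans (ENNReal.ofReal_le_ofReal hη))).trans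
    (by gcongr)
  le_dist_pow x' hx := (h.le_dist_pow x' (hx.trans (ENNReal.ofReal_le_ofReal hη))).trans
    (by gcongr)

lemma GoodAt.congr (h : GoodAt n f d K η x) {C : ℝ} (hC : 1 ≤ C) (hK : 0 ≤ K)
    (h1 : ∀ x', edist x x' ≤ ENNReal.ofReal η → d' x x' ≤ ENNReal.ofReal C * d x x')
    (h2 : ∀ x', edist x x' ≤ ENNReal.ofReal η → d x x' ≤ ENNReal.ofReal C * d' x x') :
    GoodAt n f d' (C * K) η x where
  doubling ρ h0 h1 := (h.mono (le_mul_of_one_le_left hK hC) le_rfl).doubling ρ h0 h1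
  lt_top := h.lt_top
  dist_pow_le x' hx := by
    calc d' x x' ^ n ≤ (ENNReal.ofReal C * d x x') ^ n := by gcongr; exact h1 x' hx
      _ = ENNReal.ofReal C ^ n * d x x' ^ n := mul_pow _ _ _
      _ ≤ ENNReal.ofReal C ^ n *
          (ENNReal.ofReal K ^ n * conformalVolume n f (eball x (edist x x'))) := by
          gcongr; exact h.dist_pow_le x' hx
      _ = _ := by rw [ENNReal.ofReal_mul (by linarith), mul_pow, mul_assoc]
  le_dist_pow x' hx := by
    calc conformalVolume n f (eball x (edist x x')) ≤ ENNReal.ofReal K ^ n * d x x' ^ n :=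
          h.le_dist_pow x' hx
      _ ≤ ENNReal.ofReal K ^ n * (ENNReal.ofReal C * d' x x') ^ n := by
          gcongr; exact h2 x' hx
      _ = _ := by rw [ENNReal.ofReal_mul (by linarith), mul_pow, mul_pow]; ring

/-- The constant enters doubling to the first power but the distance estimates to the power `n`; the
choice `K^n` serves both. Finite total volume follows from finiteness near each point. -/
theorem isStrongAInftyWeight_of_goodAt [CompactSpace M] (hn : 1 ≤ n) (hη : 0 < η) (hK : 1 ≤ K)
    (h : ∀ x, GoodAt n f d K η x) : IsStrongAInftyWeight n f d (K ^ n) η where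
  volume_lt_top := by
    refine isCompact_univ.measure_lt_top_of_nhdsWithin fun x _ ↦ ?_
    exact ⟨eball x (ENNReal.ofReal η), mem_nhdsWithin_of_mem_nhds
      (eball_mem_nhds x (ENNReal.ofReal_pos.2 hη)), (h x).lt_top η hη le_rfl⟩
  doubling x r hr hrη := by
    rw [ENNReal.ofReal_pow (by linarith)]
    exact (h x).doubling r hr hrη
  distance_le x y hxy := by
    refine ENNReal.div_le_of_le_mul' (((h x).dist_pow_le y hxy).trans ?_)
    gcongr
    exact le_self_pow₀ hK (by omega)
  le_distance x y hxy := by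
    refine ((h x).le_dist_pow y hxy).trans ?_
    gcongr
    exact le_self_pow₀ hK (by omega)

variable [CompactSpace M] [IsManifold (𝓡 n) ∞ M]
  [IsContinuousRiemannianBundle (EuclideanSpace ℝ (Fin n)) (fun x : M ↦ TangentSpace (𝓡 n) x)]
  [IsRiemannianManifold (𝓡 n) M] [BorelSpace M]

theorem exists_goodAt_local (hn : 1 ≤ n) (p : M) :
    ∃ η : ℝ, 0 < η ∧ ∀ I : ℝ, ∃ K : ℝ, 1 ≤ K ∧
      ∀ (f : M → ℝ) (α : (x : M) → TangentSpace (𝓡 n) x →L[ℝ] ℝ),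
        HasWeakDifferential f α → covectorLpNorm α ≤ ENNReal.ofReal I →
          ∀ x, edist p x < ENNReal.ofReal η → GoodAt n f (weightEDist n f) K η x := by
  obtain ⟨φ, B, -, hφ⟩ := exists_isAnnularKernel hn
  obtain ⟨R₀, L, h⟩ := exists_chartBounds (n := n) p
  have hL := h.one_le
  -- The Lipschitz constant is weakened to `L^n`, so that one constant serves distances and volume
  -- densities.
  obtain ⟨R, r, hR, hb⟩ :=
    (h.mono h.pos le_rfl (le_self_pow₀ hL (by omega : n ≠ 0))).exists_bilipschitzChart
  have hr := hb.pos
  have hΨ : (extChartAt (𝓡 n) p).symm (extChartAt (𝓡 n) p p) = p := extChartAt_to_inv p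
  have hD : 1 ≤ (L ^ n) ^ 2 := one_le_pow₀ (one_le_pow₀ hL)
  have hle : r / (16 * (L ^ n) ^ 2) ≤ r / 4 :=
    div_le_div_of_nonneg_left hr.le (by norm_num) (by linarith)
  -- The scale is fixed by the chart before the energy bound `I` is introduced.
  refine ⟨r / (16 * (L ^ n) ^ 2), by positivity, fun I ↦ ?_⟩
  obtain ⟨J, hJ⟩ := h.exists_weightModel hn hφ hb.radius_pos hR I
  obtain ⟨K, hK1, hK⟩ := hb.exists_local_const hφ (hasMidpoints n) J
  refine ⟨K, hK1, fun f α hw hI x hx ↦ ?_⟩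
  obtain ⟨ν, hν⟩ := hJ f α hw hI
  have h1 := hK f _ ν hν x (by
    rw [hΨ]
    exact hx.le.trans (ENNReal.ofReal_le_ofReal hle))
  exact ⟨fun ρ h2 h3 ↦ (h1.1 ρ h2 (h3.trans hle)).1, fun ρ h2 h3 ↦ (h1.1 ρ h2 (h3.trans hle)).2,
    fun x' hx' ↦ (h1.2 x' hx').1, fun x' hx' ↦ (h1.2 x' hx').2⟩

/-- Finitely many of the balls `eball p (η p)` cover, and there is a common lower bound for their
radii. -/
theorem exists_finset_cover {X : Type*} [EMetricSpace X] [CompactSpace X] (η : X → ℝ)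
    (hη : ∀ p, 0 < η p) : ∃ (t : Finset X) (η₀ : ℝ), 0 < η₀ ∧ (∀ p ∈ t, η₀ ≤ η p) ∧
      ∀ x, ∃ p ∈ t, edist p x < ENNReal.ofReal (η p) := by
  classical
  obtain ⟨t, -, ht⟩ := (isCompact_univ (X := X)).elim_nhds_subcover
    (fun p ↦ eball p (ENNReal.ofReal (η p)))
    fun p _ ↦ eball_mem_nhds p (ENNReal.ofReal_pos.2 (hη p))
  -- The common radius is the inverse of a bound for the inverse radii; inserting `1` makes this
  -- bound positive even if `t` is empty.
  obtain ⟨b, hb⟩ := (insert 1 (t.image fun p ↦ (η p)⁻¹)).exists_le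
  have hb1 : 1 ≤ b := hb 1 (by simp)
  refine ⟨t, b⁻¹, by positivity, fun p hp ↦ ?_, fun x ↦ ?_⟩
  · exact inv_le_of_inv_le₀ (hη p)
      (hb _ (Finset.mem_insert_of_mem (Finset.mem_image_of_mem _ hp)))
  · obtain ⟨p, hp, hx⟩ := mem_iUnion₂.1 (ht (mem_univ x))
    exact ⟨p, hp, by rwa [edist_comm]⟩

variable (M) in
theorem exists_goodAt (hn : 1 ≤ n) :
    ∃ η : ℝ, 0 < η ∧ ∀ I : ℝ, ∃ K : ℝ, 1 ≤ K ∧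
      ∀ (f : M → ℝ) (α : (x : M) → TangentSpace (𝓡 n) x →L[ℝ] ℝ),
        HasWeakDifferential f α → covectorLpNorm α ≤ ENNReal.ofReal I →
          ∀ x, GoodAt n f (weightEDist n f) K η x := by
  classical
  choose η hη h using fun p : M ↦ exists_goodAt_local hn p
  obtain ⟨t, η₀, hη₀, hle, hcov⟩ := exists_finset_cover η hη
  refine ⟨η₀, hη₀, fun I ↦ ?_⟩
  choose K hK1 hK using fun p ↦ h p I
  obtain ⟨b, hb⟩ := (insert 1 (t.image K)).exists_le
  refine ⟨b, hb 1 (by simp), fun f α hw hI x ↦ ?_⟩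
  obtain ⟨p, hp, hx⟩ := hcov x
  exact (hK p f α hw hI x hx).mono
    (hb _ (Finset.mem_insert_of_mem (Finset.mem_image_of_mem _ hp))) (hle p hp)

end Uniform

lemma hasWeakDifferential_zero {n : ℕ} {M : Type*} [TopologicalSpace M]
    [ChartedSpace (EuclideanSpace ℝ (Fin n)) M] :
    HasWeakDifferential (n := n) (fun _ : M ↦ (0 : ℝ)) (fun _ ↦ 0) where
  locallyIntegrable _ := locallyIntegrableOn_zero
  locallyIntegrable_differential _ _ :=
    locallyIntegrableOn_zero (μ := volume)
  integral_eq x₀ v ψ _ _ _ := by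
    have h : ∀ y : EuclideanSpace ℝ (Fin n), (0 : TangentSpace (𝓡 n)
        ((extChartAt (𝓡 n) x₀).symm y) →L[ℝ] ℝ) (chartFrame x₀ y v) * ψ y = 0 :=
      fun y ↦ zero_mul _
    simp only [h]
    simp

/-! ### Volume of small balls, and the gauge when `f` oscillates little. -/

section Regularity

variable {n : ℕ} {M : Type*} [EMetricSpace M] [ChartedSpace (EuclideanSpace ℝ (Fin n)) M]
  [RiemannianBundle (fun x : M ↦ TangentSpace (𝓡 n) x)] [MeasurableSpace M]

lemma conformalVolume_zero : conformalVolume n (fun _ : M ↦ (0 : ℝ)) = riemannianVolume n M := by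
  simp [conformalVolume]

lemma covectorLpNorm_zero :
    covectorLpNorm (n := n) (M := M) (fun _ ↦ 0) = 0 := by
  have h : ∀ x : M, ‖(0 : TangentSpace (𝓡 n) x →L[ℝ] ℝ)‖ = 0 := fun x ↦
    ContinuousLinearMap.opNorm_zero
  simp [covectorLpNorm, h]

variable (n) in
/-- The volume of small balls is comparable with the `n`-th power of the radius. -/
structure RegularAt (A ρ₀ : ℝ) (x : M) : Prop where
  volume_le : ∀ ρ : ℝ, 0 < ρ → ρ ≤ ρ₀ →
    riemannianVolume n M (eball x (ENNReal.ofReal ρ)) ≤ ENNReal.ofReal (A * ρ) ^ n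
  le_volume : ∀ ρ : ℝ, 0 < ρ → ρ ≤ ρ₀ →
    ENNReal.ofReal ρ ^ n ≤ ENNReal.ofReal A ^ n * riemannianVolume n M (eball x (ENNReal.ofReal ρ))

lemma RegularAt.mono {A ρ₀ A' ρ₁ : ℝ} {x : M} (h : RegularAt n A ρ₀ x) (hA : A ≤ A')
    (hρ : ρ₁ ≤ ρ₀) : RegularAt n A' ρ₁ x where
  volume_le ρ h0 h1 := (h.volume_le ρ h0 (h1.trans hρ)).trans (by gcongr)
  le_volume ρ h0 h1 := (h.le_volume ρ h0 (h1.trans hρ)).trans (by gcongr)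

section Exists

variable [IsManifold (𝓡 n) ∞ M]
  [IsContinuousRiemannianBundle (EuclideanSpace ℝ (Fin n)) (fun x : M ↦ TangentSpace (𝓡 n) x)]
  [IsRiemannianManifold (𝓡 n) M] [BorelSpace M]

/-- The weight `f = 0` has vanishing averages, so the estimate for the measure of balls becomes
Ahlfors regularity of the Riemannian volume. -/
theorem exists_regularAt_local (hn : 1 ≤ n) (p : M) :
    ∃ ρ₀ : ℝ, 0 < ρ₀ ∧ ∃ A : ℝ, ∀ x : M, edist p x < ENNReal.ofReal ρ₀ → RegularAt n A ρ₀ x := by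
  obtain ⟨φ, B, -, hφ⟩ := exists_isAnnularKernel hn
  obtain ⟨R₀, L, h⟩ := exists_chartBounds (n := n) p
  have hL := h.one_le
  obtain ⟨R, r, hR, hb⟩ :=
    (h.mono h.pos le_rfl (le_self_pow₀ hL (by omega : n ≠ 0))).exists_bilipschitzChart
  have hr := hb.pos
  have hΨ : (extChartAt (𝓡 n) p).symm (extChartAt (𝓡 n) p p) = p := extChartAt_to_inv p
  obtain ⟨J, hJ⟩ := h.exists_weightModel hn hφ hb.radius_pos hR 0
  obtain ⟨ν, hν⟩ := hJ (fun _ ↦ 0) (fun _ ↦ 0) hasWeakDifferential_zero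
    (by rw [covectorLpNorm_zero]; exact zero_le)
  obtain ⟨K, hK1, hK⟩ := hb.exists_measure_ball_const hφ J
  refine ⟨r / 2, by positivity, K, fun x hx ↦ ?_⟩
  have hx' : edist ((extChartAt (𝓡 n) p).symm (extChartAt (𝓡 n) p p)) x < ENNReal.ofReal r := by
    rw [hΨ]
    exact hx.trans_le (ENNReal.ofReal_le_ofReal (by linarith))
  obtain ⟨y, hy, rfl⟩ := hb.exists_coord hx'
  have hR0 := hb.radius_pos
  have key := fun ρ h0 h1 ↦ hK _ _ ν hν y (closedBall_subset_closedBall (by linarith) hy)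
    (by rw [hΨ]; exact hx.le) ρ h0 h1
  have ha : ∀ ρ, scaleAverage φ (fun _ ↦ (0 : ℝ)) y ρ = 0 := fun ρ ↦ by simp [scaleAverage]
  simp only [conformalVolume_zero, ha, Real.exp_zero, mul_one] at key
  exact ⟨fun ρ h0 h1 ↦ (key ρ h0 h1).1, fun ρ h0 h1 ↦ (key ρ h0 h1).2⟩

variable (n M) in
theorem exists_regularAt [CompactSpace M] (hn : 1 ≤ n) :
    ∃ ρ₀ : ℝ, 0 < ρ₀ ∧ ∃ A : ℝ, 1 ≤ A ∧ ∀ x : M, RegularAt n A ρ₀ x := by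
  classical
  choose ρ hρ A h using fun p : M ↦ exists_regularAt_local hn p
  obtain ⟨t, ρ₀, hρ₀, hle, hcov⟩ := exists_finset_cover ρ hρ
  obtain ⟨b, hb⟩ := (insert 1 (t.image A)).exists_le
  refine ⟨ρ₀, hρ₀, b, hb 1 (by simp), fun x ↦ ?_⟩
  obtain ⟨p, hp, hx⟩ := hcov x
  exact (h p x hx).mono (hb _ (Finset.mem_insert_of_mem (Finset.mem_image_of_mem _ hp))) (hle p hp)

end Exists

lemma conformalVolume_le_of_le {f : M → ℝ} {S : Set M} (hS : MeasurableSet S) {s : ℝ}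
    (h : ∀ z ∈ S, f z ≤ s) :
    conformalVolume n f S ≤ ENNReal.ofReal (Real.exp s) ^ n * riemannianVolume n M S := by
  rw [conformalVolume, withDensity_apply _ hS, ← setLIntegral_const]
  refine setLIntegral_mono' hS fun z hz ↦ ?_
  rw [← ENNReal.ofReal_pow (Real.exp_nonneg _), ← Real.exp_nat_mul]
  gcongr
  exact h z hz

lemma le_conformalVolume_of_le {f : M → ℝ} {S : Set M} (hS : MeasurableSet S) {s : ℝ}
    (h : ∀ z ∈ S, s ≤ f z) :
    ENNReal.ofReal (Real.exp s) ^ n * riemannianVolume n M S ≤ conformalVolume n f S := by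
  rw [conformalVolume, withDensity_apply _ hS, ← setLIntegral_const]
  refine setLIntegral_mono' hS fun z hz ↦ ?_
  rw [← ENNReal.ofReal_pow (Real.exp_nonneg _), ← Real.exp_nat_mul]
  gcongr
  exact h z hz

variable [BorelSpace M] {A ρ₀ : ℝ} {f : M → ℝ} {x y : M}

/-- On the ball around `x` containing the midpoint ball the weight is at most `exp (n (f x + 1))`,
and the volume is at most `(A ρ)^n`. -/
lemma ballGauge_le_of_osc (hn : 1 ≤ n) (hmid : HasMidpoints M) (hA : 1 ≤ A)
    (hreg : RegularAt n A ρ₀ x) (hxy : edist x y ≤ ENNReal.ofReal ρ₀)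
    (hosc : ∀ z, edist x z ≤ edist x y → |f x - f z| ≤ 1) :
    ballGauge n f x y ≤ ENNReal.ofReal (gaugeFactor n * (Real.exp 1 * A)) *
      (ENNReal.ofReal (Real.exp (f x)) * edist x y) := by
  rcases eq_or_ne (edist x y) 0 with h0 | h0
  · refine (ballGauge_le_of_measure_le hn hmid (t := 0) (b := 0) (by simp) h0.le ?_).trans ?_
    · simp
    · simp
  have htop : edist x y ≠ ⊤ := ne_top_of_le_ne_top ENNReal.ofReal_ne_top hxy
  set ρ := (edist x y).toReal with hρ
  have hρe : edist x y = ENNReal.ofReal ρ := (ENNReal.ofReal_toReal htop).symm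
  have hρ0 : 0 < ρ := ENNReal.toReal_pos h0 htop
  have hρ₀ : 0 ≤ ρ₀ := by
    by_contra hneg
    rw [ENNReal.ofReal_of_nonpos (by linarith)] at hxy
    exact h0 (le_antisymm hxy zero_le)
  rw [hρe, ENNReal.ofReal_le_ofReal_iff hρ₀] at hxy
  have h1 : conformalVolume n f (eball x (ENNReal.ofReal ρ)) ≤
      (ENNReal.ofReal (Real.exp (f x + 1)) * ENNReal.ofReal (A * ρ)) ^ n := by
    refine (conformalVolume_le_of_le isOpen_eball.measurableSet (s := f x + 1)
      fun z hz ↦ ?_).trans ?_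
    · rw [mem_eball, edist_comm, ← hρe] at hz
      linarith [(abs_le.1 (hosc z hz.le)).1]
    · rw [mul_pow]
      gcongr
      exact hreg.volume_le ρ hρ0 hxy
  refine (ballGauge_le_of_measure_le hn hmid ENNReal.ofReal_ne_top hρe.le h1).trans_eq ?_
  have hg := gaugeFactor_pos n
  rw [hρe, ← ENNReal.ofReal_mul (Real.exp_nonneg _), ← ENNReal.ofReal_mul hg.le,
    ← ENNReal.ofReal_mul (Real.exp_nonneg _), ← ENNReal.ofReal_mul (by positivity), Real.exp_add]
  congr 1
  ring

/-- The regularity is applied at the unknown midpoint, hence assumed at all points. The factor `2`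
comes from the radius `ρ / 2` of the midpoint ball. -/
lemma le_ballGauge_of_osc (hn : 1 ≤ n) (hA : 1 ≤ A)
    (hreg : ∀ z : M, RegularAt n A ρ₀ z) (hxy : edist x y ≤ ENNReal.ofReal ρ₀)
    (hosc : ∀ z, edist x z ≤ edist x y → |f x - f z| ≤ 1) :
    ENNReal.ofReal (Real.exp (f x)) * edist x y ≤
      ENNReal.ofReal (2 * (Real.exp 1 * A) / gaugeFactor n) * ballGauge n f x y := by
  have hg := gaugeFactor_pos n
  have htop : edist x y ≠ ⊤ := ne_top_of_le_ne_top ENNReal.ofReal_ne_top hxy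
  rcases eq_or_ne (edist x y) 0 with h0 | h0
  · simp [h0]
  set ρ := (edist x y).toReal with hρ
  have hρe : edist x y = ENNReal.ofReal ρ := (ENNReal.ofReal_toReal htop).symm
  have hρ0 : 0 < ρ := ENNReal.toReal_pos h0 htop
  have hρ₀ : 0 ≤ ρ₀ := by
    by_contra hneg
    rw [ENNReal.ofReal_of_nonpos (by linarith)] at hxy
    exact h0 (le_antisymm hxy zero_le)
  rw [hρe, ENNReal.ofReal_le_ofReal_iff hρ₀] at hxy
  have hhalf : edist x y / 2 = ENNReal.ofReal (ρ / 2) := by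
    rw [hρe, ENNReal.ofReal_div_of_pos (by norm_num), ENNReal.ofReal_ofNat]
  have hgauge : ENNReal.ofReal (gaugeFactor n * (Real.exp (f x - 1) / A * (ρ / 2))) ≤
      ballGauge n f x y := by
    refine le_iInf₂ fun m hm ↦ ?_
    rw [hhalf] at hm ⊢
    rw [gauge_eq, ENNReal.ofReal_mul hg.le]
    gcongr
    refine le_rpow_inv_of_pow_le hn ?_
    have h1 : ENNReal.ofReal (Real.exp (f x - 1)) ^ n *
        riemannianVolume n M (eball m (ENNReal.ofReal (ρ / 2))) ≤
        conformalVolume n f (eball m (ENNReal.ofReal (ρ / 2))) := by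
      refine le_conformalVolume_of_le isOpen_eball.measurableSet fun z hz ↦ ?_
      have h2 : edist x z ≤ edist x y := by
        rw [mem_eball] at hz
        calc edist x z ≤ edist m x + edist z m := by
              rw [add_comm, edist_comm x z]
              exact edist_triangle _ _ _
          _ ≤ edist x y / 2 + edist x y / 2 := by
              rw [hhalf]
              exact add_le_add hm.1.le hz.le
          _ = _ := ENNReal.add_halves _
      linarith [(abs_le.1 (hosc z h2)).2]
    refine le_trans ?_ h1
    have h3 := ofReal_div_pow_le (by linarith) ((hreg m).le_volume (ρ / 2) (by positivity)
      (by linarith))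
    calc ENNReal.ofReal (Real.exp (f x - 1) / A * (ρ / 2)) ^ n
        = ENNReal.ofReal (Real.exp (f x - 1)) ^ n * ENNReal.ofReal (ρ / 2 / A) ^ n := by
          rw [← mul_pow, ← ENNReal.ofReal_mul (Real.exp_nonneg _)]
          congr 2
          ring
      _ ≤ _ := by gcongr
  calc ENNReal.ofReal (Real.exp (f x)) * edist x y
      = ENNReal.ofReal (2 * (Real.exp 1 * A) / gaugeFactor n) *
          ENNReal.ofReal (gaugeFactor n * (Real.exp (f x - 1) / A * (ρ / 2))) := by
        rw [hρe, ← ENNReal.ofReal_mul (Real.exp_nonneg _), ← ENNReal.ofReal_mul (by positivity),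
          Real.exp_sub]
        congr 1
        have := Real.exp_pos 1
        field_simp
    _ ≤ _ := by gcongr

end Regularity

/-! ### The two distances for continuous `f`. -/

section Conformal

variable {n : ℕ} {M : Type*} [EMetricSpace M] [ChartedSpace (EuclideanSpace ℝ (Fin n)) M]
  [RiemannianBundle (fun x : M ↦ TangentSpace (𝓡 n) x)]

/-- The norm `e^f |·|` on tangent vectors. -/
abbrev conformalENorm (f : M → ℝ) (z : M) : ENorm (TangentSpace (𝓡 n) z) :=
  ⟨fun v ↦ ENNReal.ofReal (Real.exp (f z)) * ‖v‖ₑ⟩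

lemma conformalENorm_smul (f : M → ℝ) (z : M) :
    @ENormSMulClass ℝ (TangentSpace (𝓡 n) z) _ (conformalENorm f z) _ :=
  @ENormSMulClass.mk ℝ (TangentSpace (𝓡 n) z) _ (conformalENorm f z) _ fun r v ↦ by
    change ENNReal.ofReal (Real.exp (f z)) * ‖r • v‖ₑ =
      ‖r‖ₑ * (ENNReal.ofReal (Real.exp (f z)) * ‖v‖ₑ)
    rw [enorm_smul, mul_left_comm]

variable (n) in
/-- The length of the path `γ` on `[a, b]` for the metric `e^{2f} g₀`. -/
def conformalLength (f : M → ℝ) (γ : ℝ → M) (a b : ℝ) : ℝ≥0∞ :=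
  ∫⁻ t in Icc a b, ENNReal.ofReal (Real.exp (f (γ t))) * ‖mfderiv 𝓘(ℝ, ℝ) (𝓡 n) γ t 1‖ₑ

lemma pathELength_conformalENorm (f : M → ℝ) (γ : ℝ → M) (a b : ℝ) :
    @pathELength _ _ _ _ _ (𝓡 n) M _ _ (conformalENorm f) γ a b = conformalLength n f γ a b := by
  rw [@pathELength_eq_lintegral_mfderiv_Icc]
  rfl

variable {f : M → ℝ} {x y z : M}

lemma conformalEDist_self : conformalEDist n f x x = 0 := by
  let _ := fun z : M ↦ conformalENorm (n := n) f z
  have := fun z : M ↦ conformalENorm_smul (n := n) f z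
  exact riemannianEDist_self

lemma conformalEDist_triangle :
    conformalEDist n f x z ≤ conformalEDist n f x y + conformalEDist n f y z := by
  let _ := fun z : M ↦ conformalENorm (n := n) f z
  have := fun z : M ↦ conformalENorm_smul (n := n) f z
  exact riemannianEDist_triangle

lemma conformalEDist_le_conformalLength {γ : ℝ → M} {a b : ℝ}
    (hγ : ContMDiffOn 𝓘(ℝ, ℝ) (𝓡 n) 1 γ (Icc a b)) (ha : γ a = x) (hb : γ b = y) (hab : a ≤ b) :
    conformalEDist n f x y ≤ conformalLength n f γ a b := by
  rw [← pathELength_conformalENorm]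
  let _ := fun z : M ↦ conformalENorm (n := n) f z
  have := fun z : M ↦ conformalENorm_smul (n := n) f z
  exact riemannianEDist_le_pathELength hγ ha hb hab

lemma exists_conformalLength_lt {r : ℝ≥0∞} (hr : conformalEDist n f x y < r) :
    ∃ γ : ℝ → M, γ 0 = x ∧ γ 1 = y ∧ ContMDiffOn 𝓘(ℝ, ℝ) (𝓡 n) 1 γ (Icc 0 1) ∧
      conformalLength n f γ 0 1 < r := by
  simp only [← pathELength_conformalENorm]
  let _ := fun z : M ↦ conformalENorm (n := n) f z
  exact exists_lt_of_riemannianEDist_lt hr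

lemma conformalLength_add {γ : ℝ → M} {a b c : ℝ} (hab : a ≤ b) (hbc : b ≤ c) :
    conformalLength n f γ a b + conformalLength n f γ b c = conformalLength n f γ a c := by
  simp only [← pathELength_conformalENorm]
  exact @pathELength_add _ _ _ _ _ (𝓡 n) M _ _ (conformalENorm f) _ _ _ _ hab hbc

lemma conformalLength_le {γ : ℝ → M} {a b s : ℝ} (h : ∀ t ∈ Icc a b, f (γ t) ≤ s) :
    conformalLength n f γ a b ≤ ENNReal.ofReal (Real.exp s) * pathELength (𝓡 n) γ a b := by
  rw [pathELength_eq_lintegral_mfderiv_Icc, ← lintegral_const_mul' _ _ ENNReal.ofReal_ne_top]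
  refine setLIntegral_mono' measurableSet_Icc fun t ht ↦ ?_
  gcongr
  exact h t ht

lemma le_conformalLength {γ : ℝ → M} {a b s : ℝ} (h : ∀ t ∈ Icc a b, s ≤ f (γ t)) :
    ENNReal.ofReal (Real.exp s) * pathELength (𝓡 n) γ a b ≤ conformalLength n f γ a b := by
  rw [pathELength_eq_lintegral_mfderiv_Icc, ← lintegral_const_mul' _ _ ENNReal.ofReal_ne_top]
  refine setLIntegral_mono' measurableSet_Icc fun t ht ↦ ?_
  gcongr
  exact h t ht

lemma sum_conformalLength (γ : ℝ → M) (N : ℕ) (s : ℝ) (hs : 0 ≤ s) :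
    ∑ i ∈ Finset.range N, conformalLength n f γ (i * s) ((i + 1) * s) ≤
      conformalLength n f γ 0 (N * s) := by
  induction N with
  | zero => simp
  | succ N ih =>
    rw [Finset.sum_range_succ, Nat.cast_succ,
      ← conformalLength_add (a := 0) (b := N * s) (c := (N + 1) * s) (by positivity)
        (by nlinarith)]
    gcongr

lemma conformalEDist_le_sum (p : ℕ → M) (N : ℕ) :
    conformalEDist n f (p 0) (p N) ≤ ∑ i ∈ Finset.range N, conformalEDist n f (p i) (p (i + 1)) := by
  induction N with
  | zero => simp [conformalEDist_self]
  | succ N ih =>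
    rw [Finset.sum_range_succ]
    exact conformalEDist_triangle.trans (by gcongr)

lemma exists_osc_le_one [CompactSpace M] (hf : Continuous f) :
    ∃ δ : ℝ, 0 < δ ∧ ∀ a b : M, edist a b ≤ ENNReal.ofReal δ → |f a - f b| ≤ 1 := by
  have hu := CompactSpace.uniformContinuous_of_continuous hf
  obtain ⟨δ, hδ, h⟩ := EMetric.uniformContinuous_iff.1 hu 1 one_pos
  refine ⟨(min δ 1).toReal / 2, by
    have := ENNReal.toReal_pos (a := min δ 1) (by simp [hδ.ne']) (by simp)
    positivity, fun a b hab ↦ ?_⟩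
  have h1 : edist a b < δ := by
    refine hab.trans_lt (lt_of_lt_of_le ?_ (min_le_left δ 1))
    have h2 : (min δ 1).toReal / 2 < (min δ 1).toReal :=
      half_lt_self (ENNReal.toReal_pos (by simp [hδ.ne']) (by simp))
    calc ENNReal.ofReal ((min δ 1).toReal / 2) < ENNReal.ofReal (min δ 1).toReal :=
          ENNReal.ofReal_lt_ofReal_iff_of_nonneg (by positivity) |>.2 h2
      _ = min δ 1 := ENNReal.ofReal_toReal (by simp)
  have h3 := h h1
  rw [edist_dist, ENNReal.ofReal_lt_one, Real.dist_eq] at h3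
  exact h3.le

variable [IsRiemannianManifold (𝓡 n) M] {δ : ℝ}

/-- An almost minimal path for `g₀`, of length below `δ`, stays where `f ≤ f x + 1`, and so is a
good competitor for `g_f`. -/
lemma conformalEDist_le_of_osc (hδ : 0 < δ)
    (hosc : ∀ a b : M, edist a b ≤ ENNReal.ofReal δ → |f a - f b| ≤ 1)
    (hxy : edist x y ≤ ENNReal.ofReal (δ / 2)) :
    conformalEDist n f x y ≤ ENNReal.ofReal (Real.exp (f x + 1)) * edist x y := by
  have hlt : edist x y < ENNReal.ofReal δ :=
    hxy.trans_lt ((ENNReal.ofReal_lt_ofReal_iff hδ).2 (by linarith))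
  have he : ENNReal.ofReal (Real.exp (f x + 1)) ≠ 0 := (ENNReal.ofReal_pos.2 (Real.exp_pos _)).ne'
  rw [mul_comm, ← ENNReal.div_le_iff he ENNReal.ofReal_ne_top]
  refine le_of_forall_gt_imp_ge_of_dense fun t ht ↦ ?_
  rw [ENNReal.div_le_iff he ENNReal.ofReal_ne_top, mul_comm]
  have ht' := lt_min ht hlt
  rw [IsRiemannianManifold.out (I := 𝓡 n)] at ht'
  obtain ⟨γ, h0, h1, hγ, hl⟩ := exists_lt_of_riemannianEDist_lt ht'
  refine (conformalEDist_le_conformalLength hγ h0 h1 zero_le_one).trans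
    ((conformalLength_le (s := f x + 1) fun s hs ↦ ?_).trans ?_)
  · have h2 := edist_le_of_pathELength_le hγ hl.le hs
    rw [h0] at h2
    linarith [(abs_le.1 (hosc _ _ (h2.trans (min_le_right _ _)))).1]
  · gcongr
    exact hl.le.trans (min_le_left _ _)

variable [MeasurableSpace M] [BorelSpace M] {A ρ₀ : ℝ}

/-- For one sufficiently small `ε`, each step of any chain bounds the conformal distance of its end
points. The scale depends on `δ`, the constant does not. -/
theorem conformalEDist_le_weightEDist (hn : 1 ≤ n) (hA : 1 ≤ A) (hρ₀ : 0 < ρ₀)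
    (hreg : ∀ z : M, RegularAt n A ρ₀ z) (hδ : 0 < δ)
    (hosc : ∀ a b : M, edist a b ≤ ENNReal.ofReal δ → |f a - f b| ≤ 1) (x y : M) :
    conformalEDist n f x y ≤
      ENNReal.ofReal (Real.exp 1 * (2 * (Real.exp 1 * A) / gaugeFactor n)) *
        weightEDist n f x y := by
  have hg := gaugeFactor_pos n
  set C : ℝ := Real.exp 1 * (2 * (Real.exp 1 * A) / gaugeFactor n) with hC
  set ε : ℝ := min (δ / 2) ρ₀ with hε
  have hε0 : 0 < ε := lt_min (by positivity) hρ₀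
  have hw : (⨅ (N : ℕ) (p : ℕ → M)
      (_ : p 0 = x ∧ p N = y ∧ ∀ i < N, edist (p i) (p (i + 1)) ≤ ENNReal.ofReal ε),
      ∑ i ∈ Finset.range N, ballGauge n f (p i) (p (i + 1))) ≤ weightEDist n f x y :=
    le_iSup₂ (f := fun (ε : ℝ≥0∞) (_ : 0 < ε) ↦ ⨅ (N : ℕ) (p : ℕ → M)
      (_ : p 0 = x ∧ p N = y ∧ ∀ i < N, edist (p i) (p (i + 1)) ≤ ε),
      ∑ i ∈ Finset.range N, ballGauge n f (p i) (p (i + 1))) _ (ENNReal.ofReal_pos.2 hε0)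
  refine le_trans ?_ (mul_le_mul_right hw _)
  have hC0 : 0 < C := by positivity
  rw [mul_comm, ← ENNReal.div_le_iff (ENNReal.ofReal_pos.2 hC0).ne' ENNReal.ofReal_ne_top]
  refine le_iInf fun N ↦ le_iInf₂ fun p hp ↦ ?_
  rw [ENNReal.div_le_iff (ENNReal.ofReal_pos.2 hC0).ne' ENNReal.ofReal_ne_top, mul_comm]
  obtain ⟨rfl, rfl, hstep⟩ := hp
  refine (conformalEDist_le_sum p N).trans ?_
  rw [Finset.mul_sum]
  refine Finset.sum_le_sum fun i hi ↦ ?_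
  have hs := hstep i (Finset.mem_range.1 hi)
  have hs1 : edist (p i) (p (i + 1)) ≤ ENNReal.ofReal (δ / 2) :=
    hs.trans (ENNReal.ofReal_le_ofReal (min_le_left _ _))
  have hs2 : edist (p i) (p (i + 1)) ≤ ENNReal.ofReal ρ₀ :=
    hs.trans (ENNReal.ofReal_le_ofReal (min_le_right _ _))
  refine (conformalEDist_le_of_osc hδ hosc hs1).trans ?_
  rw [hC, ENNReal.ofReal_mul (Real.exp_nonneg _), mul_assoc, add_comm, Real.exp_add,
    ENNReal.ofReal_mul (Real.exp_nonneg _), mul_assoc]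
  exact mul_le_mul_right (le_ballGauge_of_osc hn hA hreg hs2 fun z hz ↦
    hosc _ _ ((hz.trans hs1).trans (ENNReal.ofReal_le_ofReal (by linarith)))) _

/-- An almost minimal path for `g_f`, cut into short pieces, provides chains as fine as required; on
each piece `f` is within one of its value at the start. Again `δ` does not enter the constant. -/
theorem weightEDist_le_conformalEDist (hn : 1 ≤ n) (hmid : HasMidpoints M) (hA : 1 ≤ A)
    (hρ₀ : 0 < ρ₀) (hreg : ∀ z : M, RegularAt n A ρ₀ z) (hδ : 0 < δ)
    (hosc : ∀ a b : M, edist a b ≤ ENNReal.ofReal δ → |f a - f b| ≤ 1) (x y : M) :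
    weightEDist n f x y ≤
      ENNReal.ofReal (gaugeFactor n * (Real.exp 1 * A) * Real.exp 1) * conformalEDist n f x y := by
  have hg := gaugeFactor_pos n
  set C : ℝ := gaugeFactor n * (Real.exp 1 * A) * Real.exp 1 with hC
  have hC0 : 0 < C := by positivity
  rw [mul_comm, ← ENNReal.div_le_iff (ENNReal.ofReal_pos.2 hC0).ne' ENNReal.ofReal_ne_top]
  refine le_of_forall_gt_imp_ge_of_dense fun l hl ↦ ?_
  rw [ENNReal.div_le_iff (ENNReal.ofReal_pos.2 hC0).ne' ENNReal.ofReal_ne_top, mul_comm]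
  obtain ⟨γ, h0, h1, hγ, hlen⟩ := exists_conformalLength_lt hl
  refine iSup₂_le fun ε hε ↦ ?_
  -- Steps this small are admissible for the given `ε`, and allow both volume regularity and the
  -- oscillation bound.
  set ε' : ℝ≥0∞ := min ε (ENNReal.ofReal (min δ ρ₀)) with hε'
  have hε'0 : 0 < ε' := lt_min hε (ENNReal.ofReal_pos.2 (lt_min hδ hρ₀))
  have hu := isCompact_Icc.uniformContinuousOn_of_continuous hγ.continuousOn
  obtain ⟨τ, hτ, hclose⟩ := EMetric.uniformContinuousOn_iff.1 hu ε' hε'0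
  have hclose' : ∃ s : ℝ, 0 < s ∧ ∀ a ∈ Icc (0 : ℝ) 1, ∀ b ∈ Icc (0 : ℝ) 1, |a - b| ≤ s →
      edist (γ a) (γ b) ≤ ε' := by
    refine ⟨(min τ 1).toReal / 2, by
      have := ENNReal.toReal_pos (a := min τ 1) (by simp [hτ.ne']) (by simp)
      positivity, fun a ha b hb hab ↦ (hclose ha hb ?_).le⟩
    have h2 : (min τ 1).toReal / 2 < (min τ 1).toReal :=
      half_lt_self (ENNReal.toReal_pos (by simp [hτ.ne']) (by simp))
    calc edist a b = ENNReal.ofReal |a - b| := by rw [edist_dist, Real.dist_eq]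
      _ < ENNReal.ofReal (min τ 1).toReal :=
          (ENNReal.ofReal_lt_ofReal_iff_of_nonneg (abs_nonneg _)).2 (hab.trans_lt h2)
      _ = min τ 1 := ENNReal.ofReal_toReal (by simp)
      _ ≤ τ := min_le_left _ _
  obtain ⟨s, hs, hclose'⟩ := hclose'
  obtain ⟨k, hk⟩ := exists_nat_gt s⁻¹
  have hk0 : (0 : ℝ) < k := (inv_pos.2 hs).trans hk
  have hks : (k : ℝ)⁻¹ ≤ s := (inv_lt_of_inv_lt₀ hs hk).le
  set p : ℕ → M := fun i ↦ γ (i * (k : ℝ)⁻¹) with hp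
  have hmem : ∀ i ≤ k, (i : ℝ) * (k : ℝ)⁻¹ ∈ Icc (0 : ℝ) 1 := fun i hi ↦ by
    refine ⟨by positivity, ?_⟩
    rw [mul_inv_le_iff₀ hk0, one_mul]
    exact_mod_cast hi
  have hkk : (k : ℝ) * (k : ℝ)⁻¹ = 1 := mul_inv_cancel₀ hk0.ne'
  have hseg : ∀ i < k, ∀ t ∈ Icc ((i : ℝ) * (k : ℝ)⁻¹) ((i + 1) * (k : ℝ)⁻¹),
      t ∈ Icc (0 : ℝ) 1 ∧ edist (p i) (γ t) ≤ ε' := fun i hi t ht ↦ by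
    have h2 := hmem i hi.le
    have h3 := hmem (i + 1) hi
    push_cast at h3
    have ht1 : t ∈ Icc (0 : ℝ) 1 := ⟨h2.1.trans ht.1, ht.2.trans h3.2⟩
    refine ⟨ht1, hclose' _ h2 _ ht1 ?_⟩
    rw [abs_le]
    constructor <;> nlinarith [ht.1, ht.2]
  have hnext : ∀ i : ℕ, p (i + 1) = γ ((i + 1) * (k : ℝ)⁻¹) := fun i ↦ by simp [hp]
  have hle : ∀ i : ℕ, (i : ℝ) * (k : ℝ)⁻¹ ≤ (i + 1) * (k : ℝ)⁻¹ := fun i ↦ by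
    have := inv_pos.2 hk0
    nlinarith
  have hsteps : ∀ i < k, edist (p i) (p (i + 1)) ≤ ε' := fun i hi ↦ by
    rw [hnext]
    exact (hseg i hi _ ⟨hle i, le_rfl⟩).2
  refine (iInf_le _ k).trans ((iInf₂_le p ⟨by simp [hp, h0], by simp only [hp, hkk, h1],
    fun i hi ↦ (hsteps i hi).trans (min_le_left _ _)⟩).trans ?_)
  have hδ' : ε' ≤ ENNReal.ofReal δ :=
    (min_le_right _ _).trans (ENNReal.ofReal_le_ofReal (min_le_left _ _))
  have hρ' : ε' ≤ ENNReal.ofReal ρ₀ :=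
    (min_le_right _ _).trans (ENNReal.ofReal_le_ofReal (min_le_right _ _))
  have hone : ∀ i < k, ballGauge n f (p i) (p (i + 1)) ≤ ENNReal.ofReal C *
      conformalLength n f γ (i * (k : ℝ)⁻¹) ((i + 1) * (k : ℝ)⁻¹) := by
    intro i hi
    refine (ballGauge_le_of_osc hn hmid hA (hreg _) ((hsteps i hi).trans hρ')
      fun z hz ↦ hosc _ _ ((hz.trans (hsteps i hi)).trans hδ')).trans ?_
    have h4 : ENNReal.ofReal (Real.exp (f (p i) - 1)) *
        pathELength (𝓡 n) γ (i * (k : ℝ)⁻¹) ((i + 1) * (k : ℝ)⁻¹) ≤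
        conformalLength n f γ (i * (k : ℝ)⁻¹) ((i + 1) * (k : ℝ)⁻¹) :=
      le_conformalLength fun t ht ↦ by
        linarith [(abs_le.1 (hosc _ _ ((hseg i hi t ht).2.trans hδ'))).2]
    have h5 : edist (p i) (p (i + 1)) ≤
        pathELength (𝓡 n) γ (i * (k : ℝ)⁻¹) ((i + 1) * (k : ℝ)⁻¹) := by
      rw [hnext]
      have h6 := (hmem (i + 1) hi).2
      push_cast at h6
      exact edist_le_pathELength hγ (hmem i hi.le).1 (hle i) h6
    have h7 : Real.exp (f (p i)) = Real.exp 1 * Real.exp (f (p i) - 1) := by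
      rw [← Real.exp_add]
      congr 1
      ring
    rw [hC, ENNReal.ofReal_mul (p := gaugeFactor n * (Real.exp 1 * A)) (by positivity), h7,
      ENNReal.ofReal_mul (Real.exp_nonneg _), mul_assoc, mul_assoc]
    gcongr
    exact (by gcongr : _ ≤ _).trans h4
  calc ∑ i ∈ Finset.range k, ballGauge n f (p i) (p (i + 1))
      ≤ ∑ i ∈ Finset.range k, ENNReal.ofReal C *
          conformalLength n f γ (i * (k : ℝ)⁻¹) ((i + 1) * (k : ℝ)⁻¹) :=
        Finset.sum_le_sum fun i hi ↦ hone i (Finset.mem_range.1 hi)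
    _ = ENNReal.ofReal C * ∑ i ∈ Finset.range k,
          conformalLength n f γ (i * (k : ℝ)⁻¹) ((i + 1) * (k : ℝ)⁻¹) := (Finset.mul_sum _ _ _).symm
    _ ≤ ENNReal.ofReal C * conformalLength n f γ 0 1 := by
        gcongr
        refine (sum_conformalLength γ k _ (by positivity)).trans ?_
        rw [hkk]
    _ ≤ ENNReal.ofReal C * l := by gcongr

end Conformal

end ConformalWeight

end

/-! ### Conclusion. -/

theorem mainTheorem8 (n : ℕ) (hn : 1 ≤ n)
    (M : Type*) [EMetricSpace M] [CompactSpace M]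
    [ChartedSpace (EuclideanSpace ℝ (Fin n)) M] [IsManifold (𝓡 n) ∞ M]
    [RiemannianBundle (fun x : M ↦ TangentSpace (𝓡 n) x)]
    [IsContMDiffRiemannianBundle (𝓡 n) ∞ (EuclideanSpace ℝ (Fin n))
      (fun x : M ↦ TangentSpace (𝓡 n) x)]
    [IsRiemannianManifold (𝓡 n) M]
    [MeasurableSpace M] [BorelSpace M] :
    ∃ η : ℝ, 0 < η ∧ ∀ I : ℝ, ∃ θ : ℝ, 0 < θ ∧
      ∀ (f : M → ℝ) (df : (x : M) → TangentSpace (𝓡 n) x →L[ℝ] ℝ),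
        ConformalWeight.HasWeakDifferential f df →
        ConformalWeight.covectorLpNorm df ≤ ENNReal.ofReal I →
          ConformalWeight.IsStrongAInftyWeight n f (ConformalWeight.weightEDist n f) θ η ∧
          (Continuous f →
            ConformalWeight.IsStrongAInftyWeight n f (ConformalWeight.conformalEDist n f) θ η) := by
  have : IsContinuousRiemannianBundle (EuclideanSpace ℝ (Fin n))
      (fun x : M ↦ TangentSpace (𝓡 n) x) :=
    ConformalWeight.isContinuousRiemannianBundle_of_contMDiff
  obtain ⟨η, hη, h⟩ := ConformalWeight.exists_goodAt M hn
  obtain ⟨ρ₀, hρ₀, A, hA, hreg⟩ := ConformalWeight.exists_regularAt n M hn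
  -- One constant for both comparisons of the two distances. It only involves `n` and the regularity
  -- constant of the manifold, so it precedes `I` and `f`.
  obtain ⟨C, hC1, hC₁, hC₂⟩ : ∃ C : ℝ, 1 ≤ C ∧
      Real.exp 1 * (2 * (Real.exp 1 * A) / ConformalWeight.gaugeFactor n) ≤ C ∧
      ConformalWeight.gaugeFactor n * (Real.exp 1 * A) * Real.exp 1 ≤ C :=
    ⟨max 1 (max _ _), le_max_left _ _, (le_max_left _ _).trans (le_max_right _ _),
      (le_max_right _ _).trans (le_max_right _ _)⟩
  refine ⟨η, hη, fun I ↦ ?_⟩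
  obtain ⟨K, hK1, hK⟩ := h I
  have hCK : K ≤ C * K := le_mul_of_one_le_left (by linarith) hC1
  refine ⟨(C * K) ^ n, by positivity, fun f df hw hI ↦ ⟨?_, fun hf ↦ ?_⟩⟩
  · exact ConformalWeight.isStrongAInftyWeight_of_goodAt hn hη (hK1.trans hCK)
      fun x ↦ (hK f df hw hI x).mono hCK le_rfl
  -- `δ` depends on the modulus of continuity of `f`, but no constant below depends on `δ`.
  · obtain ⟨δ, hδ, hosc⟩ := ConformalWeight.exists_osc_le_one hf
    refine ConformalWeight.isStrongAInftyWeight_of_goodAt hn hη (hK1.trans hCK) fun x ↦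
      (hK f df hw hI x).congr hC1 (by linarith) (fun y _ ↦ ?_) fun y _ ↦ ?_
    · refine (ConformalWeight.conformalEDist_le_weightEDist hn hA hρ₀ hreg hδ hosc x y).trans ?_
      gcongr
    · refine (ConformalWeight.weightEDist_le_conformalEDist hn (ConformalWeight.hasMidpoints n)
        hA hρ₀ hreg hδ hosc x y).trans ?_
      gcongr
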